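/- Max 3SAT: an instance is a 3CNF formula, i.e. a list of clauses, each of them the OR of at most three literals; the goal is a truth assignment that satisfies as many clauses as possible. An algorithm is $\rho$-approximate ($\rho\ge 1$) if on every formula $\varphi$ it outputs an assignment satisfying at least $\mathrm{opt}(\varphi)/\rho$ clauses. $\mathrm{PCP}[r(n),q(n)]$ is the class of languages $L$ that have a probabilistic polynomial-time verifier which on every input of length $n$, given oracle access to a witness string $w$, uses at most $r(n)$ random bits and makes at most $q(n)$ queries into $w$, such that for $x\in L$ some $w$ makes it accept $x$ with probability $1$, and for $x\notin L$ every $w$ makes it accept $x$ with probability at most $1/2$. **Theorem.** (1) The PCP Theorem, i.e. the equality $\mathrm{NP}=\mathrm{PCP}[O(\log n),O(1)]$, implies that there is an $\varepsilon_1>0$ such that there is no polynomial-time $(1+\varepsilon_1)$-approximate algorithm for Max 3SAT, unless $\mathrm{P}=\mathrm{NP}$. (2) More precisely, let $q\ge 1$ be a constant, $L\in\mathrm{PCP}[O(\log n),q]$ and $\varepsilon_1=\frac{1}{2q\,2^q}$. Then there is a polynomial-time computable map $x\mapsto\varphi_x$ from binary strings to 3CNF formulas such that $\varphi_x$ has $m\ge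 1$ clauses ($m$ depending on $x$); if $x\in L$, then $\varphi_x$ is satisfiable; and if $x\notin L$, then no assignment satisfies more than $(1-\varepsilon_1)m$ clauses of $\varphi_x$. If moreover $L$ is $\mathrm{NP}$-complete, then there is no polynomial-time $(1+\varepsilon_1)$-approximate algorithm for Max 3SAT, unless $\mathrm{P}=\mathrm{NP}$. -/

import Mathlib

namespace Inapprox

open Computability Turing Filter Asymptotics

/-! ### Polynomial time, P, NP, NP-completeness -/

/-- `f` is computed by a deterministic (multi-stack) Turing machine in time polynomial in the length
of the encoded input. -/
def PolyTime {α β Γ₀ Γ₁ : Type} (ea : α → List Γ₀) (eb : β → List Γ₁) (f : α → β) : Prop :=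
  Nonempty (TM2ComputableInPolyTime ea eb f)

/-- A binary string is its own encoding. -/
def encodeStr : List Bool → List Bool := id

/-- A pair of binary strings, written one after the other in two disjoint copies of the binary
alphabet. -/
def encodePair : List Bool × List Bool → List (Bool ⊕ Bool) :=
  (encodingProd (encodingList Bool) (encodingList Bool)).encode

/-- A triple of binary strings, in three disjoint copies of the binary alphabet. -/
def encodeTriple : List Bool × List Bool × List Bool → List (Bool ⊕ (Bool ⊕ Bool)) :=
  (encodingProd (encodingList Bool)
    (encodingProd (encodingList Bool) (encodingList Bool))).encode

/-- The class P of languages decidable in polynomial time. -/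
def P : Set (Language Bool) :=
  {L | ∃ f : List Bool → Bool, PolyTime encodeStr encodeBool f ∧ ∀ x, x ∈ L ↔ f x = true}

/-- The class NP of languages with polynomial-time checkable witnesses of polynomial length. -/
def NP : Set (Language Bool) :=
  {L | ∃ (V : List Bool × List Bool → Bool) (p : Polynomial ℕ), PolyTime encodePair encodeBool V ∧
    ∀ x, x ∈ L ↔ ∃ w : List Bool, w.length ≤ p.eval x.length ∧ V (x, w) = true}

/-- Polynomial-time many-one reducibility. -/
def Reduces (L₁ L₂ : Language Bool) : Prop :=
  ∃ f : List Bool → List Bool, PolyTime encodeStr encodeStr f ∧ ∀ x, x ∈ L₁ ↔ f x ∈ L₂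

/-- NP-completeness. -/
def NPComplete (L : Language Bool) : Prop :=
  L ∈ NP ∧ ∀ L' ∈ NP, Reduces L' L

/-! ### Probabilistically checkable proofs -/

/-- What a verifier does next: halt (accepting or rejecting), read the next random bit, or query the
bit of the witness at position `i`. -/
inductive Move where
  | halt (accept : Bool)
  | toss
  | query (i : ℕ)

/-- Binary encoding of moves; positions are written in binary. -/
def encodeMove : Move → List Bool
  | .halt b => [false, b]
  | .toss => [true, false]
  | .query i => true :: true :: encodeNat i

/-- A verifier program: it determines the next move from the input, the random bits read so far and
the answers to the witness queries made so far (both in chronological order). -/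
abbrev Program := List Bool × List Bool × List Bool → Move

/-- Run `V` on input `x` with random bits `R 0, R 1, …` and oracle access to the witness `w`, for at
most the given number of moves, from a state in which the random bits `c` have been read and the
answers `a` have been received. If `V` halts, return its verdict, the number of random bits read, and
the number of queries made. (Positions outside of `w` are answered by `false`.) -/
def exec (V : Program) (x : List Bool) (R : ℕ → Bool) (w : List Bool) :
    ℕ → List Bool → List Bool → Option (Bool × ℕ × ℕ)
  | 0, _, _ => none
  | k + 1, c, a =>
    match V (x, c, a) with
    | .halt b => some (b, c.length, a.length)
    | .toss => exec V x R w k (c ++ [R c.length]) a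
    | .query i => exec V x R w k c (a ++ [w.getD i false])

/-- A polynomial-time verifier: each move is computed in polynomial time, and on every input, for
every witness and all random bits, it halts after polynomially many moves. -/
structure Verifier where
  /-- the program -/
  prog : Program
  /-- each move is computed in polynomial time -/
  polyTime : PolyTime encodeTriple encodeMove prog
  /-- bound on the number of moves -/
  bound : Polynomial ℕ
  /-- the verifier halts within this number of moves -/
  halts : ∀ x R w, (exec prog x R w (bound.eval x.length) [] []).isSome = true

/-- The result of a complete run: verdict, number of random bits read, number of queries. -/
def Verifier.result (V : Verifier) (x : List Bool) (R : ℕ → Bool) (w : List Bool) : Bool × ℕ × ℕ :=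
  (exec V.prog x R w (V.bound.eval x.length) [] []).get (V.halts x R w)

/-- `V` is `(r(n), q(n))`-restricted: on inputs of length `n` it always reads at most `r n` random
bits and makes at most `q n` queries. -/
def Verifier.Restricted (V : Verifier) (r q : ℕ → ℕ) : Prop :=
  ∀ x R w, (V.result x R w).2.1 ≤ r x.length ∧ (V.result x R w).2.2 ≤ q x.length

/-- A finite string of random bits, padded to a sequence. -/
def padBits {m : ℕ} (R : Fin m → Bool) (j : ℕ) : Bool :=
  if h : j < m then R ⟨j, h⟩ else false

/-- The probability that `V` accepts input `x` with oracle access to `w`, over a uniformly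
distributed string of `m` random bits. (It is used only if `V` reads at most `m` random bits.) -/
noncomputable def Verifier.acceptProb (V : Verifier) (m : ℕ) (x w : List Bool) : ℝ :=
  ((Finset.univ.filter fun R : Fin m → Bool => (V.result x (padBits R) w).1 = true).card : ℝ) / 2 ^ m

/-- The class `PCP[r(n), q(n)]`. -/
def PCP (r q : ℕ → ℕ) : Set (Language Bool) :=
  {L | ∃ V : Verifier, V.Restricted r q ∧
    (∀ x ∈ L, ∃ w, V.acceptProb (r x.length) x w = 1) ∧
    (∀ x ∉ L, ∀ w, V.acceptProb (r x.length) x w ≤ 1 / 2)}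

/-- `r(n) = O(log n)`. -/
def IsOLog (r : ℕ → ℕ) : Prop :=
  (fun n => (r n : ℝ)) =O[atTop] (fun n : ℕ => Real.log n)

/-- `q(n) = O(1)`. -/
def IsOOne (q : ℕ → ℕ) : Prop :=
  (fun n => (q n : ℝ)) =O[atTop] (fun _ : ℕ => (1 : ℝ))

/-- The class `PCP[O(log n), q]` for a number `q` of queries. -/
def PCPLog (q : ℕ) : Set (Language Bool) :=
  {L | ∃ r : ℕ → ℕ, IsOLog r ∧ L ∈ PCP r (fun _ => q)}

/-- The class `PCP[O(log n), O(1)]`. -/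
def PCPLogConst : Set (Language Bool) :=
  {L | ∃ r q : ℕ → ℕ, IsOLog r ∧ IsOOne q ∧ L ∈ PCP r q}

/-! ### Max 3SAT -/

/-- A literal: `(true, i)` is the variable `xᵢ`, `(false, i)` is its negation. -/
abbrev Literal := Bool × ℕ

/-- A clause: an OR of literals. -/
abbrev Clause := List Literal

/-- A 3CNF formula: a list of clauses with at most three literals each. -/
abbrev CNF3 := {φ : List Clause // ∀ C ∈ φ, C.length ≤ 3}

/-- The assignment `τ` satisfies the clause `C`. -/
def Clause.sat (τ : ℕ → Bool) (C : Clause) : Bool :=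
  C.any fun l => τ l.2 == l.1

/-- The number of clauses of `φ`. -/
def CNF3.size (φ : CNF3) : ℕ := φ.1.length

/-- The number of clauses of `φ` that `τ` satisfies. -/
def CNF3.numSat (φ : CNF3) (τ : ℕ → Bool) : ℕ :=
  φ.1.countP (Clause.sat τ)

/-- The optimum of `φ` as an instance of Max 3SAT. -/
noncomputable def CNF3.opt (φ : CNF3) : ℕ :=
  sSup (Set.range φ.numSat)

/-- The supremum in the definition of the optimum is that of a bounded set. -/
theorem CNF3.bddAbove_numSat (φ : CNF3) : BddAbove (Set.range φ.numSat) := by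
  refine ⟨φ.1.length, ?_⟩
  rintro _ ⟨τ, rfl⟩
  exact List.countP_le_length

/-- Encoding of lists: each entry is encoded and followed by the separator `none`. -/
def encodeSeq {α Γ : Type} (e : α → List Γ) (l : List α) : List (Option Γ) :=
  l.flatMap fun a => (e a).map some ++ [none]

/-- A literal is its sign followed by the index of its variable in binary. -/
def encodeLiteral (l : Literal) : List Bool := l.1 :: encodeNat l.2

/-- The encoding of 3CNF formulas. -/
def encodeCNF3 (φ : CNF3) : List (Option (Option Bool)) :=
  encodeSeq (encodeSeq encodeLiteral) φ.1

/-- A truth assignment is written down as the list of the variables that it makes true. -/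
def encodeAssignment : List ℕ → List (Option Bool) := encodeSeq encodeNat

/-- The truth assignment that makes exactly the listed variables true. -/
def assignment (S : List ℕ) (i : ℕ) : Bool := decide (i ∈ S)

/-- `A` is a polynomial-time `ρ`-approximate algorithm for Max 3SAT. -/
def IsPolyTimeApprox (ρ : ℝ) (A : CNF3 → List ℕ) : Prop :=
  PolyTime encodeCNF3 encodeAssignment A ∧
    ∀ φ : CNF3, (φ.numSat (assignment (A φ)) : ℝ) ≥ (φ.opt : ℝ) / ρ

/-- A polynomial-time reduction from `L` to Max 3SAT with gap `ε`. Formulas have at least one clause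
(for the formula without clauses both conditions would hold). -/
def HasGapReduction (L : Language Bool) (ε : ℝ) : Prop :=
  ∃ f : List Bool → CNF3, PolyTime encodeStr encodeCNF3 f ∧ ∀ x, 1 ≤ (f x).size ∧
    (x ∈ L → ∃ τ, (f x).numSat τ = (f x).size) ∧
    (x ∉ L → ∀ τ, ((f x).numSat τ : ℝ) ≤ (1 - ε) * (f x).size)

end Inapprox

/-!
The reduction turns a verifier for `L` that makes at most `q` queries into a formula, as follows. The
formula has a variable for each bit of the witness and, for each string `R` of random bits and each
nonempty string `p` of at most `q` bits, a variable `y R p` that is meant to say that with random bits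
`R` the answers to the queries begin with `p`. Which query comes after given answers is found by
running the verifier on guessed answers. For each pair `R`, `p = p' ++ [b]` there is the clause
`y R p' ∧ w i = b → y R p`, where `i` is the position of the query after the answers `p'` (without the
hypothesis `y R p'` if `p'` is empty); if the verifier rejects after the answers `p`, the conclusion is
replaced by falsity (`guessClause`). These clauses have at most three literals, and there are
`2 * (2 ^ q - 1) ≤ q * 2 ^ q` of them for each `R` (`length_guesses_le`).

If the verifier always accepts some witness, the intended values satisfy all clauses
(`sat_intended`). Conversely, an assignment determines a witness, and for each `R` with which the
verifier rejects this witness some clause of `R` is violated: otherwise the variables `y R p` would be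
true for all initial parts `p` of the true answers, and the last of the clauses forbids that
(`exists_not_sat`). If this happens for at least half of the strings `R`, then at least the fraction
`1 / (2 * q * 2 ^ q)` of all clauses is violated (`Verifier.numSat_le`).

With an approximate algorithm for Max 3SAT one can therefore decide `L` in polynomial time, because
`1 / (1 + ε) > 1 - ε` (`mem_P_of_hasGapReduction`). In the first part of the theorem no NP-complete
language is needed: if P ≠ NP, any language in NP that is not in P will do, since it has a verifier
with a constant number of queries.

Most of the file shows that all this takes polynomial time on the stack machines of Mathlib. Machines
are built from structured programs (`Prog`) that can call other machines as subroutines. This gives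
closure of polynomial time under composition (`PolyTime.comp`), pairing (`PolyTime.pair`) and loops
that are bounded in time and space (`PolyTime.while`), and transducers with a counter
(`Transducer.polyTime`). With these, data that are represented by binary trees (`Coded`) can be
processed: the predicate `PT` is closed under the usual operations on pairs and lists, most notably
folds whose intermediate results stay of polynomial size (`PT.foldl`). The algorithms are then written
as functional programs, and their correctness is proved on the mathematical objects.
-/

namespace Inapprox

open Computability Turing StateTransition

/-! ### Running stack machines -/

section Machines

variable {K : Type} {Γ : K → Type} {Λ σ : Type} {K' : Type} {Γ' : K' → Type} {Λ' σ' : Type}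

/-- The machine `M` gets from one configuration to another in at most the given number of steps. -/
inductive ReachesIn [DecidableEq K] (M : Λ → TM2.Stmt Γ Λ σ) :
    ℕ → TM2.Cfg Γ Λ σ → TM2.Cfg Γ Λ σ → Prop
  | refl (n c) : ReachesIn M n c c
  | step {n l v S c} : ReachesIn M n (TM2.stepAux (M l) v S) c →
    ReachesIn M (n + 1) ⟨some l, v, S⟩ c

section
variable [DecidableEq K] {M : Λ → TM2.Stmt Γ Λ σ}

theorem ReachesIn.mono {m n : ℕ} {c c' : TM2.Cfg Γ Λ σ} (h : ReachesIn M m c c') (hmn : m ≤ n) :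
    ReachesIn M n c c' := by
  induction h generalizing n with
  | refl => exact .refl _ _
  | step _ ih =>
    obtain ⟨n, rfl⟩ : ∃ k, n = k + 1 := ⟨n - 1, by omega⟩
    exact .step (ih (by omega))

theorem ReachesIn.trans {m n : ℕ} {c c' c'' : TM2.Cfg Γ Λ σ} (h : ReachesIn M m c c')
    (h' : ReachesIn M n c' c'') : ReachesIn M (m + n) c c'' := by
  induction h with
  | refl => exact h'.mono (by omega)
  | step _ ih => rw [Nat.add_right_comm]; exact .step (ih h')

/-- Runs of bounded length in terms of the iteration that Mathlib's complexity notions use. -/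
theorem ReachesIn.exists_iterate {n : ℕ} {c c' : TM2.Cfg Γ Λ σ} (h : ReachesIn M n c c') :
    ∃ k ≤ n, (flip bind (TM2.step M))^[k] (some c) = some c' := by
  induction h with
  | refl => exact ⟨0, Nat.zero_le _, rfl⟩
  | step _ ih =>
    obtain ⟨k, hk, e⟩ := ih
    exact ⟨k + 1, by omega, e⟩

theorem iterate_flip_bind_none (f : σ → Option σ) (n : ℕ) :
    (flip bind f)^[n] none = none := by
  induction n with
  | zero => rfl
  | succ n ih => exact ih

theorem ReachesIn.of_iterate {n : ℕ} {c c' : TM2.Cfg Γ Λ σ}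
    (h : (flip bind (TM2.step M))^[n] (some c) = some c') : ReachesIn M n c c' := by
  induction n generalizing c with
  | zero => cases h; exact .refl _ _
  | succ n ih =>
    obtain ⟨_ | l, v, S⟩ := c
    · have : (flip bind (TM2.step M))^[n] none = some c' := h
      rw [iterate_flip_bind_none] at this
      cases this
    · exact .step (ih h)

end

/-- A component of the internal memory of a machine. -/
structure Lens (σ τ : Type) where
  /-- read the component -/
  get : σ → τ
  /-- overwrite the component -/
  set : τ → σ → σ
  get_set : ∀ t s, get (set t s) = t
  set_set : ∀ t t' s, set t (set t' s) = set t s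
  set_get : ∀ s, set (get s) s = s

attribute [simp] Lens.get_set Lens.set_set Lens.set_get

/-- The whole memory as a component of itself. -/
def Lens.id (σ : Type) : Lens σ σ := ⟨fun s => s, fun t _ => t, fun _ _ => rfl, fun _ _ _ => rfl,
  fun _ => rfl⟩

/-- The first component of a pair. -/
def Lens.fst (σ τ : Type) : Lens (σ × τ) σ :=
  ⟨fun s => s.1, fun t s => (t, s.2), fun _ _ => rfl, fun _ _ _ => rfl, fun _ => rfl⟩

/-- The second component of a pair. -/
def Lens.snd (σ τ : Type) : Lens (σ × τ) τ :=
  ⟨fun s => s.2, fun t s => (s.1, t), fun _ _ => rfl, fun _ _ _ => rfl, fun _ => rfl⟩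

/-- A component of a component. -/
def Lens.comp {σ τ υ : Type} (a : Lens σ τ) (b : Lens τ υ) : Lens σ υ where
  get s := b.get (a.get s)
  set u s := a.set (b.set u (a.get s)) s
  get_set := by simp
  set_set := by simp
  set_get := by simp

/-- A way to run a machine with stacks `Γ` and memory `σ` inside of one with stacks `Γ'` and
memory `σ'`. -/
structure Emb (Γ : K → Type) (σ : Type) (Γ' : K' → Type) (σ' : Type) where
  /-- where to find the stacks -/
  ι : K → K'
  inj : Function.Injective ι
  /-- identification of the alphabets -/
  e : ∀ k, Γ k ≃ Γ' (ι k)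
  /-- where to find the memory -/
  lens : Lens σ' σ

/-- Everything is where it was. -/
def Emb.id (Γ : K → Type) (σ : Type) : Emb Γ σ Γ σ := ⟨fun k => k, fun _ _ h => h,
  fun _ => Equiv.refl _, Lens.id σ⟩

/-- Translation of a statement to a bigger machine: jumps go to the labels given by `g`, and halting
becomes a jump to `h` (or remains halting, for `h = none`). -/
def Emb.stmt (E : Emb Γ σ Γ' σ') (g : Λ → Λ') (h : Option Λ') :
    TM2.Stmt Γ Λ σ → TM2.Stmt Γ' Λ' σ'
  | .push k f q => .push (E.ι k) (fun v => E.e k (f (E.lens.get v))) (E.stmt g h q)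
  | .peek k f q => .peek (E.ι k)
      (fun v o => E.lens.set (f (E.lens.get v) (o.map (E.e k).symm)) v) (E.stmt g h q)
  | .pop k f q => .pop (E.ι k)
      (fun v o => E.lens.set (f (E.lens.get v) (o.map (E.e k).symm)) v) (E.stmt g h q)
  | .load f q => .load (fun v => E.lens.set (f (E.lens.get v)) v) (E.stmt g h q)
  | .branch f q₁ q₂ => .branch (fun v => f (E.lens.get v)) (E.stmt g h q₁) (E.stmt g h q₂)
  | .goto f => .goto fun v => g (f (E.lens.get v))
  | .halt => h.elim .halt fun l => .goto fun _ => l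

/-- The label of the bigger machine that corresponds to a label of the embedded one. -/
def mapLabel (g : Λ → Λ') (h : Option Λ') : Option Λ → Option Λ'
  | none => h
  | some l => some (g l)

/-- A configuration of the bigger machine extends one of the embedded machine; outside of the
embedded stacks and memory it agrees with `v₀` and `S₀`. -/
structure Emb.Sim (E : Emb Γ σ Γ' σ') (g : Λ → Λ') (h : Option Λ') (v₀ : σ')
    (S₀ : ∀ k, List (Γ' k)) (c : TM2.Cfg Γ Λ σ) (c' : TM2.Cfg Γ' Λ' σ') : Prop where
  label : c'.l = mapLabel g h c.l
  var : c'.var = E.lens.set c.var v₀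
  stk : ∀ k, c'.stk (E.ι k) = (c.stk k).map (E.e k)
  frame : ∀ k, k ∉ Set.range E.ι → c'.stk k = S₀ k

/-- When nothing is moved, being simulated determines the configuration. -/
theorem Emb.sim_id (g : Λ → Λ') (h : Option Λ') (v₀ : σ) (S₀ : ∀ k, List (Γ k))
    (c : TM2.Cfg Γ Λ σ) (c' : TM2.Cfg Γ Λ' σ) :
    (Emb.id Γ σ).Sim g h v₀ S₀ c c' ↔ c' = ⟨mapLabel g h c.l, c.var, c.stk⟩ := by
  constructor
  · rintro ⟨h1, h2, h3, -⟩
    obtain ⟨l', v', S'⟩ := c'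
    simp only at h1 h2 h3
    congr 1
    funext k
    have := h3 k
    exact this.trans (List.map_id _)
  · rintro rfl
    exact ⟨rfl, rfl, fun k => (List.map_id _).symm, fun k hk => (hk ⟨k, rfl⟩).elim⟩

variable [DecidableEq K]

section
variable [DecidableEq K']

/-- One step of the embedded machine is one step of the bigger machine. -/
theorem Emb.stepAux_sim (E : Emb Γ σ Γ' σ') (g : Λ → Λ') (h : Option Λ') {v₀ : σ'}
    {S₀ : ∀ k, List (Γ' k)} (q : TM2.Stmt Γ Λ σ) {v : σ} {S : ∀ k, List (Γ k)} {v' : σ'}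
    {S' : ∀ k, List (Γ' k)} (hv : v' = E.lens.set v v₀)
    (hS : ∀ k, S' (E.ι k) = (S k).map (E.e k))
    (hf : ∀ k, k ∉ Set.range E.ι → S' k = S₀ k) :
    E.Sim g h v₀ S₀ (TM2.stepAux q v S) (TM2.stepAux (E.stmt g h q) v' S') := by
  have upd : ∀ (S : ∀ k, List (Γ k)) (S' : ∀ k, List (Γ' k)) (k : K) (l : List (Γ k)),
      (∀ k, S' (E.ι k) = (S k).map (E.e k)) → ∀ j,
      Function.update S' (E.ι k) (l.map (E.e k)) (E.ι j) =
        (Function.update S k l j).map (E.e j) := by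
    intro S S' k l hS j
    by_cases hj : j = k
    · subst hj; simp
    · simp [hj, E.inj.ne hj, hS]
  have fr : ∀ (S' : ∀ k, List (Γ' k)) (k : K) (l : List (Γ' (E.ι k))),
      (∀ k, k ∉ Set.range E.ι → S' k = S₀ k) → ∀ j, j ∉ Set.range E.ι →
      Function.update S' (E.ι k) l j = S₀ j := by
    intro S' k l hf j hj
    rw [Function.update_of_ne, hf j hj]
    rintro rfl; exact hj ⟨k, rfl⟩
  induction q generalizing v S v' S' with
  | push k f q ih =>
    simp only [Emb.stmt, TM2.stepAux]
    refine ih hv ?_ ?_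
    · have := upd S S' k (f v :: S k) hS
      simpa [hv, hS] using this
    · exact fr _ _ _ hf
  | peek k f q ih =>
    simp only [Emb.stmt, TM2.stepAux]
    refine ih ?_ hS hf
    simp [hv, hS, List.head?_map, Option.map_map, Function.comp_def]
  | pop k f q ih =>
    simp only [Emb.stmt, TM2.stepAux]
    refine ih ?_ ?_ ?_
    · simp [hv, hS, List.head?_map, Option.map_map, Function.comp_def]
    · have := upd S S' k (S k).tail hS
      simpa [hS] using this
    · exact fr _ _ _ hf
  | load f q ih =>
    simp only [Emb.stmt, TM2.stepAux]
    exact ih (by simp [hv]) hS hf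
  | branch f q₁ q₂ ih₁ ih₂ =>
    simp only [Emb.stmt, TM2.stepAux]
    rw [hv, E.lens.get_set, ← hv]
    cases f v
    · exact ih₂ hv hS hf
    · exact ih₁ hv hS hf
  | goto f => exact ⟨by simp [Emb.stmt, TM2.stepAux, mapLabel, hv], hv, hS, hf⟩
  | halt =>
    cases h with
    | none => exact ⟨rfl, hv, hS, hf⟩
    | some l => exact ⟨rfl, hv, hS, hf⟩

theorem Emb.reachesIn_sim (E : Emb Γ σ Γ' σ') (g : Λ → Λ') (h : Option Λ') {v₀ : σ'}
    {S₀ : ∀ k, List (Γ' k)} {M : Λ → TM2.Stmt Γ Λ σ} {M' : Λ' → TM2.Stmt Γ' Λ' σ'}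
    (hM : ∀ l, M' (g l) = E.stmt g h (M l)) {n : ℕ} {c d : TM2.Cfg Γ Λ σ}
    (hr : ReachesIn M n c d) {c' : TM2.Cfg Γ' Λ' σ'} (hs : E.Sim g h v₀ S₀ c c') :
    ∃ d', ReachesIn M' n c' d' ∧ E.Sim g h v₀ S₀ d d' := by
  induction hr generalizing c' with
  | refl => exact ⟨c', .refl _ _, hs⟩
  | @step n l v S d _ ih =>
    obtain ⟨l', v', S'⟩ := c'
    obtain ⟨hl, hv, hS, hf⟩ := hs
    simp only [mapLabel] at hl hv hS hf
    subst hl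
    obtain ⟨d', h1, h2⟩ := ih (E.stepAux_sim g h (M l) hv hS hf)
    exact ⟨d', .step (by rw [hM]; exact h1), h2⟩

end

/-! ### Structured programs -/

/-- A piece of program. Its exit is the halting statement. -/
structure Prog (Γ : K → Type) (σ : Type) where
  /-- labels -/
  Λ : Type
  /-- there are finitely many labels -/
  fin : Fintype Λ
  /-- the label to start at -/
  entry : Λ
  /-- the code -/
  code : Λ → TM2.Stmt Γ Λ σ

/-- Started with memory `v` and stacks `S`, the program exits with memory `v'` and stacks `S'` after
at most `t` steps. -/
def Prog.Exec (A : Prog Γ σ) (t : ℕ) (v : σ) (S : ∀ k, List (Γ k)) (v' : σ)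
    (S' : ∀ k, List (Γ k)) : Prop :=
  ReachesIn A.code t ⟨some A.entry, v, S⟩ ⟨none, v', S'⟩

theorem Prog.Exec.mono {A : Prog Γ σ} {t t' : ℕ} {v v' : σ} {S S' : ∀ k, List (Γ k)}
    (h : A.Exec t v S v' S') (ht : t ≤ t') : A.Exec t' v S v' S' :=
  ReachesIn.mono h ht

/-- A program with a single label, at which it may loop. -/
def Prog.one (q : TM2.Stmt Γ Unit σ) : Prog Γ σ := ⟨Unit, inferInstance, (), fun _ => q⟩

theorem Prog.exec_one {q : TM2.Stmt Γ Unit σ} {v v' : σ} {S S' : ∀ k, List (Γ k)}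
    (h : TM2.stepAux q v S = ⟨none, v', S'⟩) : (Prog.one q).Exec 1 v S v' S' := by
  refine .step ?_
  change ReachesIn _ 0 (TM2.stepAux q v S) _
  rw [h]; exact .refl _ _

theorem Prog.exec_one_loop {q : TM2.Stmt Γ Unit σ} {t : ℕ} {v v' v'' : σ}
    {S S' S'' : ∀ k, List (Γ k)} (h : TM2.stepAux q v S = ⟨some (), v', S'⟩)
    (h' : (Prog.one q).Exec t v' S' v'' S'') : (Prog.one q).Exec (t + 1) v S v'' S'' := by
  refine .step ?_
  change ReachesIn _ t (TM2.stepAux q v S) _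
  rw [h]; exact h'

/-- `A` and then `B`. -/
def Prog.seq (A B : Prog Γ σ) : Prog Γ σ where
  Λ := A.Λ ⊕ B.Λ
  fin := @instFintypeSum _ _ A.fin B.fin
  entry := .inl A.entry
  code := Sum.elim (fun l => (Emb.id Γ σ).stmt .inl (some (.inr B.entry)) (A.code l))
    (fun l => (Emb.id Γ σ).stmt .inr none (B.code l))

theorem Prog.Exec.seq {A B : Prog Γ σ} {t u : ℕ} {v v' v'' : σ} {S S' S'' : ∀ k, List (Γ k)}
    (hA : A.Exec t v S v' S') (hB : B.Exec u v' S' v'' S'') :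
    (A.seq B).Exec (t + u) v S v'' S'' := by
  obtain ⟨d, h1, h2⟩ := (Emb.id Γ σ).reachesIn_sim (M' := (A.seq B).code) Sum.inl
    (some (.inr B.entry)) (fun _ => rfl) hA (v₀ := v) (S₀ := S) ((Emb.sim_id ..).2 rfl)
  obtain ⟨d', h1', h2'⟩ := (Emb.id Γ σ).reachesIn_sim (M' := (A.seq B).code) Sum.inr
    none (fun _ => rfl) hB (v₀ := v) (S₀ := S) ((Emb.sim_id ..).2 rfl)
  rw [Emb.sim_id] at h2 h2'
  subst h2 h2'
  exact h1.trans h1'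

/-- Run the statement `q`; where it jumps, run the body and repeat; where it halts, exit. -/
def Prog.loop (q : TM2.Stmt Γ Unit σ) (A : Prog Γ σ) : Prog Γ σ where
  Λ := Option A.Λ
  fin := @instFintypeOption _ A.fin
  entry := none
  code
    | none => (Emb.id Γ σ).stmt (fun _ => some A.entry) none q
    | some l => (Emb.id Γ σ).stmt some (some none) (A.code l)

theorem Prog.stepAux_loop (q : TM2.Stmt Γ Unit σ) (A : Prog Γ σ) (v : σ) (S : ∀ k, List (Γ k)) :
    TM2.stepAux ((Prog.loop q A).code none) v S =
      ⟨mapLabel (fun _ => some A.entry) none (TM2.stepAux q v S).l, (TM2.stepAux q v S).var,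
        (TM2.stepAux q v S).stk⟩ := by
  have := (Emb.id Γ σ).stepAux_sim (fun _ => some A.entry) none q (v₀ := v) (S₀ := S) (v := v)
    (S := S) (v' := v) (S' := S) rfl (fun k => (List.map_id _).symm) (fun _ _ => rfl)
  rwa [Emb.sim_id] at this

theorem Prog.exec_loop_exit {q : TM2.Stmt Γ Unit σ} {A : Prog Γ σ} {v v' : σ}
    {S S' : ∀ k, List (Γ k)} (h : TM2.stepAux q v S = ⟨none, v', S'⟩) :
    (Prog.loop q A).Exec 1 v S v' S' := by
  refine .step ?_
  erw [Prog.stepAux_loop, h]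
  exact .refl _ _

theorem Prog.exec_loop_step {q : TM2.Stmt Γ Unit σ} {A : Prog Γ σ} {v v₁ v₂ v' : σ}
    {S S₁ S₂ S' : ∀ k, List (Γ k)} {t u : ℕ} (h : TM2.stepAux q v S = ⟨some (), v₁, S₁⟩)
    (hA : A.Exec t v₁ S₁ v₂ S₂) (hl : (Prog.loop q A).Exec u v₂ S₂ v' S') :
    (Prog.loop q A).Exec (t + u + 1) v S v' S' := by
  refine .step ?_
  erw [Prog.stepAux_loop, h]
  obtain ⟨d, h1, h2⟩ := (Emb.id Γ σ).reachesIn_sim (M' := (Prog.loop q A).code) some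
    (some none) (fun _ => rfl) hA (v₀ := v) (S₀ := S) ((Emb.sim_id ..).2 rfl)
  rw [Emb.sim_id] at h2
  subst h2
  exact h1.trans hl

/-- Run a machine on some of the stacks. -/
def Prog.call (M : FinTM2) (E : Emb M.Γ M.σ Γ' σ') : Prog Γ' σ' where
  Λ := M.Λ
  fin := M.ΛFin
  entry := M.main
  code l := E.stmt (fun l => l) none (M.m l)

/-- Mathlib defines the initial and final stacks by casts along equalities of alphabets; here they
are function updates. -/
theorem stk_initList (M : FinTM2) (s : List (M.Γ M.k₀)) :
    (initList M s).stk = Function.update (fun _ => []) M.k₀ s := by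
  funext k
  by_cases h : k = M.k₀
  · subst h; simp [initList]
  · simp [initList, h]

theorem stk_haltList (M : FinTM2) (s : List (M.Γ M.k₁)) :
    (haltList M s).stk = Function.update (fun _ => []) M.k₁ s := by
  funext k
  by_cases h : k = M.k₁
  · subst h; simp [haltList]
  · simp [haltList, h]

/-- On input `s` the machine outputs `s'` within `t` steps. -/
def Outputs (M : FinTM2) (s : List (M.Γ M.k₀)) (s' : List (M.Γ M.k₁)) (t : ℕ) : Prop :=
  ReachesIn M.m t ⟨some M.main, M.initialState, Function.update (fun _ => []) M.k₀ s⟩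
    ⟨none, M.initialState, Function.update (fun _ => []) M.k₁ s'⟩

/-- `Outputs` is the existence of the corresponding Mathlib structure. -/
theorem outputs_iff (M : FinTM2) (s : List (M.Γ M.k₀)) (s' : List (M.Γ M.k₁)) (t : ℕ) :
    Outputs M s s' t ↔ Nonempty (TM2OutputsInTime M s (some s') t) := by
  have h1 : initList M s = ⟨some M.main, M.initialState, Function.update (fun _ => []) M.k₀ s⟩ := by
    rw [← stk_initList]; rfl
  have h2 : haltList M s' = ⟨none, M.initialState, Function.update (fun _ => []) M.k₁ s'⟩ := by
    rw [← stk_haltList]; rfl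
  constructor
  · intro h
    obtain ⟨k, hk, e⟩ := h.exists_iterate
    rw [← h1, ← h2] at e
    exact ⟨⟨⟨k, e⟩, hk⟩⟩
  · rintro ⟨⟨⟨k, e⟩, hk⟩⟩
    change (flip bind (TM2.step M.m))^[k] (some (initList M s)) = some (haltList M s') at e
    rw [h1, h2] at e
    exact (ReachesIn.of_iterate e).mono hk

/-- A call does what the called machine does, provided that its stacks are empty apart from the
input and its memory is in the initial state. Both hold again afterwards, so calls can be
repeated. -/
theorem Prog.exec_call [DecidableEq K'] {M : FinTM2} {E : Emb M.Γ M.σ Γ' σ'} {s : List (M.Γ M.k₀)}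
    {s' : List (M.Γ M.k₁)} {t : ℕ} (h : Outputs M s s' t) {v : σ'} {S S' : ∀ k, List (Γ' k)}
    (hv : E.lens.get v = M.initialState) (h₀ : S (E.ι M.k₀) = s.map (E.e _))
    (hS : ∀ k, k ≠ M.k₀ → S (E.ι k) = []) (h₁ : S' (E.ι M.k₁) = s'.map (E.e _))
    (hS' : ∀ k, k ≠ M.k₁ → S' (E.ι k) = []) (hf : ∀ k, k ∉ Set.range E.ι → S' k = S k) :
    (Prog.call M E).Exec t v S v S' := by
  obtain ⟨⟨l, v', S''⟩, h1, hl, hv', hS'', hf''⟩ :=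
    E.reachesIn_sim (M' := (Prog.call M E).code) (fun l => l) none
    (fun _ => rfl) h (v₀ := v) (S₀ := S) (c' := ⟨some M.main, v, S⟩)
    ⟨rfl, by simp [← hv], fun k => by
      by_cases hk : k = M.k₀
      · subst hk; simpa using h₀
      · simpa [hk] using hS k hk, fun _ _ => rfl⟩
  have e1 : v' = v := by simpa [← hv] using hv'
  have e2 : S'' = S' := by
    funext k
    by_cases hk : k ∈ Set.range E.ι
    · obtain ⟨k, rfl⟩ := hk
      have := hS'' k
      by_cases hk : k = M.k₁
      · subst hk; simpa [h₁] using this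
      · simpa [hk, hS' k hk] using this
    · rw [hf k hk]; exact hf'' k hk
  simp only [mapLabel] at hl
  subst hl e1 e2
  exact h1

/-- Choose a statement according to the memory. -/
noncomputable def caseOn [Fintype σ] (f : σ → TM2.Stmt Γ Λ σ) : TM2.Stmt Γ Λ σ :=
  open Classical in
  (Finset.univ.toList : List σ).foldr (fun s q => .branch (fun v => decide (v = s)) (f s) q) .halt

@[simp] theorem stepAux_caseOn [Fintype σ] (f : σ → TM2.Stmt Γ Λ σ) (v : σ)
    (S : ∀ k, List (Γ k)) : TM2.stepAux (caseOn f) v S = TM2.stepAux (f v) v S := by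
  classical
  have : ∀ l : List σ, v ∈ l → TM2.stepAux
      (l.foldr (fun s q => .branch (fun v => decide (v = s)) (f s) q) .halt) v S =
      TM2.stepAux (f v) v S := by
    intro l hl
    induction l with
    | nil => cases hl
    | cons a l ih =>
      by_cases h : v = a
      · subst h; simp
      · simp only [List.foldr_cons, TM2.stepAux, h, decide_false, cond_false]
        exact ih (by simpa [h] using hl)
  convert this Finset.univ.toList (by simp) using 2
  unfold caseOn
  congr!

/-- Push the symbols of a list, the first one first. -/
def pushList (k : K) : List (Γ k) → TM2.Stmt Γ Λ σ → TM2.Stmt Γ Λ σ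
  | [], q => q
  | a :: l, q => .push k (fun _ => a) (pushList k l q)

@[simp] theorem stepAux_pushList (k : K) (l : List (Γ k)) (q : TM2.Stmt Γ Λ σ) (v : σ)
    (S : ∀ k, List (Γ k)) : TM2.stepAux (pushList k l q) v S =
      TM2.stepAux q v (Function.update S k (l.reverse ++ S k)) := by
  induction l generalizing S with
  | nil => simp [pushList]
  | cons a l ih => simp [pushList, ih]

/-- Pop the symbols of stack `a` one by one, pushing `f x` onto stack `b` for each symbol `x`. -/
noncomputable def moveProg [Fintype σ] (a b : K) (B : Lens σ (Option (Γ a)))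
    (f : Γ a → List (Γ b)) : Prog Γ σ :=
  .one (.pop a (fun v o => B.set o v) (caseOn fun v => match B.get v with
    | none => .halt
    | some x => pushList b (f x) (.goto fun _ => ())))

theorem exec_moveProg [Fintype σ] {a b : K} (hab : a ≠ b) (B : Lens σ (Option (Γ a)))
    (f : Γ a → List (Γ b)) (v : σ) (hv : B.get v = none) (S : ∀ k, List (Γ k)) :
    (moveProg a b B f).Exec ((S a).length + 1) v S v
      (Function.update (Function.update S a []) b (((S a).flatMap f).reverse ++ S b)) := by
  have key : ∀ (l : List (Γ a)) (v' : σ) (S : ∀ k, List (Γ k)), S a = l → B.set none v' = v →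
      (moveProg a b B f).Exec (l.length + 1) v' S v
      (Function.update (Function.update S a []) b ((l.flatMap f).reverse ++ S b)) := by
    intro l
    induction l with
    | nil =>
      intro v' S hS hv'
      refine Prog.exec_one ?_
      simp [hS, hv', hab.symm, hv]
    | cons x l ih =>
      intro v' S hS hv'
      refine Prog.exec_one_loop (v' := B.set (some x) v')
        (S' := Function.update (Function.update S a l) b ((f x).reverse ++ S b)) ?_ ?_
      · simp [hS, hab.symm]
      · have e : Function.update (Function.update S a []) b
            (((x :: l).flatMap f).reverse ++ S b) =
          Function.update (Function.update
            (Function.update (Function.update S a l) b ((f x).reverse ++ S b)) a []) b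
            ((l.flatMap f).reverse ++
              Function.update (Function.update S a l) b ((f x).reverse ++ S b) b) := by
          funext k
          by_cases h1 : k = b
          · subst h1; simp
          · by_cases h2 : k = a
            · subst h2; simp [h1]
            · simp [h1, h2]
        rw [e]
        exact ih _ _ (by simp [hab]) (by simpa using hv')
  exact key _ v S rfl (by rw [← hv]; simp)

end Machines

/-! ### Closure properties of polynomial time -/

section PolyTimeClosure

/-- The evaluation of a polynomial with natural coefficients is monotone. -/
theorem eval_mono (p : Polynomial ℕ) : Monotone fun n => p.eval n := by
  intro m n h
  simp only [Polynomial.eval_eq_sum, Polynomial.sum]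
  gcongr

/-- All stacks are empty, except for one. -/
def single {K : Type} [DecidableEq K] {Γ : K → Type} (k : K) (l : List (Γ k)) : ∀ k, List (Γ k) :=
  Function.update (fun _ => []) k l

section single
variable {K : Type} [DecidableEq K] {Γ : K → Type}

@[simp] theorem single_same (k : K) (l : List (Γ k)) : single k l k = l := by simp [single]

theorem single_of_ne {j k : K} (h : j ≠ k) (l : List (Γ k)) : single k l j = [] := by
  simp [single, h]

end single

/-- A program that turns the encoded input on one stack into the encoded output on another one in
polynomial time, with all other stacks empty and its memory restored, is a polynomial-time
machine. -/
theorem polyTime_of_prog {α β Γ₀ Γ₁ K : Type} [DecidableEq K] [Fintype K] {Γ : K → Type} {σ : Type}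
    [Fintype σ] {ea : α → List Γ₀} {eb : β → List Γ₁} {f : α → β} (A : Prog Γ σ) (k₀ k₁ : K)
    [Fintype (Γ k₀)] (init : σ) (e₀ : Γ k₀ ≃ Γ₀) (e₁ : Γ k₁ ≃ Γ₁) (p : Polynomial ℕ)
    (h : ∀ a, A.Exec (p.eval (ea a).length) init (single k₀ ((ea a).map e₀.symm)) init
      (single k₁ ((eb (f a)).map e₁.symm))) : PolyTime ea eb f := by
  let M : FinTM2 := { K := K, k₀ := k₀, k₁ := k₁, Γ := Γ, Λ := A.Λ, main := A.entry,
                      ΛFin := A.fin, σ := σ, initialState := init, m := A.code }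
  exact ⟨{ tm := M, inputAlphabet := e₀, outputAlphabet := e₁, time := p,
           outputsFun := fun a => ((outputs_iff M _ _ _).1 (h a)).some }⟩

/-- The machine behind `PolyTime`, with the data unbundled. -/
theorem PolyTime.exists_machine {α β Γ₀ Γ₁ : Type} {ea : α → List Γ₀} {eb : β → List Γ₁}
    {f : α → β} (h : PolyTime ea eb f) :
    ∃ (M : FinTM2) (e₀ : M.Γ M.k₀ ≃ Γ₀) (e₁ : M.Γ M.k₁ ≃ Γ₁) (p : Polynomial ℕ), ∀ a,
      Outputs M ((ea a).map e₀.symm) ((eb (f a)).map e₁.symm) (p.eval (ea a).length) := by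
  obtain ⟨h⟩ := h
  exact ⟨h.tm, h.inputAlphabet, h.outputAlphabet, h.time, fun a =>
    (outputs_iff _ _ _ _).2 ⟨h.outputsFun a⟩⟩

/-- The number of push instructions in a statement. -/
def pushes {K : Type} {Γ : K → Type} {Λ σ : Type} : TM2.Stmt Γ Λ σ → ℕ
  | .push _ _ q => pushes q + 1
  | .peek _ _ q => pushes q
  | .pop _ _ q => pushes q
  | .load _ q => pushes q
  | .branch _ q₁ q₂ => pushes q₁ + pushes q₂
  | .goto _ => 0
  | .halt => 0

theorem length_stepAux {K : Type} [DecidableEq K] {Γ : K → Type} {Λ σ : Type}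
    (q : TM2.Stmt Γ Λ σ) (v : σ) (S : ∀ k, List (Γ k)) (j : K) :
    ((TM2.stepAux q v S).stk j).length ≤ (S j).length + pushes q := by
  induction q generalizing v S with
  | push k f q ih =>
    refine (ih _ _).trans ?_
    by_cases h : j = k
    · subst h; simp only [Function.update_self, List.length_cons, pushes]; omega
    · simp [pushes, h]
  | peek k f q ih => exact ih _ _
  | pop k f q ih =>
    refine (ih _ _).trans ?_
    by_cases h : j = k
    · subst h; simp [pushes]
    · simp [pushes, h]
  | load f q ih => exact ih _ _
  | branch f q₁ q₂ ih₁ ih₂ =>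
    simp only [TM2.stepAux, pushes]
    cases f v
    · exact (ih₂ _ _).trans (by omega)
    · exact (ih₁ _ _).trans (by omega)
  | goto f => simp [pushes]
  | halt => simp [pushes]

/-- A stack grows by a bounded number of symbols per step. -/
theorem ReachesIn.length_le {K : Type} [DecidableEq K] {Γ : K → Type} {Λ σ : Type}
    {M : Λ → TM2.Stmt Γ Λ σ} {C : ℕ} (hC : ∀ l, pushes (M l) ≤ C) {n : ℕ} {c c' : TM2.Cfg Γ Λ σ}
    (h : ReachesIn M n c c') (j : K) : (c'.stk j).length ≤ (c.stk j).length + C * n := by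
  induction h with
  | refl => omega
  | @step n l v S c _ ih =>
    have := length_stepAux (M l) v S j
    have := hC l
    rw [Nat.mul_succ]
    simp only
    omega

/-- The output of a polynomial-time function has polynomial length. -/
theorem PolyTime.exists_length_le {α β Γ₀ Γ₁ : Type} {ea : α → List Γ₀} {eb : β → List Γ₁}
    {f : α → β} (h : PolyTime ea eb f) :
    ∃ p : Polynomial ℕ, ∀ a, (eb (f a)).length ≤ p.eval (ea a).length := by
  obtain ⟨M, e₀, e₁, p, hM⟩ := h.exists_machine
  have := M.ΛFin
  refine ⟨.X + .C (Finset.univ.sup fun l => pushes (M.m l)) * p, fun a => ?_⟩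
  have := (hM a).length_le (C := Finset.univ.sup fun l => pushes (M.m l))
    (fun l => Finset.le_sup (f := fun l => pushes (M.m l)) (Finset.mem_univ l)) M.k₁
  simp only [Function.update_self, List.length_map] at this
  refine this.trans ?_
  simp only [Polynomial.eval_add, Polynomial.eval_X, Polynomial.eval_mul, Polynomial.eval_C]
  gcongr
  by_cases hk : M.k₁ = M.k₀
  · have : ∀ (k : M.K) (hk : k = M.k₀), (Function.update (fun _ => [] : ∀ k, List (M.Γ k)) M.k₀
        ((ea a).map e₀.symm) k).length ≤ (ea a).length := by
      rintro k rfl; simp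
    exact this _ hk
  · simp [hk]

theorem exec_moveProg_single {K : Type} [DecidableEq K] {Γ : K → Type} {σ : Type} [Fintype σ]
    {a b : K} (hab : a ≠ b) (B : Lens σ (Option (Γ a)))
    (f : Γ a → List (Γ b)) (v : σ) (hv : B.get v = none) (l : List (Γ a)) :
    (moveProg a b B f).Exec (l.length + 1) v (single a l) v (single b (l.flatMap f).reverse) := by
  have := exec_moveProg hab B f v hv (single a l)
  simp only [single_same, single_of_ne hab.symm, List.append_nil] at this
  convert this using 1
  funext k
  by_cases h1 : k = b
  · subst h1; simp
  · by_cases h2 : k = a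
    · subst h2; simp [single]
    · simp [h1, single]

theorem exec_call_single {K : Type} [DecidableEq K] {Γ : K → Type} {σ : Type} {M : FinTM2}
    {E : Emb M.Γ M.σ Γ σ} {s : List (M.Γ M.k₀)}
    {s' : List (M.Γ M.k₁)} {t : ℕ} (h : Outputs M s s' t) {v : σ}
    (hv : E.lens.get v = M.initialState) :
    (Prog.call M E).Exec t v (single (E.ι M.k₀) (s.map (E.e _))) v
      (single (E.ι M.k₁) (s'.map (E.e _))) := by
  refine Prog.exec_call h hv (by simp) (fun k hk => single_of_ne (E.inj.ne hk) _) (by simp)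
    (fun k hk => single_of_ne (E.inj.ne hk) _) (fun k hk => ?_)
  rw [single_of_ne, single_of_ne]
  · rintro rfl; exact hk ⟨_, rfl⟩
  · rintro rfl; exact hk ⟨_, rfl⟩

/-- Polynomial-time functions are closed under composition. The composite machine has a
spare stack, through which the intermediate result is moved to restore its order. -/
theorem PolyTime.comp {α β γ Γ₀ Γ₁ Γ₂ : Type} {ea : α → List Γ₀} {eb : β → List Γ₁}
    {ec : γ → List Γ₂} {g : β → γ} {f : α → β} (hg : PolyTime eb ec g) (hf : PolyTime ea eb f) :
    PolyTime ea ec (g ∘ f) := by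
  obtain ⟨r, hr⟩ := hf.exists_length_le
  obtain ⟨M, d₀, d₁, p, hM⟩ := hf.exists_machine
  obtain ⟨N, e₀, e₁, q, hN⟩ := hg.exists_machine
  have := M.kFin
  have := N.kFin
  have := M.σFin
  have := N.σFin
  have : Fintype (M.Γ M.k₀) := M.Γk₀Fin
  have : Fintype (N.Γ N.k₀) := N.Γk₀Fin
  have : Fintype (M.Γ M.k₁) := Fintype.ofEquiv _ (e₀.trans d₁.symm)
  let Γ : (M.K ⊕ N.K) ⊕ Unit → Type := Sum.elim (Sum.elim M.Γ N.Γ) fun _ => M.Γ M.k₁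
  let σ := (M.σ × N.σ) × Option (M.Γ M.k₁)
  let EM : Emb M.Γ M.σ Γ σ := ⟨fun k => .inl (.inl k), fun _ _ h => by simpa using h,
    fun _ => Equiv.refl _, (Lens.fst _ _).comp (Lens.fst _ _)⟩
  let EN : Emb N.Γ N.σ Γ σ := ⟨fun k => .inl (.inr k), fun _ _ h => by simpa using h,
    fun _ => Equiv.refl _, (Lens.fst _ _).comp (Lens.snd _ _)⟩
  let B : Lens σ (Option (M.Γ M.k₁)) := Lens.snd _ _
  let init : σ := ((M.initialState, N.initialState), none)
  have : Fintype (Γ (.inl (.inl M.k₀))) := M.Γk₀Fin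
  let A : Prog Γ σ := ((Prog.call M EM).seq ((moveProg (Γ := Γ) (.inl (.inl M.k₁)) (.inr ()) B
    fun x => [x]).seq (moveProg (Γ := Γ) (.inr ()) (.inl (.inr N.k₀)) B
      fun x => [e₀.symm (d₁ x)]))).seq (Prog.call N EN)
  refine polyTime_of_prog A (.inl (.inl M.k₀)) (.inl (.inr N.k₁)) init d₀ e₁
    ((p + ((r + 1) + (r + 1))) + q.comp r) fun a => ?_
  have h1 := exec_call_single (E := EM) (hM a) (v := init) rfl
  have h2 := exec_moveProg_single (Γ := Γ) (a := .inl (.inl M.k₁)) (b := .inr ()) (by simp) B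
    (fun x => [x]) init rfl ((eb (f a)).map d₁.symm)
  have h3 := exec_moveProg_single (Γ := Γ) (a := .inr ()) (b := .inl (.inr N.k₀)) (by simp) B
    (fun x => [e₀.symm (d₁ x)]) init rfl ((eb (f a)).map d₁.symm).reverse
  have h4 := exec_call_single (E := EN) (hN (f a)) (v := init) rfl
  have e1 : ∀ l : List (M.Γ M.k₁), l.flatMap (fun x => [x]) = l := by simp
  have e2 : ∀ l : List Γ₁, (((l.map d₁.symm).reverse.flatMap
      (fun x => [e₀.symm (d₁ x)])).reverse) = l.map e₀.symm := by
    intro l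
    induction l <;> simp_all
  erw [e1, List.length_map] at h2
  erw [e2, List.length_reverse, List.length_map] at h3
  have e3 : ∀ (k : M.K) (l : List (M.Γ k)), l.map (EM.e k) = l := fun k l => List.map_id _
  have e4 : ∀ (k : N.K) (l : List (N.Γ k)), l.map (EN.e k) = l := fun k l => List.map_id _
  rw [e3, e3] at h1
  rw [e4, e4] at h4
  refine ((h1.seq (h2.seq h3)).seq h4).mono ?_
  have := hr a
  have := eval_mono q (hr a)
  simp only [Polynomial.eval_add, Polynomial.eval_one,
    Polynomial.eval_comp] at this ⊢
  omega

end PolyTimeClosure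

/-! ### Pairs and loops in polynomial time -/

section Combinators

/-- Pop the symbols of stack `a` one by one, pushing a copy of each onto `b` and onto `c`. -/
noncomputable def copyProg {K : Type} {Γ : K → Type} {σ : Type} [Fintype σ] (a b c : K)
    (B : Lens σ (Option (Γ a))) (f : Γ a → Γ b) (g : Γ a → Γ c) : Prog Γ σ :=
  .one (.pop a (fun v o => B.set o v) (caseOn fun v => match B.get v with
    | none => .halt
    | some x => .push b (fun _ => f x) (.push c (fun _ => g x) (.goto fun _ => ()))))

theorem exec_copyProg {K : Type} [DecidableEq K] {Γ : K → Type} {σ : Type} [Fintype σ] {a b c : K}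
    (hab : a ≠ b) (hac : a ≠ c) (hbc : b ≠ c) (B : Lens σ (Option (Γ a)))
    (f : Γ a → Γ b) (g : Γ a → Γ c) (v : σ) (hv : B.get v = none) (S : ∀ k, List (Γ k)) :
    (copyProg a b c B f g).Exec ((S a).length + 1) v S v
      (Function.update (Function.update (Function.update S a []) b (((S a).map f).reverse ++ S b)) c
        (((S a).map g).reverse ++ S c)) := by
  have key : ∀ (l : List (Γ a)) (v' : σ) (S : ∀ k, List (Γ k)), S a = l → B.set none v' = v →
      (copyProg a b c B f g).Exec (l.length + 1) v' S v
      (Function.update (Function.update (Function.update S a []) b ((l.map f).reverse ++ S b)) c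
        ((l.map g).reverse ++ S c)) := by
    intro l
    induction l with
    | nil =>
      intro v' S hS hv'
      refine Prog.exec_one ?_
      have e : Function.update (Function.update (Function.update S a []) b (S b)) c (S c) =
          Function.update S a [] := by
        rw [Function.update_eq_iff]
        refine ⟨by simp [hac.symm], fun j _ => ?_⟩
        by_cases h : j = b
        · subst h; simp [hab.symm]
        · simp [h]
      simp [hS, hv', hv, e]
    | cons x l ih =>
      intro v' S hS hv'
      refine Prog.exec_one_loop (v' := B.set (some x) v')
        (S' := Function.update (Function.update (Function.update S a l) b (f x :: S b)) c
          (g x :: S c)) ?_ ?_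
      · simp [hS, hab.symm, hac.symm, hbc.symm]
      · have e : Function.update (Function.update (Function.update S a []) b
            (((x :: l).map f).reverse ++ S b)) c (((x :: l).map g).reverse ++ S c) =
          Function.update (Function.update (Function.update
            (Function.update (Function.update (Function.update S a l) b (f x :: S b)) c
              (g x :: S c)) a []) b
            ((l.map f).reverse ++
              Function.update (Function.update (Function.update S a l) b (f x :: S b)) c
                (g x :: S c) b)) c
            ((l.map g).reverse ++
              Function.update (Function.update (Function.update S a l) b (f x :: S b)) c
                (g x :: S c) c) := by
          funext k
          by_cases h1 : k = c
          · subst h1; simp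
          · by_cases h2 : k = b
            · subst h2; simp [h1]
            · by_cases h3 : k = a
              · subst h3; simp [h1, h2]
              · simp [h1, h2, h3]
        rw [e]
        exact ih _ _ (by simp [hab, hac]) (by simpa using hv')
  exact key _ v S rfl (by rw [← hv]; simp)

/-- Both of two polynomial-time functions can be computed from the same input. -/
theorem PolyTime.pair {α β γ : Type} {ea : α → List Bool} {eb : β → List Bool}
    {ec : γ → List Bool} {f : α → β} {g : α → γ} (hf : PolyTime ea eb f) (hg : PolyTime ea ec g) :
    PolyTime ea (fun p : β × γ => true :: (eb p.1 ++ ec p.2)) (fun a => (f a, g a)) := by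
  obtain ⟨rf, hrf⟩ := hf.exists_length_le
  obtain ⟨rg, hrg⟩ := hg.exists_length_le
  obtain ⟨M, d₀, d₁, p, hM⟩ := hf.exists_machine
  obtain ⟨N, e₀, e₁, q, hN⟩ := hg.exists_machine
  have := M.kFin
  have := N.kFin
  have := M.σFin
  have := N.σFin
  let Γ : (M.K ⊕ N.K) ⊕ Bool → Type := Sum.elim (Sum.elim M.Γ N.Γ) fun _ => Bool
  let σ := (M.σ × N.σ) × Option Bool
  let EM : Emb M.Γ M.σ Γ σ := ⟨fun k => .inl (.inl k), fun _ _ h => by simpa using h,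
    fun _ => Equiv.refl _, (Lens.fst _ _).comp (Lens.fst _ _)⟩
  let EN : Emb N.Γ N.σ Γ σ := ⟨fun k => .inl (.inr k), fun _ _ h => by simpa using h,
    fun _ => Equiv.refl _, (Lens.fst _ _).comp (Lens.snd _ _)⟩
  let B : Lens σ (Option Bool) := Lens.snd _ _
  let BM : Lens σ (Option (M.Γ M.k₁)) := ⟨fun v => v.2.map d₁.symm, fun o v => (v.1, o.map d₁),
    by simp, by simp, by simp⟩
  let BN : Lens σ (Option (N.Γ N.k₁)) := ⟨fun v => v.2.map e₁.symm, fun o v => (v.1, o.map e₁),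
    by simp, by simp, by simp⟩
  let init : σ := ((M.initialState, N.initialState), none)
  have : Fintype (Γ (.inr true)) := Bool.fintype
  let st (a : ∀ k, List (M.Γ k)) (b : ∀ k, List (N.Γ k)) (io tmp : List Bool) :
      ∀ k, List (Γ k) := fun k => match k with
    | .inl (.inl k) => a k
    | .inl (.inr k) => b k
    | .inr true => io
    | .inr false => tmp
  have st_ext : ∀ (S : ∀ k, List (Γ k)) (a : ∀ k, List (M.Γ k)) (b : ∀ k, List (N.Γ k))
      (io tmp : List Bool), (∀ k, S (.inl (.inl k)) = a k) → (∀ k, S (.inl (.inr k)) = b k) →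
      S (.inr true) = io → S (.inr false) = tmp → S = st a b io tmp := by
    intro S a b io tmp h1 h2 h3 h4
    funext k
    obtain (k | k) | (_ | _) := k
    exacts [h1 k, h2 k, h4, h3]
  let P1 : Prog Γ σ := moveProg (Γ := Γ) (.inr true) (.inr false) B fun x : Bool => [x]
  let P2 : Prog Γ σ := copyProg (Γ := Γ) (.inr false) (.inl (.inl M.k₀)) (.inl (.inr N.k₀)) B
    (fun x : Bool => d₀.symm x) (fun x : Bool => e₀.symm x)
  let P3 : Prog Γ σ := (Prog.call M EM).seq (Prog.call N EN)
  let P4 : Prog Γ σ := moveProg (Γ := Γ) (.inl (.inr N.k₁)) (.inr false) BN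
    fun x : N.Γ N.k₁ => [e₁ x]
  let P5 : Prog Γ σ := moveProg (Γ := Γ) (.inr false) (.inr true) B fun x : Bool => [x]
  let P6 : Prog Γ σ := moveProg (Γ := Γ) (.inl (.inl M.k₁)) (.inr false) BM
    fun x : M.Γ M.k₁ => [d₁ x]
  let P7 : Prog Γ σ := .one (.push (.inr true) (fun _ => true) .halt)
  refine polyTime_of_prog ((P1.seq P2).seq (P3.seq ((P4.seq P5).seq ((P6.seq P5).seq P7))))
    (.inr true) (.inr true) init (Equiv.refl Bool) (Equiv.refl Bool)
    ((2 * .X + 2) + ((p + q) + ((2 * rg + 2) + ((2 * rf + 2) + 1)))) fun a => ?_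
  generalize hn : (ea a).length = n
  have hf1 := hrf a
  have hg1 := hrg a
  rw [hn] at hf1 hg1
  -- the successive contents of the stacks
  let z₁ : ∀ k, List (M.Γ k) := fun _ => []
  let z₂ : ∀ k, List (N.Γ k) := fun _ => []
  have h1 : P1.Exec (n + 1) init (st z₁ z₂ (ea a) []) init (st z₁ z₂ [] (ea a).reverse) := by
    have := exec_moveProg (Γ := Γ) (a := .inr true) (b := .inr false) (by simp) B
      (fun x : Bool => [x]) init rfl (st z₁ z₂ (ea a) [])
    have e : (st z₁ z₂ (ea a) [] (.inr true)).length = n := hn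
    rw [e] at this
    convert this using 1
    refine (st_ext _ _ _ _ _ ?_ ?_ ?_ ?_).symm
    · intro k; simp [st]; rfl
    · intro k; simp [st]; rfl
    · simp; rfl
    · have : ∀ l : List Bool, (l.flatMap (fun x => [x])).reverse ++ [] = l.reverse := by simp
      rw [Function.update_self]; exact this _
  have h2 : P2.Exec (n + 1) init (st z₁ z₂ [] (ea a).reverse) init
      (st (single M.k₀ ((ea a).map d₀.symm)) (single N.k₀ ((ea a).map e₀.symm)) [] []) := by
    have := exec_copyProg (Γ := Γ) (a := .inr false) (b := .inl (.inl M.k₀))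
      (c := .inl (.inr N.k₀)) (by simp) (by simp) (by simp) B
      (fun x : Bool => d₀.symm x) (fun x : Bool => e₀.symm x) init rfl
      (st z₁ z₂ [] (ea a).reverse)
    have e : (st z₁ z₂ [] (ea a).reverse (.inr false)).length = n := by
      rw [← hn]; exact List.length_reverse
    rw [e] at this
    convert this using 1
    refine (st_ext _ _ _ _ _ ?_ ?_ ?_ ?_).symm
    · intro k
      by_cases hk : k = M.k₀
      · subst hk
        rw [Function.update_of_ne (by simp), Function.update_self]
        have : ∀ l : List Bool, (l.reverse.map (fun x => d₀.symm x)).reverse ++ [] =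
          l.map d₀.symm := by simp
        simp only [single_same]
        exact this _
      · rw [Function.update_of_ne (by simp), Function.update_of_ne (by simpa using hk),
          Function.update_of_ne (by simp), single_of_ne hk]
    · intro k
      by_cases hk : k = N.k₀
      · subst hk
        rw [Function.update_self]
        have : ∀ l : List Bool, (l.reverse.map (fun x => e₀.symm x)).reverse ++ [] =
          l.map e₀.symm := by simp
        simp only [single_same]
        exact this _
      · rw [Function.update_of_ne (by simpa using hk), Function.update_of_ne (by simp),
          Function.update_of_ne (by simp), single_of_ne hk]
    · simp [st]; rfl
    · simp; rfl
  have mapM : ∀ (k : M.K) (l : List (M.Γ k)), l.map (EM.e k) = l := fun k l => List.map_id _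
  have mapN : ∀ (k : N.K) (l : List (N.Γ k)), l.map (EN.e k) = l := fun k l => List.map_id _
  have h3a : (Prog.call M EM).Exec (p.eval n) init
      (st (single M.k₀ ((ea a).map d₀.symm)) (single N.k₀ ((ea a).map e₀.symm)) [] []) init
      (st (single M.k₁ ((eb (f a)).map d₁.symm)) (single N.k₀ ((ea a).map e₀.symm)) [] []) := by
    rw [← hn]
    refine Prog.exec_call (hM a) rfl ?_ ?_ ?_ ?_ ?_
    · rw [mapM]; simp [st, EM]; rfl
    · intro k hk; exact single_of_ne hk _
    · rw [mapM]; simp [st, EM]; rfl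
    · intro k hk; exact single_of_ne hk _
    · rintro ((k | k) | k) hk
      · exact (hk ⟨k, rfl⟩).elim
      · rfl
      · cases k <;> rfl
  have h3b : (Prog.call N EN).Exec (q.eval n) init
      (st (single M.k₁ ((eb (f a)).map d₁.symm)) (single N.k₀ ((ea a).map e₀.symm)) [] []) init
      (st (single M.k₁ ((eb (f a)).map d₁.symm)) (single N.k₁ ((ec (g a)).map e₁.symm)) [] []) := by
    rw [← hn]
    refine Prog.exec_call (hN a) rfl ?_ ?_ ?_ ?_ ?_
    · rw [mapN]; simp [st, EN]; rfl
    · intro k hk; exact single_of_ne hk _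
    · rw [mapN]; simp [st, EN]; rfl
    · intro k hk; exact single_of_ne hk _
    · rintro ((k | k) | k) hk
      · rfl
      · exact (hk ⟨k, rfl⟩).elim
      · cases k <;> rfl
  have h4 : P4.Exec (rg.eval n + 1) init
      (st (single M.k₁ ((eb (f a)).map d₁.symm)) (single N.k₁ ((ec (g a)).map e₁.symm)) [] []) init
      (st (single M.k₁ ((eb (f a)).map d₁.symm)) z₂ [] (ec (g a)).reverse) := by
    have := exec_moveProg (Γ := Γ) (a := .inl (.inr N.k₁)) (b := .inr false) (by simp) BN
      (fun x : N.Γ N.k₁ => [e₁ x]) init rfl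
      (st (single M.k₁ ((eb (f a)).map d₁.symm)) (single N.k₁ ((ec (g a)).map e₁.symm)) [] [])
    have e : (st (single M.k₁ ((eb (f a)).map d₁.symm)) (single N.k₁ ((ec (g a)).map e₁.symm)) [] []
        (.inl (.inr N.k₁))) = (ec (g a)).map e₁.symm := by simp [st]; rfl
    rw [e] at this
    have e' : ((ec (g a)).map e₁.symm).length = (ec (g a)).length := List.length_map _
    erw [e'] at this
    refine Prog.Exec.mono ?_ (Nat.succ_le_succ hg1)
    convert this using 1
    refine (st_ext _ _ _ _ _ ?_ ?_ ?_ ?_).symm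
    · intro k; simp [st]; rfl
    · intro k
      by_cases hk : k = N.k₁
      · subst hk; simp [z₂]; rfl
      · rw [Function.update_of_ne (by simp), Function.update_of_ne (by simpa using hk)]
        exact single_of_ne hk _
    · simp [st]; rfl
    · rw [Function.update_self]
      have : ∀ l : List Bool, ((l.map e₁.symm).flatMap (fun x => [e₁ x])).reverse ++ [] =
        l.reverse := by
          intro l
          rw [List.append_nil]
          congr 1
          induction l <;> simp_all
      exact this _
  have h5 : ∀ (a' : ∀ k, List (M.Γ k)) (l l' : List Bool) (m : ℕ), l.length ≤ m →
      P5.Exec (m + 1) init (st a' z₂ l' l.reverse) init (st a' z₂ (l ++ l') []) := by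
    intro a' l l' m hm
    have := exec_moveProg (Γ := Γ) (a := .inr false) (b := .inr true) (by simp) B
      (fun x : Bool => [x]) init rfl (st a' z₂ l' l.reverse)
    have e : (st a' z₂ l' l.reverse (.inr false)).length = l.length := List.length_reverse
    rw [e] at this
    refine Prog.Exec.mono ?_ (Nat.succ_le_succ hm)
    convert this using 1
    refine (st_ext _ _ _ _ _ ?_ ?_ ?_ ?_).symm
    · intro k; simp [st]; rfl
    · intro k; simp [st]; rfl
    · have : ∀ l l' : List Bool, (l.reverse.flatMap (fun x => [x])).reverse ++ l' = l ++ l' := by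
        simp
      rw [Function.update_self]; exact this _ _
    · simp; rfl
  have h6 : P6.Exec (rf.eval n + 1) init
      (st (single M.k₁ ((eb (f a)).map d₁.symm)) z₂ (ec (g a)) []) init
      (st z₁ z₂ (ec (g a)) (eb (f a)).reverse) := by
    have := exec_moveProg (Γ := Γ) (a := .inl (.inl M.k₁)) (b := .inr false) (by simp) BM
      (fun x : M.Γ M.k₁ => [d₁ x]) init rfl
      (st (single M.k₁ ((eb (f a)).map d₁.symm)) z₂ (ec (g a)) [])
    have e : (st (single M.k₁ ((eb (f a)).map d₁.symm)) z₂ (ec (g a)) []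
        (.inl (.inl M.k₁))) = (eb (f a)).map d₁.symm := by simp [st]; rfl
    rw [e] at this
    have e' : ((eb (f a)).map d₁.symm).length = (eb (f a)).length := List.length_map _
    erw [e'] at this
    refine Prog.Exec.mono ?_ (Nat.succ_le_succ hf1)
    convert this using 1
    refine (st_ext _ _ _ _ _ ?_ ?_ ?_ ?_).symm
    · intro k
      by_cases hk : k = M.k₁
      · subst hk; simp [z₁]; rfl
      · rw [Function.update_of_ne (by simp), Function.update_of_ne (by simpa using hk)]
        exact single_of_ne hk _
    · intro k; simp [st]; rfl
    · simp [st]; rfl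
    · rw [Function.update_self]
      have : ∀ l : List Bool, ((l.map d₁.symm).flatMap (fun x => [d₁ x])).reverse ++ [] =
        l.reverse := by
          intro l
          rw [List.append_nil]
          congr 1
          induction l <;> simp_all
      exact this _
  have h7 : P7.Exec 1 init (st z₁ z₂ (eb (f a) ++ ec (g a)) []) init
      (st z₁ z₂ (true :: (eb (f a) ++ ec (g a))) []) := by
    refine Prog.exec_one ?_
    simp only [TM2.stepAux]
    congr 1
    refine st_ext _ _ _ _ _ ?_ ?_ ?_ ?_
    · intro k; simp [st]; rfl
    · intro k; simp [st]; rfl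
    · rw [Function.update_self]; rfl
    · simp [st]; rfl
  have hio : ∀ l : List Bool, single (Γ := Γ) (.inr true) l = st z₁ z₂ l [] := by
    intro l
    refine st_ext _ _ _ _ _ ?_ ?_ ?_ ?_
    · intro k; simp [single, z₁]; rfl
    · intro k; simp [single, z₂]; rfl
    · exact single_same _ _
    · simp [single]; rfl
  have hid : ∀ l : List Bool, l.map (Equiv.refl Bool).symm = l := fun l => List.map_id l
  erw [hid, hid, hio, hio]
  have h5' := h5 (single M.k₁ ((eb (f a)).map d₁.symm)) (ec (g a)) [] _ hg1
  rw [List.append_nil] at h5'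
  refine ((h1.seq h2).seq ((h3a.seq h3b).seq ((h4.seq h5').seq ((h6.seq
    (h5 z₁ (eb (f a)) (ec (g a)) _ hf1)).seq h7)))).mono ?_
  simp only [Polynomial.eval_add, Polynomial.eval_one, Polynomial.eval_mul, Polynomial.eval_X,
    Polynomial.eval_ofNat]
  omega

/-- Look at the second symbol of stack `k`, whose first symbol is `x`, and jump if it satisfies the
test `d`. -/
def testStmt {K : Type} {Γ : K → Type} {σ : Type} (k : K) (d : Γ k → Bool) (x : Γ k)
    (B : Lens σ (Option Bool)) : TM2.Stmt Γ Unit σ :=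
  .pop k (fun v _ => v) <| .peek k (fun v o => B.set (o.map d) v) <| .push k (fun _ => x) <|
    .branch (fun v => B.get v == some true)
      (.load (B.set none) (.goto fun _ => ())) (.load (B.set none) .halt)

theorem stepAux_testStmt {K : Type} [DecidableEq K] {Γ : K → Type} {σ : Type} {k : K}
    (d : Γ k → Bool) {x y : Γ k} {l : List (Γ k)} (B : Lens σ (Option Bool)) (v : σ)
    (hv : B.get v = none) (S : ∀ k, List (Γ k)) (hS : S k = x :: y :: l) :
    TM2.stepAux (testStmt k d x B) v S = ⟨if d y then some () else none, v, S⟩ := by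
  have e : B.set none v = v := by rw [← hv]; simp
  simp only [testStmt, TM2.stepAux, hS, List.tail_cons, Function.update_self, List.head?_cons,
    Option.map_some, Function.update_idem, Lens.get_set, Lens.set_set, e]
  rw [← hS, Function.update_eq_self]
  cases d y <;> simp

/-- The loop `while next x = some y do x := F y` leads from `x` to `z` in the given number of
rounds, and `e x` never becomes longer than `B` on the way. -/
inductive Rounds {X Y : Type} (e : X → List Bool) (next : X → Option Y) (F : Y → X) (B : ℕ) :
    ℕ → X → X → Prop
  | done {x} : next x = none → (e x).length ≤ B → Rounds e next F B 0 x x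
  | step {n x y z} : next x = some y → (e x).length ≤ B → Rounds e next F B n (F y) z →
    Rounds e next F B (n + 1) x z

theorem Rounds.length_le {X Y : Type} {e : X → List Bool} {next : X → Option Y} {F : Y → X} {B : ℕ}
    {n : ℕ} {x z : X} (h : Rounds e next F B n x z) : (e x).length ≤ B := by
  cases h <;> assumption

/-- While loops whose body is computed in polynomial time, that go on for polynomially many rounds
and do not leave the strings of polynomial length, can be run in polynomial time. The second bit of
the representation of `x` tells whether to go on. -/
theorem PolyTime.while {X₀ X Y : Type} {e₀ : X₀ → List Bool} {e : X → List Bool}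
    {eY : Y → List Bool} {F : Y → X} (hF : PolyTime eY e F) (next : X → Option Y)
    (hnext : ∀ x y, next x = some y → eY y = e x)
    (hbit : ∀ x, ∃ r, e x = true :: (next x).isSome :: r) (start result : X₀ → X)
    (hstart : ∀ x, e₀ x = e (start x)) (p q : Polynomial ℕ)
    (h : ∀ x, ∃ n ≤ p.eval (e₀ x).length,
      Rounds e next F (q.eval (e₀ x).length) n (start x) (result x)) :
    PolyTime e₀ e result := by
  obtain ⟨M, d₀, d₁, r, hM⟩ := hF.exists_machine
  have := M.kFin
  have := M.σFin
  let Γ : M.K ⊕ Unit → Type := Sum.elim M.Γ fun _ => Bool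
  let σ := M.σ × Option Bool
  let E : Emb M.Γ M.σ Γ σ := ⟨.inl, Sum.inl_injective, fun _ => Equiv.refl _, Lens.fst _ _⟩
  let B : Lens σ (Option Bool) := Lens.snd _ _
  let B₁ : Lens σ (Option (M.Γ M.k₁)) := ⟨fun v => v.2.map d₁.symm, fun o v => (v.1, o.map d₁),
    by simp, by simp, by simp⟩
  let init : σ := (M.initialState, none)
  have : Fintype (Γ (.inl M.k₀)) := M.Γk₀Fin
  let k₀ : M.K ⊕ Unit := .inl M.k₀
  let body : Prog Γ σ := (Prog.call M E).seq
    ((moveProg (Γ := Γ) (.inl M.k₁) (.inr ()) B₁ fun x : M.Γ M.k₁ => [d₁ x]).seq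
    (moveProg (Γ := Γ) (.inr ()) (.inl M.k₀) B fun x : Bool => [d₀.symm x]))
  let test : TM2.Stmt Γ Unit σ := testStmt (.inl M.k₀) d₀ (d₀.symm true) B
  let st (l : List Bool) : ∀ k, List (Γ k) := single (Γ := Γ) (.inl M.k₀) (l.map d₀.symm)
  have htest : ∀ b l, TM2.stepAux test init (st (true :: b :: l)) =
      ⟨if b then some () else none, init, st (true :: b :: l)⟩ := by
    intro b l
    have e1 : st (true :: b :: l) (.inl M.k₀) = d₀.symm true :: d₀.symm b :: l.map d₀.symm := by
      simp [st]; rfl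
    have := stepAux_testStmt (Γ := Γ) (σ := σ) (k := .inl M.k₀) d₀ B init rfl _ e1
    rwa [Equiv.apply_symm_apply] at this
  have hbody : ∀ y (m : ℕ), (eY y).length ≤ m → (e (F y)).length ≤ m →
      body.Exec (r.eval m + 2 * m + 2) init (st (eY y)) init (st (e (F y))) := by
    intro y m hm hm'
    have h1 := exec_call_single (E := E) (hM y) (v := init) rfl
    have h2 := exec_moveProg_single (Γ := Γ) (a := .inl M.k₁) (b := .inr ()) (by simp) B₁
      (fun x : M.Γ M.k₁ => [d₁ x]) init rfl ((e (F y)).map d₁.symm)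
    have h3 := exec_moveProg_single (Γ := Γ) (a := .inr ()) (b := .inl M.k₀) (by simp) B
      (fun x : Bool => [d₀.symm x]) init rfl (e (F y)).reverse
    have e1 : ∀ l : List Bool, (l.map d₁.symm).flatMap (fun x => [d₁ x]) = l := by
      intro l
      induction l <;> simp_all
    have e2 : ∀ l : List Bool, (l.reverse.flatMap (fun x => [d₀.symm x])).reverse =
        l.map d₀.symm := by
      intro l
      induction l <;> simp_all
    erw [e1, List.length_map] at h2
    erw [e2, List.length_reverse] at h3
    have e3 : ∀ (k : M.K) (l : List (M.Γ k)), l.map (E.e k) = l := fun k l => List.map_id _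
    rw [e3, e3] at h1
    refine ((h1.mono (eval_mono r hm)).seq ((h2.mono (Nat.succ_le_succ hm')).seq
      (h3.mono (Nat.succ_le_succ hm')))).mono ?_
    simp only
    omega
  have hloop : ∀ (m n : ℕ) (x z : X), Rounds e next F m n x z →
      (Prog.loop test body).Exec (n * (r.eval m + 2 * m + 3) + 1) init (st (e x)) init
        (st (e z)) := by
    intro m n x z hx
    induction hx with
    | @done x hx _ =>
      obtain ⟨l, hl⟩ := hbit x
      rw [hl, hx]
      exact (Prog.exec_loop_exit (htest _ _)).mono (by omega)
    | @step n x y z hx hB hr ih =>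
      obtain ⟨l, hl⟩ := hbit x
      have h1 := htest (next x).isSome l
      rw [← hl, hx] at h1
      have h2 := hbody y m (by rw [hnext x y hx]; exact hB) hr.length_le
      rw [hnext x y hx] at h2
      refine (Prog.exec_loop_step h1 h2 ih).mono ?_
      ring_nf
      omega
  refine polyTime_of_prog (Prog.loop test body) (.inl M.k₀) (.inl M.k₀) init d₀ d₀
    (p * (r.comp q + 2 * q + 3) + 1) fun x => ?_
  obtain ⟨n, hn, hx⟩ := h x
  rw [hstart]
  refine (hloop _ _ _ _ hx).mono ?_
  simp only [Polynomial.eval_add, Polynomial.eval_one, Polynomial.eval_mul, Polynomial.eval_comp,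
    Polynomial.eval_ofNat, hstart] at hn ⊢
  gcongr

end Combinators

/-! ### Transducers with a counter -/

section Transducers

/-- A one-way transducer with a counter. On reading a symbol it sees its state and whether the
counter is zero. -/
structure Transducer (Γ Γ' S : Type) where
  /-- the next state -/
  next : S → Bool → Γ → S
  /-- whether to increase (`some true`), to decrease (`some false`) or to keep the counter -/
  count : S → Bool → Γ → Option Bool
  /-- the symbols to write -/
  out : S → Bool → Γ → List Γ'
  /-- the symbols to write at the end of the input -/
  fin : S → List Γ'

/-- The effect of an instruction on the value of the counter. -/
def applyCount : Option Bool → ℕ → ℕ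
  | none, n => n
  | some true, n => n + 1
  | some false, n => n - 1

/-- The output of a transducer started in a given state with a given value of the counter. -/
def Transducer.run {Γ Γ' S : Type} (T : Transducer Γ Γ' S) : S → ℕ → List Γ → List Γ'
  | s, _, [] => T.fin s
  | s, n, a :: l => T.out s (n == 0) a ++
      T.run (T.next s (n == 0) a) (applyCount (T.count s (n == 0) a) n) l

/-- The instruction for a change of the counter, which is kept in unary on stack `k`. -/
def countStmt {K : Type} {Γ : K → Type} {Λ σ : Type} (k : K) (u : Γ k) :
    Option Bool → TM2.Stmt Γ Λ σ → TM2.Stmt Γ Λ σ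
  | none, q => q
  | some true, q => .push k (fun _ => u) q
  | some false, q => .pop k (fun v _ => v) q

theorem stepAux_countStmt {K : Type} [DecidableEq K] {Γ : K → Type} {Λ σ : Type} {k : K} {u : Γ k}
    (c : Option Bool) (q : TM2.Stmt Γ Λ σ) (v : σ) {S : ∀ k, List (Γ k)} {n : ℕ}
    (hS : S k = List.replicate n u) : TM2.stepAux (countStmt k u c q) v S =
      TM2.stepAux q v (Function.update S k (List.replicate (applyCount c n) u)) := by
  obtain _ | _ | _ := c
  · simp [countStmt, applyCount, ← hS]
  · simp [countStmt, applyCount, hS]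
  · simp [countStmt, applyCount, hS, List.replicate_succ]

section
variable {K : Type} {Γ : K → Type} {S : Type} {inp tmp cnt : K}

/-- The memory of the machine that simulates a transducer: the state, and buffers for the symbols
popped from the stacks. -/
abbrev TransducerMem (S A B C : Type) := S × (Option A × (Option B × Option C))

/-- Simulation of a transducer. The output appears on the stack `tmp` in reverse order. -/
noncomputable def transducerProg (T : Transducer (Γ inp) (Γ tmp) S) (s₀ : S) (u : Γ cnt)
    [Fintype (TransducerMem S (Γ inp) (Γ tmp) (Γ cnt))] :
    Prog Γ (TransducerMem S (Γ inp) (Γ tmp) (Γ cnt)) :=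
  .one <| .pop inp (fun v o => (v.1, o, v.2.2)) <|
    .peek cnt (fun v o => (v.1, v.2.1, v.2.2.1, o)) <| caseOn fun v => match v.2.1 with
    | none => .load (fun _ => (s₀, none, none, none)) (pushList tmp (T.fin v.1) .halt)
    | some a => .load (fun _ => (T.next v.1 v.2.2.2.isNone a, none, none, none)) <|
        countStmt cnt u (T.count v.1 v.2.2.2.isNone a) <|
        pushList tmp (T.out v.1 v.2.2.2.isNone a) <| .goto fun _ => ()

/-- The simulation; `m` is what remains of the counter, to be removed afterwards. -/
theorem exec_transducerProg [DecidableEq K] (T : Transducer (Γ inp) (Γ tmp) S) (s₀ : S) (u : Γ cnt)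
    [Fintype (TransducerMem S (Γ inp) (Γ tmp) (Γ cnt))] (hit : inp ≠ tmp) (hic : inp ≠ cnt)
    (htc : tmp ≠ cnt) (l : List (Γ inp)) (s : S) (n : ℕ) (St : ∀ k, List (Γ k)) (hl : St inp = l)
    (hn : St cnt = List.replicate n u) :
    ∃ m ≤ n + l.length, (transducerProg T s₀ u).Exec (l.length + 1) (s, none, none, none) St
      (s₀, none, none, none) (Function.update (Function.update (Function.update St inp []) tmp
        ((T.run s n l).reverse ++ St tmp)) cnt (List.replicate m u)) := by
  have hz : ∀ n : ℕ, (List.replicate n u).head?.isNone = (n == 0) := by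
    intro n; cases n <;> simp [List.replicate_succ]
  induction l generalizing s n St with
  | nil =>
    refine ⟨n, by simp, Prog.exec_one ?_⟩
    have e : Function.update (Function.update (Function.update St inp []) tmp
        ((T.fin s).reverse ++ St tmp)) cnt (List.replicate n u) =
        Function.update (Function.update St inp []) tmp ((T.fin s).reverse ++ St tmp) := by
      rw [Function.update_eq_self_iff, Function.update_of_ne htc.symm,
        Function.update_of_ne hic.symm, hn]
    simp [hl, Transducer.run, hit.symm, e]
  | cons a l ih =>
    obtain ⟨m, hm, h⟩ := ih (T.next s (n == 0) a) (applyCount (T.count s (n == 0) a) n)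
      (Function.update (Function.update (Function.update St inp l) cnt
        (List.replicate (applyCount (T.count s (n == 0) a) n) u)) tmp
        ((T.out s (n == 0) a).reverse ++ St tmp)) (by simp [hit, hic]) (by simp [htc.symm])
    refine ⟨m, ?_, ?_⟩
    · refine hm.trans ?_
      have : applyCount (T.count s (n == 0) a) n ≤ n + 1 := by
        cases T.count s (n == 0) a with
        | none => simp [applyCount]
        | some b => cases b <;> simp [applyCount]; omega
      simp only [List.length_cons]
      omega
    · have e : Function.update (Function.update (Function.update St inp []) tmp
          ((T.run s n (a :: l)).reverse ++ St tmp)) cnt (List.replicate m u) =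
          Function.update (Function.update (Function.update (Function.update (Function.update
            (Function.update St inp l) cnt
            (List.replicate (applyCount (T.count s (n == 0) a) n) u)) tmp
            ((T.out s (n == 0) a).reverse ++ St tmp)) inp []) tmp
            ((T.run (T.next s (n == 0) a) (applyCount (T.count s (n == 0) a) n) l).reverse ++
            Function.update (Function.update (Function.update St inp l) cnt
            (List.replicate (applyCount (T.count s (n == 0) a) n) u)) tmp
            ((T.out s (n == 0) a).reverse ++ St tmp) tmp)) cnt (List.replicate m u) := by
        funext k
        by_cases h1 : k = cnt
        · subst h1; simp
        · by_cases h2 : k = tmp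
          · subst h2; simp [h1, Transducer.run]
          · by_cases h3 : k = inp
            · subst h3; simp [h1, h2]
            · simp [h1, h2, h3]
      refine Prog.exec_one_loop (v' := (T.next s (n == 0) a, none, none, none)) (S' :=
        Function.update (Function.update (Function.update St inp l) cnt
        (List.replicate (applyCount (T.count s (n == 0) a) n) u)) tmp
        ((T.out s (n == 0) a).reverse ++ St tmp)) ?_ (by rw [e]; exact h)
      · simp only [TM2.stepAux, hl, List.head?_cons, List.tail_cons, stepAux_caseOn,
          Function.update_of_ne hic.symm, hn, hz]
        rw [stepAux_countStmt (n := n) _ _ _ (by rw [Function.update_of_ne hic.symm, hn]),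
          stepAux_pushList]
        simp [htc, hit.symm]

end

/-- The output is at most linearly longer than the input. -/
theorem Transducer.exists_length_run_le {Γ Γ' S : Type} [Fintype Γ] [Fintype S]
    (T : Transducer Γ Γ' S) : ∃ C, ∀ s n l, (T.run s n l).length ≤ C * (l.length + 1) := by
  let C₁ := Finset.univ.sup fun x : S × Bool × Γ => (T.out x.1 x.2.1 x.2.2).length
  let C₂ := Finset.univ.sup fun s : S => (T.fin s).length
  refine ⟨C₁ + C₂, fun s n l => ?_⟩
  have h2 : ∀ s, (T.fin s).length ≤ C₂ := fun s =>
    Finset.le_sup (f := fun s : S => (T.fin s).length) (Finset.mem_univ s)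
  have h1 : ∀ s b a, (T.out s b a).length ≤ C₁ := fun s b a =>
    Finset.le_sup (f := fun x : S × Bool × Γ => (T.out x.1 x.2.1 x.2.2).length)
      (Finset.mem_univ (s, b, a))
  induction l generalizing s n with
  | nil => simpa [Transducer.run] using (h2 s).trans (Nat.le_add_left _ _)
  | cons a l ih =>
    simp only [Transducer.run, List.length_append, List.length_cons]
    rw [Nat.mul_succ (C₁ + C₂)]
    have := h1 s (n == 0) a
    have := ih (T.next s (n == 0) a) (applyCount (T.count s (n == 0) a) n)
    omega

/-- What a transducer computes is computable in polynomial time. -/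
theorem Transducer.polyTime {α β Γi Γo S : Type} [Fintype Γi] [Fintype Γo] [Fintype S]
    {ea : α → List Γi} {eb : β → List Γo} {f : α → β} (T : Transducer Γi Γo S) (s₀ : S)
    (h : ∀ a, T.run s₀ 0 (ea a) = eb (f a)) : PolyTime ea eb f := by
  obtain ⟨C, hC⟩ := T.exists_length_run_le
  let Γ : (Unit ⊕ Unit) ⊕ Bool → Type := Sum.elim (Sum.elim (fun _ => Γi) fun _ => Unit) fun _ => Γo
  let inp : (Unit ⊕ Unit) ⊕ Bool := .inl (.inl ())
  let cnt : (Unit ⊕ Unit) ⊕ Bool := .inl (.inr ())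
  let tmp : (Unit ⊕ Unit) ⊕ Bool := .inr false
  let out : (Unit ⊕ Unit) ⊕ Bool := .inr true
  let σ := TransducerMem S Γi Γo Unit
  have i1 : Fintype (TransducerMem S (Γ inp) (Γ tmp) (Γ cnt)) :=
    (inferInstance : Fintype (S × (Option Γi × (Option Γo × Option Unit))))
  let T' : Transducer (Γ inp) (Γ tmp) S := T
  let u : Γ cnt := ()
  let g : Γ tmp → List (Γ out) := fun x : Γo => ([x] : List Γo)
  let P1 : Prog Γ (TransducerMem S (Γ inp) (Γ tmp) (Γ cnt)) := transducerProg T' s₀ u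
  let P2 : Prog Γ (TransducerMem S (Γ inp) (Γ tmp) (Γ cnt)) := moveProg cnt out
    (((Lens.snd _ _).comp (Lens.snd _ _)).comp (Lens.snd _ _)) fun _ => []
  let P3 : Prog Γ (TransducerMem S (Γ inp) (Γ tmp) (Γ cnt)) := moveProg tmp out
    (((Lens.snd _ _).comp (Lens.snd _ _)).comp (Lens.fst _ _)) g
  have i2 : Fintype (Γ inp) := ‹Fintype Γi›
  refine polyTime_of_prog (P1.seq (P2.seq P3)) inp out (s₀, none, none, none) (Equiv.refl Γi)
    (Equiv.refl Γo) (.X + 1 + (.X + 1 + (.C C * (.X + 1) + 1))) fun a => ?_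
  let l : List Γi := ea a
  let st (l : List Γi) (c : List Unit) (t o : List Γo) : ∀ k, List (Γ k) := fun k => match k with
    | .inl (.inl ()) => l
    | .inl (.inr ()) => c
    | .inr false => t
    | .inr true => o
  have st_ext : ∀ (S : ∀ k, List (Γ k)) (l : List Γi) (c : List Unit) (t o : List Γo),
      S inp = l → S cnt = c → S tmp = t → S out = o → S = st l c t o := by
    intro S l c t o h1 h2 h3 h4
    funext k
    obtain (k | k) | (_ | _) := k
    exacts [h1, h2, h3, h4]
  obtain ⟨m, hm, h1⟩ := exec_transducerProg T' s₀ u (by simp [inp, tmp]) (by simp [inp, cnt])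
    (by simp [tmp, cnt]) l s₀ 0 (st l [] [] []) rfl rfl
  rw [Nat.zero_add] at hm
  have e1 : Function.update (Function.update (Function.update (st l [] [] []) inp []) tmp
      ((T'.run s₀ 0 l).reverse ++ st l [] [] [] tmp)) cnt (List.replicate m u) =
      st [] (List.replicate m ()) (eb (f a)).reverse [] := by
    refine st_ext _ _ _ _ _ ?_ ?_ ?_ ?_
    · rw [Function.update_of_ne (by simp [inp, cnt]), Function.update_of_ne (by simp [inp, tmp]),
        Function.update_self]; rfl
    · rw [Function.update_self]; rfl
    · rw [Function.update_of_ne (by simp [tmp, cnt]), Function.update_self]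
      exact (List.append_nil _).trans (congrArg List.reverse (h a))
    · rw [Function.update_of_ne (by simp [out, cnt]), Function.update_of_ne (by simp [out, tmp]),
        Function.update_of_ne (by simp [out, inp])]
  rw [e1] at h1
  have h2 := exec_moveProg (Γ := Γ) (a := cnt) (b := out) (by simp [cnt, out])
    (((Lens.snd S (Option (Γ inp) × Option (Γ tmp) × Option (Γ cnt))).comp (Lens.snd _ _)).comp
      (Lens.snd _ _)) (fun _ => []) (s₀, none, none, none) rfl
    (st [] (List.replicate m ()) (eb (f a)).reverse [])
  have e2 : Function.update (Function.update (st [] (List.replicate m ()) (eb (f a)).reverse [])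
      cnt []) out (((st [] (List.replicate m ()) (eb (f a)).reverse [] cnt).flatMap
        fun _ => []).reverse ++ st [] (List.replicate m ()) (eb (f a)).reverse [] out) =
      st [] [] (eb (f a)).reverse [] := by
    refine st_ext _ _ _ _ _ ?_ ?_ ?_ ?_
    · rw [Function.update_of_ne (by simp [inp, out]), Function.update_of_ne (by simp [inp, cnt])]
    · rw [Function.update_of_ne (by simp [out, cnt]), Function.update_self]; rfl
    · rw [Function.update_of_ne (by simp [tmp, out]), Function.update_of_ne (by simp [tmp, cnt])]
    · rw [Function.update_self]
      have : ∀ l : List (Γ cnt), (l.flatMap fun _ => ([] : List (Γ out))).reverse ++ [] = [] := by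
        simp
      exact this _
  have e2' : (st [] (List.replicate m ()) (eb (f a)).reverse [] cnt).length = m :=
    List.length_replicate
  rw [e2, e2'] at h2
  have h3 := exec_moveProg (Γ := Γ) (a := tmp) (b := out) (by simp [tmp, out])
    (((Lens.snd S (Option (Γ inp) × Option (Γ tmp) × Option (Γ cnt))).comp (Lens.snd _ _)).comp
      (Lens.fst _ _)) g (s₀, none, none, none) rfl
    (st [] [] (eb (f a)).reverse [])
  have e3 : Function.update (Function.update (st [] [] (eb (f a)).reverse [])
      tmp []) out (((st [] [] (eb (f a)).reverse [] tmp).flatMap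
        g).reverse ++ st [] [] (eb (f a)).reverse [] out) =
      st [] [] [] (eb (f a)) := by
    refine st_ext _ _ _ _ _ ?_ ?_ ?_ ?_
    · rw [Function.update_of_ne (by simp [inp, out]), Function.update_of_ne (by simp [inp, tmp])]
    · rw [Function.update_of_ne (by simp [out, cnt]), Function.update_of_ne (by simp [cnt, tmp])]
    · rw [Function.update_of_ne (by simp [tmp, out]), Function.update_self]; rfl
    · rw [Function.update_self]
      have : ∀ l : List Γo, (l.reverse.flatMap fun x => [x]).reverse ++ [] = l := by simp
      exact this _
  have e3' : (st [] [] (eb (f a)).reverse [] tmp).length = (eb (f a)).length :=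
    List.length_reverse
  rw [e3, e3'] at h3
  have e4 : single (Γ := Γ) inp (l.map (Equiv.refl Γi).symm) = st l [] [] [] := by
    refine st_ext _ _ _ _ _ ?_ ?_ ?_ ?_
    · exact (single_same _ _).trans (List.map_id _)
    · exact single_of_ne (by simp [inp, cnt]) _
    · exact single_of_ne (by simp [inp, tmp]) _
    · exact single_of_ne (by simp [inp, out]) _
  have e5 : single (Γ := Γ) out ((eb (f a)).map (Equiv.refl Γo).symm) = st [] [] [] (eb (f a)) := by
    refine st_ext _ _ _ _ _ ?_ ?_ ?_ ?_
    · exact single_of_ne (by simp [inp, out]) _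
    · exact single_of_ne (by simp [out, cnt]) _
    · exact single_of_ne (by simp [out, tmp]) _
    · exact (single_same _ _).trans (List.map_id _)
  have h4 := (h1.seq (h2.seq h3)).mono (t' := Polynomial.eval (ea a).length
      (.X + 1 + (.X + 1 + (.C C * (.X + 1) + 1)))) (by
    have := hC s₀ 0 (ea a)
    rw [h a] at this
    simp only [Polynomial.eval_add, Polynomial.eval_one, Polynomial.eval_mul, Polynomial.eval_X,
      Polynomial.eval_C]
    exact Nat.add_le_add le_rfl (Nat.add_le_add (Nat.succ_le_succ hm) (Nat.succ_le_succ this)))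
  rw [← e4, ← e5] at h4
  exact h4

end Transducers

/-! ### Polynomial-time functions on structured data -/

/-- Binary trees, as a universal format for finite data. -/
inductive Code where
  | nil
  | cons (a b : Code)

/-- A tree is written down in preorder. -/
def Code.enc : Code → List Bool
  | .nil => [false]
  | .cons a b => true :: (a.enc ++ b.enc)

/-- Types whose elements are represented by trees. -/
class Coded (α : Type) where
  /-- the tree that represents an element -/
  code : α → Code

/-- The bit string that represents an element of a coded type. -/
def enc {α : Type} [Coded α] (a : α) : List Bool := (Coded.code a).enc

/-- The length of the bit string that represents an element of a coded type. -/
def size {α : Type} [Coded α] (a : α) : ℕ := (enc a).length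

instance : Coded Unit := ⟨fun _ => .nil⟩
instance : Coded Bool := ⟨fun b => cond b (.cons .nil .nil) .nil⟩
instance {α β : Type} [Coded α] [Coded β] : Coded (α × β) :=
  ⟨fun p => .cons (Coded.code p.1) (Coded.code p.2)⟩
instance {α : Type} [Coded α] : Coded (List α) :=
  ⟨fun l => l.foldr (fun a c => .cons (Coded.code a) c) .nil⟩
instance {α : Type} [Coded α] : Coded (Option α) :=
  ⟨fun o => o.elim .nil fun a => .cons (Coded.code a) .nil⟩
instance {α β : Type} [Coded α] [Coded β] : Coded (α ⊕ β) :=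
  ⟨Sum.elim (fun a => .cons .nil (Coded.code a)) (fun b => .cons (.cons .nil .nil) (Coded.code b))⟩

section Basics
variable {α β : Type} [Coded α] [Coded β]

theorem enc_pair (a : α) (b : β) : enc (a, b) = true :: (enc a ++ enc b) := rfl
theorem enc_some (a : α) : enc (some a) = true :: (enc a ++ [false]) := rfl
theorem enc_nil : enc ([] : List α) = [false] := rfl
theorem enc_cons (a : α) (l : List α) : enc (a :: l) = true :: (enc a ++ enc l) := rfl

@[simp] theorem size_unit (u : Unit) : size u = 1 := rfl
@[simp] theorem size_true : size true = 3 := rfl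
@[simp] theorem size_false : size false = 1 := rfl
@[simp] theorem size_pair (a : α) (b : β) : size (a, b) = size a + size b + 1 := by
  simp [size, enc_pair]
@[simp] theorem size_nil : size ([] : List α) = 1 := rfl
@[simp] theorem size_cons (a : α) (l : List α) : size (a :: l) = size a + size l + 1 := by
  simp [size, enc_cons]
@[simp] theorem size_none : size (none : Option α) = 1 := rfl
@[simp] theorem size_some (a : α) : size (some a) = size a + 2 := by
  simp [size, enc_some]

theorem size_bool_le (b : Bool) : size b ≤ 3 := by cases b <;> simp

theorem length_le_size (l : List α) : l.length ≤ size l := by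
  induction l with
  | nil => simp
  | cons a l ih => simp; omega

theorem size_append (l l' : List α) : size (l ++ l') + 1 = size l + size l' := by
  induction l with
  | nil => simp; omega
  | cons a l ih => simp; omega

theorem size_reverse (l : List α) : size l.reverse = size l := by
  induction l with
  | nil => rfl
  | cons a l ih =>
    have := size_append l.reverse [a]
    simp at this ⊢; omega

theorem size_le_of_sublist {l l' : List α} (h : l.Sublist l') : size l ≤ size l' := by
  induction h with
  | slnil => exact le_rfl
  | cons a _ ih => simp; omega
  | cons_cons a _ ih => simp; omega

theorem size_le_of_mem {l : List α} {a : α} (h : a ∈ l) : size a ≤ size l := by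
  induction l with
  | nil => cases h
  | cons b l ih =>
    rcases List.mem_cons.1 h with rfl | h
    · simp; omega
    · have := ih h; simp; omega

theorem size_list_le {l : List α} {B : ℕ} (h : ∀ a ∈ l, size a ≤ B) :
    size l ≤ l.length * (B + 1) + 1 := by
  induction l with
  | nil => simp
  | cons a l ih =>
    have h1 := h a (by simp)
    have h2 := ih fun a ha => h a (by simp [ha])
    simp only [size_cons, List.length_cons, Nat.succ_mul]
    omega

end Basics

/-- Polynomial-time computability of a function between coded types. Proofs of `PT` are put together
from combinators like a functional program. -/
def PT {α β : Type} [Coded α] [Coded β] (f : α → β) : Prop :=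
  PolyTime (enc : α → List Bool) (enc : β → List Bool) f

/-- Only the encodings of the values matter, not the type in which they live. This is how functions
between types with the same codes are identified. -/
theorem PolyTime.congr {α β β' Γ₀ Γ₁ : Type} {ea : α → List Γ₀} {eb : β → List Γ₁}
    {eb' : β' → List Γ₁} {f : α → β} {f' : α → β'} (hf : PolyTime ea eb f)
    (h : ∀ a, eb (f a) = eb' (f' a)) : PolyTime ea eb' f' := by
  obtain ⟨hf⟩ := hf
  exact ⟨{ hf with outputsFun := fun a => h a ▸ hf.outputsFun a }⟩

/-- Only the encodings of the arguments matter. -/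
theorem PolyTime.restrict {α α' β Γ₀ Γ₁ : Type} {ea : α → List Γ₀} {ea' : α' → List Γ₀}
    {eb : β → List Γ₁} {f : α → β} (hf : PolyTime ea eb f) (g : α' → α)
    (h : ∀ a, ea (g a) = ea' a) : PolyTime ea' eb (f ∘ g) := by
  obtain ⟨hf⟩ := hf
  exact ⟨{ hf with outputsFun := fun a => h a ▸ hf.outputsFun (g a) }⟩

/-! ### Functions computed by transducers -/

section Scanning
variable {Γ Γ' S : Type}

/-- While a transducer is in a state that stays the same, it translates symbol by symbol. -/
theorem Transducer.run_stay (T : Transducer Γ Γ' S) (s : S) (w : Γ → List Γ')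
    (h : ∀ z a, T.next s z a = s ∧ T.out s z a = w a) (n : ℕ) (l : List Γ) :
    T.run s n l = l.flatMap w ++ T.fin s := by
  induction l generalizing n with
  | nil => simp [run]
  | cons a l ih => simp [run, (h _ _).1, (h _ _).2, ih]

/-- In state `s` the transducer recognizes the end of one more tree than the counter says. -/
theorem Transducer.run_scan (T : Transducer Bool Γ' S) (s s' : S) (w : Bool → List Γ')
    (h₁ : ∀ z, T.next s z true = s ∧ T.count s z true = some true ∧ T.out s z true = w true)
    (h₂ : T.next s false false = s ∧ T.count s false false = some false ∧
      T.out s false false = w false)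
    (h₃ : T.next s true false = s' ∧ T.count s true false = none ∧ T.out s true false = w false)
    (t : Code) (n : ℕ) (l : List Bool) : T.run s n (t.enc ++ l) = t.enc.flatMap w ++
      if n = 0 then T.run s' 0 l else T.run s (n - 1) l := by
  induction t generalizing n l with
  | nil =>
    rcases n with _ | n
    · simp [Code.enc, run, h₃, applyCount]
    · simp [Code.enc, run, h₂, applyCount]
  | cons a b iha ihb =>
    simp only [Code.enc, List.cons_append, run, h₁, applyCount, List.append_assoc,
      List.flatMap_cons, List.flatMap_append]
    rw [iha, ihb]
    simp

end Scanning

/-- This transducer separates the first component from the rest of a tree that is not a leaf. For a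
leaf it outputs `d`. -/
def splitTransducer (first : Bool) (d : List Bool) : Transducer Bool Bool (Fin 4) where
  next
    | 0, _, false => 3
    | 0, _, true => 1
    | 1, true, false => 2
    | s, _, _ => s
  count
    | 1, _, true => some true
    | 1, false, false => some false
    | _, _, _ => none
  out
    | 1, _, a => cond first [a] []
    | 2, _, a => cond first [] [a]
    | _, _, _ => []
  fin
    | 3 => d
    | _ => []

theorem run_splitTransducer_leaf (first : Bool) (d : List Bool) :
    (splitTransducer first d).run 0 0 Code.nil.enc = d := by
  simp [Code.enc, Transducer.run, splitTransducer]

theorem run_splitTransducer_cons (first : Bool) (d : List Bool) (a b : Code) :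
    (splitTransducer first d).run 0 0 (true :: (a.enc ++ b.enc)) =
      cond first a.enc b.enc := by
  have h1 : (splitTransducer first d).run 1 0 (a.enc ++ b.enc) = _ :=
    (splitTransducer first d).run_scan 1 2 (fun a => cond first [a] [])
    (by intro z; cases z <;> simp [splitTransducer]) (by simp [splitTransducer])
    (by simp [splitTransducer]) a 0 b.enc
  have h2 : (splitTransducer first d).run 2 0 b.enc = _ :=
    (splitTransducer first d).run_stay 2 (fun a => cond first [] [a])
    (by intro z a; cases z <;> cases a <;> simp [splitTransducer]) 0 b.enc
  have h3 : (splitTransducer first d).run 0 0 (true :: (a.enc ++ b.enc)) =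
      (splitTransducer first d).run 1 0 (a.enc ++ b.enc) := rfl
  rw [h3, h1, h2]
  cases first <;> simp [splitTransducer]

/-- This transducer tells whether a tree is a leaf. -/
def leafTransducer : Transducer Bool Bool (Fin 3) where
  next
    | 0, _, false => 1
    | 0, _, true => 2
    | s, _, _ => s
  count _ _ _ := none
  out _ _ _ := []
  fin
    | 1 => enc true
    | _ => enc false

/-- This transducer outputs `x` or `y` on reading `(b, x, y)`, according to `b`. -/
def selectTransducer : Transducer Bool Bool (Fin 10) where
  next
    | 0, _, _ => 1
    | 1, _, false => 2
    | 1, _, true => 3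
    | 2, _, _ => 4
    | 4, true, false => 9
    | 3, _, _ => 5
    | 5, _, _ => 6
    | 6, _, _ => 7
    | 7, true, false => 8
    | s, _, _ => s
  count
    | 4, _, true => some true
    | 4, false, false => some false
    | 7, _, true => some true
    | 7, false, false => some false
    | _, _, _ => none
  out
    | 7, _, a => [a]
    | 9, _, a => [a]
    | _, _, _ => []
  fin _ := []

theorem run_selectTransducer_false (x y : Code) : selectTransducer.run 0 0
    (true :: false :: true :: (x.enc ++ y.enc)) = y.enc := by
  have h1 : selectTransducer.run 4 0 (x.enc ++ y.enc) = _ :=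
    selectTransducer.run_scan 4 9 (fun _ => [])
    (by intro z; cases z <;> simp [selectTransducer]) (by simp [selectTransducer])
    (by simp [selectTransducer]) x 0 y.enc
  have h2 : selectTransducer.run 9 0 y.enc = _ :=
    selectTransducer.run_stay 9 (fun a => [a])
    (by intro z a; cases z <;> cases a <;> simp [selectTransducer]) 0 y.enc
  have h3 : selectTransducer.run 0 0 (true :: false :: true :: (x.enc ++ y.enc)) =
      selectTransducer.run 4 0 (x.enc ++ y.enc) := rfl
  rw [h3, h1, h2]
  simp [selectTransducer]

theorem run_selectTransducer_true (x y : Code) : selectTransducer.run 0 0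
    (true :: true :: false :: false :: true :: (x.enc ++ y.enc)) = x.enc := by
  have h1 : selectTransducer.run 7 0 (x.enc ++ y.enc) = _ :=
    selectTransducer.run_scan 7 8 (fun a => [a])
    (by intro z; cases z <;> simp [selectTransducer]) (by simp [selectTransducer])
    (by simp [selectTransducer]) x 0 y.enc
  have h2 : selectTransducer.run 8 0 y.enc = _ :=
    selectTransducer.run_stay 8 (fun _ => [])
    (by intro z a; cases z <;> cases a <;> simp [selectTransducer]) 0 y.enc
  have h3 : selectTransducer.run 0 0
      (true :: true :: false :: false :: true :: (x.enc ++ y.enc)) =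
      selectTransducer.run 7 0 (x.enc ++ y.enc) := rfl
  rw [h3, h1, h2]
  simp [selectTransducer]

/-- This transducer ignores its input. -/
def constTransducer (d : List Bool) : Transducer Bool Bool Unit where
  next _ _ _ := ()
  count _ _ _ := none
  out _ _ _ := []
  fin _ := d

namespace PT

section
variable {α β γ δ : Type} [Coded α] [Coded β] [Coded γ] [Coded δ]

theorem id : PT (fun a : α => a) := ⟨idComputableInPolyTime _⟩

theorem comp {g : β → γ} {f : α → β} (hg : PT g) (hf : PT f) : PT fun a => g (f a) :=
  PolyTime.comp hg hf

theorem pair {f : α → β} {g : α → γ} (hf : PT f) (hg : PT g) : PT fun a => (f a, g a) :=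
  (PolyTime.pair hf hg).congr fun _ => rfl

theorem fst : PT (Prod.fst : α × β → α) :=
  (splitTransducer true []).polyTime 0 fun _ => run_splitTransducer_cons _ _ _ _

theorem snd : PT (Prod.snd : α × β → β) :=
  (splitTransducer false []).polyTime 0 fun _ => run_splitTransducer_cons _ _ _ _

theorem const (b : β) : PT fun _ : α => b :=
  (constTransducer (enc b)).polyTime () fun a => by
    rw [(constTransducer (enc b)).run_stay () (fun _ => []) (by simp [constTransducer])]
    simp [constTransducer]

theorem isEmpty : PT fun l : List α => l.isEmpty :=
  leafTransducer.polyTime 0 fun l => by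
    cases l with
    | nil => rfl
    | cons a l =>
      have h := leafTransducer.run_stay 2 (fun _ => [])
        (by intro z a; cases z <;> cases a <;> simp [leafTransducer]) 0 (enc a ++ enc l)
      have h' : leafTransducer.run 0 0 (enc (a :: l)) = leafTransducer.run 2 0 (enc a ++ enc l) :=
        rfl
      have e : ∀ l : List Bool, l.flatMap (fun _ => ([] : List Bool)) = [] := by simp
      rw [h', h, e]
      rfl

theorem headD (d : α) : PT fun l : List α => l.headD d :=
  (splitTransducer true (enc d)).polyTime 0 fun l => by
    cases l with
    | nil => exact run_splitTransducer_leaf _ _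
    | cons a l => exact run_splitTransducer_cons _ _ _ _

theorem tail : PT fun l : List α => l.tail :=
  (splitTransducer false [false]).polyTime 0 fun l => by
    cases l with
    | nil => exact run_splitTransducer_leaf _ _
    | cons a l => exact run_splitTransducer_cons _ _ _ _

theorem getD (d : α) : PT fun o : Option α => o.getD d :=
  (PolyTime.restrict (headD d) (fun o : Option α => o.toList) (fun o => by
    cases o <;> rfl)).congr fun o => by cases o <;> rfl

theorem optionSome {f : α → β} (hf : PT f) : PT fun a => some (f a) :=
  (pair hf (const ())).congr fun _ => rfl

theorem cons {f : α → β} {g : α → List β} (hf : PT f) (hg : PT g) : PT fun a => f a :: g a :=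
  (pair hf hg).congr fun _ => rfl

theorem inl {f : α → β} (hf : PT f) : PT fun a => (Sum.inl (f a) : β ⊕ γ) :=
  (pair (const false) hf).congr fun _ => rfl

theorem inr {f : α → γ} (hf : PT f) : PT fun a => (Sum.inr (f a) : β ⊕ γ) :=
  (pair (const true) hf).congr fun _ => rfl

theorem ite {b : α → Bool} {f g : α → β} (hb : PT b) (hf : PT f) (hg : PT g) :
    PT fun a => if b a then f a else g a := by
  have h : PT fun p : Bool × β × β => if p.1 then p.2.1 else p.2.2 :=
    selectTransducer.polyTime 0 fun p => by
      obtain ⟨_ | _, x, y⟩ := p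
      · exact run_selectTransducer_false _ _
      · exact run_selectTransducer_true _ _
  exact h.comp (hb.pair (hf.pair hg))

theorem not {b : α → Bool} (hb : PT b) : PT fun a => !b a :=
  (hb.ite (const false) (const true)).congr fun a => by cases b a <;> rfl

theorem isSome : PT fun o : Option α => o.isSome := by
  have h : PT fun o : Option α => o.toList.isEmpty :=
    PolyTime.restrict isEmpty (fun o : Option α => o.toList) fun o => by cases o <;> rfl
  exact h.not.congr fun o => by cases o <;> rfl

theorem and {b c : α → Bool} (hb : PT b) (hc : PT c) : PT fun a => b a && c a :=
  (hb.ite hc (const false)).congr fun a => by cases b a <;> rfl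

theorem beq {b c : α → Bool} (hb : PT b) (hc : PT c) : PT fun a => b a == c a :=
  (hb.ite hc hc.not).congr fun a => by cases b a <;> cases c a <;> rfl

end
end PT

/-! ### Bounds and folds -/

/-- The quantity `g` is bounded by a polynomial in the size of the argument. -/
def Bdd {α : Type} [Coded α] (g : α → ℕ) : Prop :=
  ∃ p : Polynomial ℕ, ∀ a, g a ≤ p.eval (size a)

namespace Bdd
variable {α β : Type} [Coded α] [Coded β]

theorem const (n : ℕ) : Bdd fun _ : α => n := ⟨.C n, fun _ => by simp⟩

theorem mono {f g : α → ℕ} (hg : Bdd g) (h : ∀ a, f a ≤ g a) : Bdd f :=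
  hg.imp fun _ hp a => (h a).trans (hp a)

theorem add {f g : α → ℕ} (hf : Bdd f) (hg : Bdd g) : Bdd fun a => f a + g a := by
  obtain ⟨p, hp⟩ := hf
  obtain ⟨q, hq⟩ := hg
  exact ⟨p + q, fun a => by simpa using Nat.add_le_add (hp a) (hq a)⟩

theorem mul {f g : α → ℕ} (hf : Bdd f) (hg : Bdd g) : Bdd fun a => f a * g a := by
  obtain ⟨p, hp⟩ := hf
  obtain ⟨q, hq⟩ := hg
  exact ⟨p * q, fun a => by simpa using Nat.mul_le_mul (hp a) (hq a)⟩

theorem eval {f : α → ℕ} (hf : Bdd f) (p : Polynomial ℕ) : Bdd fun a => p.eval (f a) := by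
  obtain ⟨q, hq⟩ := hf
  exact ⟨p.comp q, fun a => by simpa using eval_mono p (hq a)⟩

theorem size {f : α → β} (hf : PT f) : Bdd fun a => size (f a) := by
  obtain ⟨p, hp⟩ := hf.exists_length_le
  exact ⟨p, hp⟩

end Bdd

/-- A fold is computable in polynomial time if its intermediate results are of polynomial size. -/
theorem PT.foldl {α σ X : Type} [Coded α] [Coded σ] [Coded X] {list : X → List α} {init : X → σ}
    {f : X → σ → α → σ} (hl : PT list) (hi : PT init)
    (hf : PT fun p : (X × σ) × α => f p.1.1 p.1.2 p.2) {B : X → ℕ} (hB : Bdd B)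
    (h : ∀ x l, l <+: list x → size (l.foldl (f x) (init x)) ≤ B x) :
    PT fun x => (list x).foldl (f x) (init x) := by
  -- The loop runs on the remaining list, the parameters and the current value. The code of a
  -- nonempty list is that of the pair of its head and its tail, which are what the body needs.
  let start : X → List α × (X × σ) := fun x => (list x, x, init x)
  let F : (α × List α) × (X × σ) → List α × (X × σ) := fun y =>
    (y.1.2, y.2.1, f y.2.1 y.2.2 y.1.1)
  let next : List α × (X × σ) → Option ((α × List α) × (X × σ)) := fun s => match s.1 with
    | [] => none
    | a :: l => some ((a, l), s.2)
  have hF : PT F := (snd.comp fst).pair ((fst.comp snd).pair (hf.comp (snd.pair (fst.comp fst))))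
  have hstart : PT start := hl.pair (id.pair hi)
  obtain ⟨q, hq⟩ := hB
  have key : ∀ (x : X) (l₂ l₁ : List α), list x = l₁ ++ l₂ →
      Rounds enc next F ((.X + q : Polynomial ℕ).eval (size (start x))) l₂.length
        (l₂, x, l₁.foldl (f x) (init x)) ([], x, (list x).foldl (f x) (init x)) := by
    intro x l₂ l₁ e
    have hs : size (l₂, x, l₁.foldl (f x) (init x)) ≤
        (.X + q : Polynomial ℕ).eval (size (start x)) := by
      have h1 := h x l₁ ⟨l₂, e.symm⟩
      have h2 : size l₂ ≤ size (list x) := size_le_of_sublist (by simp [e])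
      have h3 := hq x
      have h4 : q.eval (size x) ≤ q.eval (size (start x)) :=
        eval_mono q (by simp [start]; omega)
      have h5 : 1 ≤ size (init x) := by
        simp only [size, enc]; cases Coded.code (init x) <;> simp [Code.enc]
      simp only [Polynomial.eval_add, Polynomial.eval_X]
      simp only [start, size_pair] at h4 ⊢
      omega
    induction l₂ generalizing l₁ with
    | nil => simpa [e] using Rounds.done (F := F) (next := next) rfl hs
    | cons a l ih =>
      refine Rounds.step (y := ((a, l), x, l₁.foldl (f x) (init x))) rfl hs ?_
      have e' : list x = (l₁ ++ [a]) ++ l := by simp [e]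
      have hs' : size (l, x, (l₁ ++ [a]).foldl (f x) (init x)) ≤
          (.X + q : Polynomial ℕ).eval (size (start x)) := by
        have h1 := h x (l₁ ++ [a]) ⟨l, e'.symm⟩
        have h2 : size l ≤ size (list x) := size_le_of_sublist (by simp [e])
        have h3 := hq x
        have h4 : q.eval (size x) ≤ q.eval (size (start x)) :=
          eval_mono q (by simp [start]; omega)
        have h5 : 1 ≤ size (init x) := by
          simp only [size, enc]; cases Coded.code (init x) <;> simp [Code.enc]
        simp only [Polynomial.eval_add, Polynomial.eval_X]
        simp only [start, size_pair] at h4 ⊢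
        omega
      have := ih (l₁ ++ [a]) e' hs'
      simpa [F] using this
  have h1 : PolyTime (fun x => enc (start x)) enc
      (fun x => (([], x, (list x).foldl (f x) (init x)) : List α × (X × σ))) := by
    refine PolyTime.while hF next ?_ ?_ start _ (fun _ => rfl) .X (.X + q) fun x => ?_
    · rintro ⟨_ | ⟨a, l⟩, s⟩ y hy
      · cases hy
      · cases hy; rfl
    · rintro ⟨_ | ⟨a, l⟩, s⟩
      · exact ⟨_, rfl⟩
      · exact ⟨_, rfl⟩
    · refine ⟨(list x).length, ?_, key x (list x) [] rfl⟩
      have := length_le_size (list x)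
      simp only [Polynomial.eval_X]
      refine this.trans ?_
      change _ ≤ size (start x)
      simp [start]; omega
  have h2 : PolyTime (enc : X → _) (fun x => enc (start x)) (fun x => x) :=
    PolyTime.congr hstart fun _ => rfl
  exact (snd.comp (snd.comp (g := Prod.snd) (f := fun x => (([], x, (list x).foldl (f x) (init x)) :
    List α × (X × σ))) (h1.comp h2)))

/-! ### Lists in polynomial time -/

namespace PT

section
variable {α β X : Type} [Coded α] [Coded β] [Coded X]

theorem reverse {f : X → List α} (hf : PT f) : PT fun x => (f x).reverse := by
  have e : ∀ l : List α, l.foldl (fun acc a => a :: acc) [] = l.reverse := fun l => by simp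
  have := foldl (f := fun _ acc a => a :: acc) hf (const ([] : List α))
    (snd.cons (snd.comp fst)) (Bdd.size hf) fun x l hl => by
      rw [e, size_reverse]; exact size_le_of_sublist hl.sublist
  exact this.congr fun x => by rw [e]

theorem append {f g : X → List α} (hf : PT f) (hg : PT g) : PT fun x => f x ++ g x := by
  have e : ∀ l l' : List α, l.foldl (fun acc a => a :: acc) l' = l.reverse ++ l' := fun l l' => by
    simp
  have := foldl (f := fun _ acc a => a :: acc) hf.reverse hg
    (snd.cons (snd.comp fst)) ((Bdd.size hf).add (Bdd.size hg)) fun x l hl => by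
      have h1 := size_append l.reverse (g x)
      have h2 := size_le_of_sublist hl.sublist
      rw [size_reverse] at h1 h2
      rw [e]; omega
  exact this.congr fun x => by rw [e, List.reverse_reverse]

theorem map {list : X → List α} {f : X → α → β} (hl : PT list)
    (hf : PT fun p : X × α => f p.1 p.2) : PT fun x => (list x).map (f x) := by
  have e : ∀ (x : X) (l : List α),
      l.foldl (fun acc a => f x a :: acc) [] = (l.map (f x)).reverse := by
    intro x l
    rw [← List.map_reverse, ← List.foldr_reverse]
    induction l.reverse <;> simp_all
  obtain ⟨p, hp⟩ := Bdd.size hf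
  have := foldl (f := fun x acc a => f x a :: acc) hl (const ([] : List β))
    ((hf.comp ((fst.comp fst).pair snd)).cons (snd.comp fst))
    (((Bdd.size hl).mul (((((Bdd.size (α := X) PT.id).add (Bdd.size hl)).add
      (Bdd.const 1)).eval p).add (Bdd.const 1))).add (Bdd.const 1)) fun x l hl' => by
      rw [e, size_reverse]
      refine (size_list_le (B := p.eval (size x + size (list x) + 1)) ?_).trans ?_
      · intro b hb
        obtain ⟨a, ha, rfl⟩ := List.mem_map.1 hb
        refine (hp (x, a)).trans (eval_mono p ?_)
        have := size_le_of_mem (hl'.subset ha)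
        simp; omega
      · have h1 : l.length ≤ size (list x) := hl'.length_le.trans (length_le_size _)
        rw [List.length_map]
        gcongr
  exact this.reverse.congr fun x => by rw [e, List.reverse_reverse]

theorem flatten {f : X → List (List α)} (hf : PT f) : PT fun x => (f x).flatten := by
  have e : ∀ l : List (List α), l.foldl (fun acc a => acc ++ a) [] = l.flatten := by
    have : ∀ (l : List (List α)) b, l.foldl (fun acc a => acc ++ a) b = b ++ l.flatten := by
      intro l
      induction l with
      | nil => simp
      | cons a l ih => intro b; simp [ih]
    simpa using fun l => this l []
  have hs : ∀ l : List (List α), size l.flatten ≤ size l := by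
    intro l
    induction l with
    | nil => simp
    | cons a l ih =>
      have := size_append a l.flatten
      simp; omega
  have := foldl (f := fun _ acc a => acc ++ a) hf (const ([] : List α))
    ((snd.comp fst).append snd) (Bdd.size hf) fun x l hl => by
      rw [e]; exact (hs l).trans (size_le_of_sublist hl.sublist)
  exact this.congr fun x => by rw [e]

theorem flatMap {list : X → List α} {f : X → α → List β} (hl : PT list)
    (hf : PT fun p : X × α => f p.1 p.2) : PT fun x => (list x).flatMap (f x) :=
  (hl.map hf).flatten.congr fun x => by rw [List.flatMap_def]

theorem filter {list : X → List α} {p : X → α → Bool} (hl : PT list)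
    (hp : PT fun y : X × α => p y.1 y.2) : PT fun x => (list x).filter (p x) :=
  (hl.flatMap (f := fun x a => if p x a then [a] else [])
    (hp.ite (snd.cons (const [])) (const []))).congr fun x => congrArg enc <| by
      induction list x with
      | nil => rfl
      | cons a l ih => cases h : p x a <;> simp_all

theorem any {list : X → List α} {p : X → α → Bool} (hl : PT list)
    (hp : PT fun y : X × α => p y.1 y.2) : PT fun x => (list x).any (p x) :=
  (isEmpty.comp (hl.filter hp)).not.congr fun x => congrArg enc <| by
      induction list x with
      | nil => rfl
      | cons a l ih => cases h : p x a <;> simp_all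

/-- Drop as many entries as another list has. -/
theorem drop {f : X → List α} {g : X → List β} (hf : PT f) (hg : PT g) :
    PT fun x => (f x).drop (g x).length := by
  have e : ∀ (l' : List β) (l : List α), l'.foldl (fun acc _ => acc.tail) l = l.drop l'.length := by
    intro l'
    induction l' with
    | nil => simp
    | cons b l' ih => intro l; simp [ih, List.drop_tail]
  have := foldl (f := fun _ (acc : List α) _ => acc.tail) hg hf (tail.comp (snd.comp fst))
    (Bdd.size hf) fun x l hl => by
      rw [e]; exact size_le_of_sublist (List.drop_sublist _ _)
  exact this.congr fun x => by rw [e]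

theorem length_le {f : X → List α} {g : X → List β} (hf : PT f) (hg : PT g) :
    PT fun x => decide ((f x).length ≤ (g x).length) :=
  (isEmpty.comp (hf.drop hg)).congr fun x => congrArg enc <| by
    rw [Bool.eq_iff_iff]; simp

theorem length_lt {f : X → List α} {g : X → List β} (hf : PT f) (hg : PT g) :
    PT fun x => decide ((f x).length < (g x).length) :=
  (hg.length_le hf).not.congr fun x => congrArg enc <| by
    rw [Bool.eq_iff_iff]; simp

theorem dropLast {f : X → List α} (hf : PT f) : PT fun x => (f x).dropLast :=
  (tail.comp hf.reverse).reverse.congr fun x => by simp [List.tail_reverse]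

theorem getLastD {f : X → List α} (hf : PT f) (d : α) : PT fun x => (f x).getLastD d :=
  ((headD d).comp hf.reverse).congr fun x => by
    congr 1
    rcases List.eq_nil_or_concat (f x) with h | ⟨l, a, h⟩ <;> simp [h]

/-- Equality of bit strings. -/
theorem eqBits {f g : X → List Bool} (hf : PT f) (hg : PT g) : PT fun x => decide (f x = g x) := by
  let step : Bool × List Bool → Bool → Bool × List Bool := fun s a =>
    (s.1 && (!s.2.isEmpty && (s.2.headD false == a)), s.2.tail)
  have e : ∀ (l : List Bool) (s : Bool × List Bool), ((l.foldl step s).1 &&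
      (l.foldl step s).2.isEmpty) = (s.1 && decide (l = s.2)) ∧
      size (l.foldl step s).2 ≤ size s.2 := by
    intro l
    induction l with
    | nil =>
      rintro ⟨b, _ | ⟨c, s⟩⟩ <;> simp
    | cons a l ih =>
      rintro ⟨b, _ | ⟨c, s⟩⟩
      · have := ih (step (b, []) a)
        simp only [List.foldl_cons]
        rw [this.1]
        exact ⟨by simp [step], this.2.trans (by simp [step])⟩
      · have := ih (step (b, c :: s) a)
        simp only [List.foldl_cons]
        rw [this.1]
        refine ⟨?_, this.2.trans (by simp [step]; omega)⟩
        rw [Bool.eq_iff_iff]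
        cases a <;> cases c <;> simp [step] <;> exact fun _ => decide_eq_true_iff
  have h : PT fun x => (f x).foldl step (true, g x) := by
    refine foldl (f := fun _ => step) hf ((const true).pair hg) ?_
      (((Bdd.size hg).add (Bdd.const 4))) fun x l hl => ?_
    · have hs : PT fun p : (X × (Bool × List Bool)) × Bool => p.1.2 := snd.comp fst
      exact ((fst.comp hs).and ((isEmpty.comp (snd.comp hs)).not.and
        (((headD false).comp (snd.comp hs)).beq snd))).pair (tail.comp (snd.comp hs))
    · have := (e l (true, g x)).2
      have := size_bool_le (l.foldl step (true, g x)).1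
      have : ∀ p : Bool × List Bool, size p = size p.1 + size p.2 + 1 := fun _ => size_pair _ _
      rw [this]
      simp only at *
      omega
  exact ((fst.comp h).and (isEmpty.comp (snd.comp h))).congr fun x => by
    rw [(e (f x) (true, g x)).1]; simp

theorem memBits {f : X → List Bool} {g : X → List (List Bool)} (hf : PT f) (hg : PT g) :
    PT fun x => decide (f x ∈ g x) :=
  (hg.any (p := fun x a => decide (f x = a)) (PT.eqBits (hf.comp fst) snd)).congr fun x => by
    congr 1
    rw [Bool.eq_iff_iff]
    simp

/-- The values of a polynomial at the length of a list, in unary. -/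
theorem unary {f : X → List α} (hf : PT f) (p : Polynomial ℕ) :
    PT fun x => List.replicate (p.eval (f x).length) () := by
  have add : ∀ m n : X → ℕ, PT (fun x => List.replicate (m x) ()) →
      PT (fun x => List.replicate (n x) ()) → PT (fun x => List.replicate (m x + n x) ()) :=
    fun m n hm hn => (hm.append hn).congr fun x => by rw [List.replicate_append_replicate]
  have mul : ∀ m n : X → ℕ, PT (fun x => List.replicate (m x) ()) →
      PT (fun x => List.replicate (n x) ()) → PT (fun x => List.replicate (m x * n x) ()) :=
    fun m n hm hn => (hm.flatMap (f := fun x _ => List.replicate (n x) ())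
      (hn.comp fst)).congr fun x => by
        congr 1
        generalize m x = k
        induction k with
        | zero => simp
        | succ k ih =>
          rw [List.replicate_succ, List.flatMap_cons, ih, List.replicate_append_replicate]
          congr 1; ring
  have len : PT fun x => List.replicate (f x).length () :=
    (hf.map (f := fun _ _ => ()) (const ())).congr fun x => by simp
  induction p using Polynomial.induction_on' with
  | add p q hp hq => simpa using add _ _ hp hq
  | monomial n a =>
    induction n generalizing a with
    | zero => simpa using (const (α := X) (List.replicate a ()))
    | succ n ih => simpa [pow_succ, mul_assoc] using mul _ _ (ih a) len

end
end PT

/-! ### Strings over finite alphabets -/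

/-- The encoding of trees is prefix-free. -/
theorem Code.enc_append_inj : ∀ (a b : Code) {l l' : List Bool}, a.enc ++ l = b.enc ++ l' →
    a = b ∧ l = l'
  | .nil, .nil, l, l', h => by simpa [enc] using h
  | .nil, .cons _ _, l, l', h => by simp [enc] at h
  | .cons _ _, .nil, l, l', h => by simp [enc] at h
  | .cons a b, .cons c d, l, l', h => by
    simp only [enc, List.cons_append, List.append_assoc, List.cons.injEq, true_and] at h
    have h1 := enc_append_inj a c h
    have h2 := enc_append_inj b d h1.2
    rw [h1.1, h2.1]
    exact ⟨rfl, h2.2⟩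

/-- This transducer replaces the symbols of a string by their representations. -/
def readTransducer (Γ : Type) [Coded Γ] : Transducer Γ Bool Unit where
  next _ _ _ := ()
  count _ _ _ := none
  out _ _ a := true :: enc a
  fin _ := [false]

/-- Passage from a string to its representation. -/
theorem PolyTime.readString (Γ : Type) [Fintype Γ] [Coded Γ] :
    PolyTime (fun l : List Γ => l) enc fun l : List Γ => l :=
  (readTransducer Γ).polyTime () fun l => by
    rw [(readTransducer Γ).run_stay () (fun a => true :: enc a) (by simp [readTransducer])]
    induction l with
    | nil => rfl
    | cons a l ih => simpa [enc_cons] using ih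

open Classical in
/-- This transducer replaces the representations of symbols by the symbols. Its state is the part
of the representation of a symbol that has been read. -/
noncomputable def writeTransducer (Γ : Type) [Coded Γ] (N : ℕ) :
    Transducer Bool Γ {l : List Bool // l.length ≤ N} where
  next s _ a := if h : (s.1 ++ [a]).length ≤ N ∧ ¬ ∃ x : Γ, true :: enc x = s.1 ++ [a] then
    ⟨_, h.1⟩ else ⟨[], Nat.zero_le _⟩
  count _ _ _ := none
  out s _ a := if h : ∃ x : Γ, true :: enc x = s.1 ++ [a] then [h.choose] else []
  fin _ := []

/-- Passage from the representation of a string to the string. -/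
theorem PolyTime.writeString (Γ : Type) [Fintype Γ] [Coded Γ]
    (hΓ : Function.Injective (Coded.code : Γ → Code)) :
    PolyTime enc (fun l : List Γ => l) fun l : List Γ => l := by
  let N := Finset.univ.sup fun x : Γ => (enc x).length + 1
  have hN : ∀ x : Γ, (enc x).length + 1 ≤ N := fun x =>
    Finset.le_sup (f := fun x : Γ => (enc x).length + 1) (Finset.mem_univ x)
  have : Fintype {l : List Bool // l.length ≤ N} := (List.finite_length_le Bool N).fintype
  refine (writeTransducer Γ N).polyTime ⟨[], Nat.zero_le _⟩ fun l => ?_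
  have word : ∀ (x : Γ) (r s : List Bool) (hs : s.length ≤ N) (l : List Bool), r ≠ [] →
      true :: enc x = s ++ r → (writeTransducer Γ N).run ⟨s, hs⟩ 0 (r ++ l) =
        x :: (writeTransducer Γ N).run ⟨[], Nat.zero_le _⟩ 0 l := by
    intro x r
    induction r with
    | nil => intro s hs l h; exact (h rfl).elim
    | cons a r ih =>
      intro s hs l _ hx
      have uniq : ∀ y : Γ, true :: enc y = s ++ [a] → y = x ∧ r = [] := by
        intro y hy
        have h1 : true :: (enc x ++ []) = true :: (enc y ++ r) := by
          rw [List.append_nil, hx, ← List.cons_append, hy]; simp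
        have h2 := Code.enc_append_inj _ _ (List.cons.inj h1).2
        exact ⟨(hΓ h2.1).symm, h2.2.symm⟩
      by_cases hr : r = []
      · subst hr
        have hex : ∃ y : Γ, true :: enc y = s ++ [a] := ⟨x, hx⟩
        have h1 : hex.choose = x := (uniq _ hex.choose_spec).1
        simp only [List.cons_append, List.nil_append, Transducer.run]
        have h2 : (writeTransducer Γ N).out ⟨s, hs⟩ (0 == 0) a = [x] := by
          simp only [writeTransducer]
          rw [dif_pos hex, h1]
        have h3 : (writeTransducer Γ N).next ⟨s, hs⟩ (0 == 0) a = ⟨[], Nat.zero_le _⟩ := by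
          simp only [writeTransducer]
          rw [dif_neg (fun h => h.2 hex)]
        rw [h2, h3]
        rfl
      · have hex : ¬ ∃ y : Γ, true :: enc y = s ++ [a] := fun ⟨y, hy⟩ => hr (uniq y hy).2
        have hlen : (s ++ [a]).length ≤ N := by
          have := hN x
          have h4 := congrArg List.length hx
          simp only [List.length_cons, List.length_append, List.length_nil] at h4 ⊢
          omega
        have h2 : (writeTransducer Γ N).out ⟨s, hs⟩ (0 == 0) a = [] := by
          simp only [writeTransducer]
          rw [dif_neg hex]
        have h3 : (writeTransducer Γ N).next ⟨s, hs⟩ (0 == 0) a = ⟨s ++ [a], hlen⟩ := by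
          simp only [writeTransducer]
          rw [dif_pos ⟨hlen, hex⟩]
        simp only [List.cons_append, Transducer.run, h2, h3]
        exact ih (s ++ [a]) hlen l hr (by simpa using hx)
  induction l with
  | nil =>
    have hex : ¬ ∃ y : Γ, true :: enc y = [] ++ [false] := by simp
    simp only [enc_nil, Transducer.run, writeTransducer]
    rw [dif_neg hex]
    rfl
  | cons a l ih =>
    have := word a (true :: enc a) [] (Nat.zero_le _) (enc l) (by simp) rfl
    rw [enc_cons, ← List.cons_append, this, ih]

/-- A polynomial-time machine for `f`, on whatever encodings, can be used as a subroutine. -/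
theorem PolyTime.toPT {α β Γ₀ Γ₁ X : Type} [Fintype Γ₀] [Fintype Γ₁] [Coded Γ₀] [Coded Γ₁]
    [Coded X] {ea : α → List Γ₀} {eb : β → List Γ₁} {f : α → β} (hf : PolyTime ea eb f)
    (h₀ : Function.Injective (Coded.code : Γ₀ → Code)) {g : X → α} (hg : PT fun x => ea (g x)) :
    PT fun x => eb (f (g x)) := by
  have h1 : PolyTime enc ea g := ((PolyTime.writeString Γ₀ h₀).comp hg).congr fun _ => rfl
  have h2 : PolyTime enc (fun l : List Γ₁ => l) (fun x => eb (f (g x))) :=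
    (hf.comp h1).congr fun _ => rfl
  exact (PolyTime.readString Γ₁).comp h2

/-- A function on strings can be computed by way of coded representations. -/
theorem PT.toPolyTime {β Γ₀ Γ : Type} [Fintype Γ₀] [Fintype Γ] [Coded Γ₀] [Coded Γ]
    {eb : β → List Γ} {f : List Γ₀ → β} (hf : PT fun x => eb (f x))
    (h₁ : Function.Injective (Coded.code : Γ → Code)) : PolyTime (fun l => l) eb f :=
  (((PolyTime.writeString Γ h₁).comp hf).comp (PolyTime.readString Γ₀)).congr fun _ => rfl

theorem injective_code_bool : Function.Injective (Coded.code : Bool → Code) := by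
  rintro (_ | _) (_ | _) h <;> first | rfl | cases h

theorem injective_code_option {α : Type} [Coded α]
    (h : Function.Injective (Coded.code : α → Code)) :
    Function.Injective (Coded.code : Option α → Code) := by
  rintro (_ | a) (_ | b) e
  · rfl
  · cases e
  · cases e
  · exact congrArg some (h (Code.cons.inj e).1)

theorem injective_code_sum {α β : Type} [Coded α] [Coded β]
    (h : Function.Injective (Coded.code : α → Code))
    (h' : Function.Injective (Coded.code : β → Code)) :
    Function.Injective (Coded.code : α ⊕ β → Code) := by
  rintro (a | a) (b | b) e
  · exact congrArg _ (h (Code.cons.inj e).2)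
  · cases (Code.cons.inj e).1
  · cases (Code.cons.inj e).1
  · exact congrArg _ (h' (Code.cons.inj e).2)

/-! ### Binary numbers -/

theorem encodeNat_posNum (p : PosNum) : encodeNat (p : ℕ) = encodePosNum p := by
  have : (((Num.pos p : Num) : ℕ) : Num) = Num.pos p := Num.of_to_nat _
  rw [Num.cast_pos] at this
  rw [encodeNat, this, encodeNum]

theorem exists_posNum {n : ℕ} (hn : n ≠ 0) : ∃ p : PosNum, (p : ℕ) = n := by
  have h : (((n : ℕ) : Num) : ℕ) = n := Num.to_of_nat n
  cases h' : (n : Num) with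
  | zero => rw [h'] at h; exact (hn h.symm).elim
  | pos p => rw [h'] at h; exact ⟨p, h⟩

theorem encodeNat_two_mul_add_one (n : ℕ) : encodeNat (2 * n + 1) = true :: encodeNat n := by
  rcases eq_or_ne n 0 with rfl | hn
  · rfl
  · obtain ⟨p, rfl⟩ := exists_posNum hn
    have : ((PosNum.bit1 p : PosNum) : ℕ) = 2 * (p : ℕ) + 1 := by
      rw [PosNum.cast_bit1]; ring
    rw [← this, encodeNat_posNum, encodeNat_posNum, encodePosNum]

theorem encodeNat_two_mul {n : ℕ} (hn : n ≠ 0) : encodeNat (2 * n) = false :: encodeNat n := by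
  obtain ⟨p, rfl⟩ := exists_posNum hn
  have : ((PosNum.bit0 p : PosNum) : ℕ) = 2 * (p : ℕ) := by
    rw [PosNum.cast_bit0]; ring
  rw [← this, encodeNat_posNum, encodeNat_posNum, encodePosNum]

/-- The number with the given binary digits, the least significant first, followed by a leading
digit `1`. -/
def numOf : List Bool → ℕ
  | [] => 1
  | b :: l => 2 * numOf l + b.toNat

theorem numOf_ne_zero (l : List Bool) : numOf l ≠ 0 := by
  induction l with
  | nil => simp [numOf]
  | cons b l ih => simp [numOf, ih]

theorem encodeNat_numOf (l : List Bool) : encodeNat (numOf l) = l ++ [true] := by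
  induction l with
  | nil => rfl
  | cons b l ih =>
    cases b
    · simpa [numOf, ih] using encodeNat_two_mul (numOf_ne_zero l)
    · simpa [numOf, ih] using encodeNat_two_mul_add_one (numOf l)

theorem numOf_injective : Function.Injective numOf := fun l l' h => by
  have := congrArg encodeNat h
  rw [encodeNat_numOf, encodeNat_numOf] at this
  exact List.append_cancel_right this

/-! ### Bit strings of a given length -/

/-- All extensions of the given strings by one bit. -/
def extend (L : List (List Bool)) : List (List Bool) :=
  L.flatMap fun s => [s ++ [false], s ++ [true]]

/-- All bit strings of length `m`. -/
def allStr : ℕ → List (List Bool)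
  | 0 => [[]]
  | m + 1 => extend (allStr m)

theorem mem_allStr {m : ℕ} {s : List Bool} : s ∈ allStr m ↔ s.length = m := by
  induction m generalizing s with
  | zero => simp [allStr]
  | succ m ih =>
    simp only [allStr, extend, List.mem_flatMap, List.mem_cons, List.not_mem_nil, or_false, ih]
    constructor
    · rintro ⟨t, ht, rfl | rfl⟩ <;> simp [ht]
    · intro h
      obtain ⟨t, b, rfl⟩ : ∃ t b, s = t ++ [b] :=
        ⟨s.dropLast, s.getLast (by rintro rfl; simp at h), (List.dropLast_append_getLast _).symm⟩
      refine ⟨t, by simpa using h, ?_⟩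
      cases b <;> simp

theorem length_extend (L : List (List Bool)) : (extend L).length = 2 * L.length := by
  induction L with
  | nil => rfl
  | cons a L ih => simp only [extend] at ih; simp [extend, ih]; omega

theorem length_allStr (m : ℕ) : (allStr m).length = 2 ^ m := by
  induction m with
  | zero => rfl
  | succ m ih => rw [allStr, length_extend, ih]; ring

theorem nodup_allStr (m : ℕ) : (allStr m).Nodup := by
  induction m with
  | zero => simp [allStr]
  | succ m ih =>
    simp only [allStr, extend]
    refine List.nodup_flatMap.2 ⟨fun s _ => by simp, ih.imp ?_⟩
    intro s t hst
    simp only [Function.onFun, List.disjoint_left]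
    intro u hu hu'
    simp only [List.mem_cons, List.not_mem_nil, or_false] at hu hu'
    rcases hu with rfl | rfl <;> rcases hu' with h | h <;>
      exact hst (List.append_inj_left' h rfl)

/-- A property that does not depend on the last bit. -/
theorem countP_allStr_succ (P : List Bool → Bool) {m : ℕ}
    (h : ∀ s b, s.length = m → P (s ++ [b]) = P s) :
    (allStr (m + 1)).countP P = 2 * (allStr m).countP P := by
  have : ∀ L : List (List Bool), (∀ s ∈ L, s.length = m) →
      (extend L).countP P = 2 * L.countP P := by
    intro L hL
    induction L with
    | nil => rfl
    | cons s L ih =>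
      have h1 := ih fun t ht => hL t (by simp [ht])
      have h2 := h s true (hL s (by simp))
      have h3 := h s false (hL s (by simp))
      simp only [extend] at h1
      simp only [extend, List.flatMap_cons, List.countP_append, List.countP_cons, h1, h2, h3,
        List.countP_nil]
      omega
  exact this _ fun s hs => mem_allStr.1 hs

/-- The infinite bit sequence that starts with `s` and goes on with zeros. -/
def bitsOf (s : List Bool) (j : ℕ) : Bool := s.getD j false

theorem padBits_eq {m : ℕ} (R : Fin m → Bool) : padBits R = bitsOf (List.ofFn R) := by
  funext j
  simp only [padBits, bitsOf, List.getD_eq_getElem?_getD, List.getElem?_ofFn]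
  split <;> simp

/-- Counting random strings as functions is counting them as lists. -/
theorem card_filter_padBits (m : ℕ) (P : (ℕ → Bool) → Bool) :
    (Finset.univ.filter fun R : Fin m → Bool => P (padBits R) = true).card =
      (allStr m).countP fun s => P (bitsOf s) := by
  rw [List.countP_eq_length_filter,
    ← List.toFinset_card_of_nodup ((nodup_allStr m).filter _)]
  refine Finset.card_bij (fun R _ => List.ofFn R) ?_ ?_ ?_
  · intro R hR
    simp only [Finset.mem_filter, Finset.mem_univ, true_and] at hR
    simp [mem_allStr, ← padBits_eq, hR]
  · intro R _ R' _ h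
    exact List.ofFn_injective h
  · intro s hs
    simp only [List.mem_toFinset, List.mem_filter, mem_allStr] at hs
    obtain ⟨rfl, h⟩ := hs
    exact ⟨s.get, by simp [padBits_eq, List.ofFn_get, h], List.ofFn_get s⟩

/-! ### Runs of a verifier -/

/-- The state of a run: the random bits read, the answers received, the verdict if there is one, and
the position of the last query. -/
abbrev RunState := (List Bool × List Bool) × (Option Bool × ℕ)

/-- The answers received so far. -/
abbrev RunState.answers (s : RunState) : List Bool := s.1.2

/-- The verdict. -/
abbrev RunState.verdict (s : RunState) : Option Bool := s.2.1

/-- The position of the last query. -/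
abbrev RunState.last (s : RunState) : ℕ := s.2.2

/-- The state at the beginning. -/
def RunState.init : RunState := (([], []), (none, 0))

/-- One move of a verifier with random bits `ρ`. The oracle is told how many answers it has given
and the position of the query; if it has no answer, the verifier has to wait for ever. -/
def runStep (V : Program) (x : List Bool) (ρ : ℕ → Bool) (o : ℕ → ℕ → Option Bool) :
    RunState → RunState
  | ((c, a), (some b, i)) => ((c, a), (some b, i))
  | ((c, a), (none, j)) => match V (x, c, a) with
    | .halt b => ((c, a), (some b, j))
    | .toss => ((c ++ [ρ c.length], a), (none, j))
    | .query i => match o a.length i with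
      | none => ((c, a), (none, j))
      | some b => ((c, a ++ [b]), (none, i))

/-- The state after `k` moves. -/
def runs (V : Program) (x : List Bool) (ρ : ℕ → Bool) (o : ℕ → ℕ → Option Bool) (k : ℕ) :
    RunState :=
  (runStep V x ρ o)^[k] .init

/-- The oracle that answers according to a fixed witness. -/
def witnessOracle (W : ℕ → Bool) : ℕ → ℕ → Option Bool := fun _ i => some (W i)

/-- The oracle that gives the answers `p`, whatever the queries are. -/
def guessOracle (p : List Bool) : ℕ → ℕ → Option Bool := fun n _ => p[n]?

section
variable {V : Program} {x : List Bool} {ρ : ℕ → Bool} {o : ℕ → ℕ → Option Bool}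

theorem runs_succ (k : ℕ) : runs V x ρ o (k + 1) = runStep V x ρ o (runs V x ρ o k) :=
  Function.iterate_succ_apply' _ _ _

theorem runStep_of_isSome {s : RunState} (h : s.verdict.isSome) : runStep V x ρ o s = s := by
  obtain ⟨⟨c, a⟩, ⟨_ | b, j⟩⟩ := s
  · cases h
  · rfl

theorem runs_eq_of_isSome {k m : ℕ} (h : (runs V x ρ o k).verdict.isSome) (hkm : k ≤ m) :
    runs V x ρ o m = runs V x ρ o k := by
  induction m, hkm using Nat.le_induction with
  | base => rfl
  | succ m _ ih => rw [runs_succ, ih, runStep_of_isSome h]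

/-- A move adds at most one answer. -/
theorem answers_runStep (s : RunState) : (runStep V x ρ o s).answers = s.answers ∨
    ∃ b, (runStep V x ρ o s).answers = s.answers ++ [b] := by
  obtain ⟨⟨c, a⟩, ⟨_ | b, j⟩⟩ := s
  · simp only [runStep]
    rcases V (x, c, a) with b | _ | i
    · exact .inl rfl
    · exact .inl rfl
    · simp only
      rcases o a.length i with _ | b
      · exact .inl rfl
      · exact .inr ⟨b, rfl⟩
  · exact .inl rfl

theorem answers_prefix_succ (k : ℕ) :
    (runs V x ρ o k).answers <+: (runs V x ρ o (k + 1)).answers := by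
  rw [runs_succ]
  rcases answers_runStep (V := V) (x := x) (ρ := ρ) (o := o) (runs V x ρ o k) with h | ⟨b, h⟩
  · rw [h]
  · rw [h]; exact List.prefix_append _ _

theorem answers_prefix {k m : ℕ} (h : k ≤ m) :
    (runs V x ρ o k).answers <+: (runs V x ρ o m).answers := by
  induction m, h using Nat.le_induction with
  | base => exact List.prefix_rfl
  | succ m _ ih => exact ih.trans (answers_prefix_succ m)

/-- As long as the true answers are as guessed, the guessed run is the true one. -/
theorem runs_guess_eq {W : ℕ → Bool} {p : List Bool} {k : ℕ}
    (h : (runs V x ρ (witnessOracle W) k).answers <+: p) :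
    runs V x ρ (guessOracle p) k = runs V x ρ (witnessOracle W) k := by
  induction k with
  | zero => rfl
  | succ k ih =>
    have ih' := ih ((answers_prefix_succ k).trans h)
    rw [runs_succ, runs_succ, ih']
    rw [runs_succ] at h
    generalize runs V x ρ (witnessOracle W) k = s at h
    obtain ⟨⟨c, a⟩, ⟨_ | b, j⟩⟩ := s
    · rcases hV : V (x, c, a) with b | _ | i
      · simp only [runStep, hV]
      · simp only [runStep, hV]
      · simp only [runStep, hV, witnessOracle, guessOracle] at h ⊢
        have : p[a.length]? = some (W i) := by
          obtain ⟨r, rfl⟩ := h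
          simp [RunState.answers]
        rw [this]
    · rfl

/-- If the guess is an initial part of the true answers, then the guessed run follows the true one
up to the point where the guess is used up, or to the end. -/
theorem exists_runs_guess_eq {W : ℕ → Bool} {p : List Bool} {m : ℕ}
    (hp : p <+: (runs V x ρ (witnessOracle W) m).answers) :
    ∃ k ≤ m, runs V x ρ (guessOracle p) m = runs V x ρ (witnessOracle W) k ∧
      (runs V x ρ (witnessOracle W) k).answers = p := by
  have key : ∀ j ≤ m, (runs V x ρ (witnessOracle W) j).answers <+: p ∨
      ∃ k ≤ j, runs V x ρ (guessOracle p) j = runs V x ρ (witnessOracle W) k ∧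
      (runs V x ρ (witnessOracle W) k).answers = p := by
    intro j hj
    induction j with
    | zero => exact .inl List.nil_prefix
    | succ j ih =>
      by_cases hpre : (runs V x ρ (witnessOracle W) (j + 1)).answers <+: p
      · exact .inl hpre
      right
      have hpre' : p <+: (runs V x ρ (witnessOracle W) (j + 1)).answers :=
        (List.prefix_or_prefix_of_prefix hp (answers_prefix hj)).resolve_right hpre
      have hs : ∃ k ≤ j, runs V x ρ (guessOracle p) j = runs V x ρ (witnessOracle W) k ∧
          (runs V x ρ (witnessOracle W) k).answers = p ∧
          (runs V x ρ (guessOracle p) (j + 1) = runs V x ρ (guessOracle p) j ∨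
            runs V x ρ (guessOracle p) (j + 1) = runs V x ρ (witnessOracle W) (k + 1) ∧
            (runs V x ρ (witnessOracle W) (k + 1)).answers = p) := by
        have aux : ∀ k ≤ j, runs V x ρ (guessOracle p) j = runs V x ρ (witnessOracle W) k →
            (runs V x ρ (witnessOracle W) k).answers = p →
            (runs V x ρ (guessOracle p) (j + 1) = runs V x ρ (guessOracle p) j ∨
            runs V x ρ (guessOracle p) (j + 1) = runs V x ρ (witnessOracle W) (k + 1) ∧
            (runs V x ρ (witnessOracle W) (k + 1)).answers = p) := by
          intro k hk h1 h2
          rw [runs_succ, runs_succ, h1]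
          generalize runs V x ρ (witnessOracle W) k = s at h2
          obtain ⟨⟨c, a⟩, ⟨_ | b, l⟩⟩ := s
          · change a = p at h2
            subst h2
            simp only [runStep]
            rcases V (x, c, a) with b | _ | i
            · exact .inr ⟨rfl, rfl⟩
            · exact .inr ⟨rfl, rfl⟩
            · left; simp [guessOracle]
          · exact .inl rfl
        rcases ih (by omega) with h | ⟨k, hk, h1, h2⟩
        · have h1 := runs_guess_eq h
          have h2 : (runs V x ρ (witnessOracle W) j).answers = p := by
            rcases answers_runStep (V := V) (x := x) (ρ := ρ) (o := witnessOracle W)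
              (runs V x ρ (witnessOracle W) j) with e | ⟨b, e⟩
            · rw [← runs_succ] at e; rw [e] at hpre; exact (hpre h).elim
            · rw [← runs_succ] at e
              rw [e] at hpre hpre'
              rcases List.prefix_concat_iff.1 hpre' with e' | e'
              · exact (hpre (by rw [e'])).elim
              · exact h.eq_of_length_le e'.length_le
          exact ⟨j, le_rfl, h1, h2, aux j le_rfl h1 h2⟩
        · exact ⟨k, hk, h1, h2, aux k hk h1 h2⟩
      obtain ⟨k, hk, h1, h2, h3 | ⟨h3, h4⟩⟩ := hs
      · exact ⟨k, by omega, h3.trans h1, h2⟩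
      · exact ⟨k + 1, by omega, h3, h4⟩
  rcases key m le_rfl with h | h
  · exact ⟨m, le_rfl, runs_guess_eq h, h.eq_of_length_le hp.length_le⟩
  · exact h

/-- The last answer of a true run is the bit of the witness at the position of the last query. -/
theorem getLast_answers (W : ℕ → Bool) (k : ℕ)
    (h : (runs V x ρ (witnessOracle W) k).answers ≠ []) :
    (runs V x ρ (witnessOracle W) k).answers.getLastD false =
      W (runs V x ρ (witnessOracle W) k).last := by
  induction k with
  | zero => exact (h rfl).elim
  | succ k ih =>
    rw [runs_succ] at h ⊢
    generalize runs V x ρ (witnessOracle W) k = s at h ih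
    obtain ⟨⟨c, a⟩, ⟨_ | b, j⟩⟩ := s
    · rcases hV : V (x, c, a) with b | _ | i
      · simp only [runStep, hV] at h ⊢; exact ih h
      · simp only [runStep, hV] at h ⊢; exact ih h
      · simp [runStep, hV, witnessOracle, RunState.answers, RunState.last]
    · exact ih h

/-- If all but the last one of the guessed answers are right and the guess is used up, then the last
query is the one that the true run makes at that point. -/
theorem exists_answers_concat {W : ℕ → Bool} {p : List Bool} {b : Bool} {m : ℕ}
    (hp : p <+: (runs V x ρ (witnessOracle W) m).answers)
    (h : (runs V x ρ (guessOracle (p ++ [b])) m).answers = p ++ [b]) :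
    p ++ [W (runs V x ρ (guessOracle (p ++ [b])) m).last] <+:
      (runs V x ρ (witnessOracle W) m).answers := by
  have key : ∀ j ≤ m, runs V x ρ (guessOracle (p ++ [b])) j = runs V x ρ (witnessOracle W) j ∧
      (runs V x ρ (witnessOracle W) j).answers <+: p ∨
      (runs V x ρ (guessOracle (p ++ [b])) j).answers = p ++ [b] ∧
      p ++ [W (runs V x ρ (guessOracle (p ++ [b])) j).last] <+:
      (runs V x ρ (witnessOracle W) m).answers := by
    intro j hj
    induction j with
    | zero => exact .inl ⟨rfl, List.nil_prefix⟩
    | succ j ih =>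
      rcases ih (by omega) with ⟨h1, h2⟩ | ⟨h1, h2⟩
      · by_cases hpre : (runs V x ρ (witnessOracle W) (j + 1)).answers <+: p
        · exact .inl ⟨runs_guess_eq (hpre.trans (List.prefix_append _ _)), hpre⟩
        · right
          have hpre' : p <+: (runs V x ρ (witnessOracle W) (j + 1)).answers :=
            (List.prefix_or_prefix_of_prefix hp (answers_prefix hj)).resolve_right hpre
          have hm := answers_prefix (V := V) (x := x) (ρ := ρ) (o := witnessOracle W) hj
          rw [runs_succ] at hpre hpre' hm
          rw [runs_succ, h1]
          generalize runs V x ρ (witnessOracle W) j = s at hpre hpre' hm h2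
          obtain ⟨⟨c, a⟩, ⟨_ | b', l⟩⟩ := s
          · rcases hV : V (x, c, a) with b' | _ | i
            · simp only [runStep, hV] at hpre; exact (hpre h2).elim
            · simp only [runStep, hV] at hpre; exact (hpre h2).elim
            · simp only [runStep, hV, witnessOracle, RunState.answers] at hpre hpre' hm h2 ⊢
              have : a = p := by
                rcases List.prefix_concat_iff.1 hpre' with e' | e'
                · exact (hpre (by rw [e'])).elim
                · exact h2.eq_of_length_le e'.length_le
              subst this
              simpa [guessOracle] using hm
          · exact (hpre h2).elim
      · right
        rw [runs_succ]
        generalize runs V x ρ (guessOracle (p ++ [b])) j = s at h1 h2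
        obtain ⟨⟨c, a⟩, ⟨_ | b', l⟩⟩ := s
        · change a = p ++ [b] at h1
          subst h1
          rcases hV : V (x, c, p ++ [b]) with b' | _ | i
          · rw [runStep, hV]; exact ⟨rfl, h2⟩
          · rw [runStep, hV]; exact ⟨rfl, h2⟩
          · have : guessOracle (p ++ [b]) (p ++ [b]).length i = none := by
              simp [guessOracle]
            rw [runStep, hV]
            dsimp only
            rw [this]
            exact ⟨rfl, h2⟩
        · exact ⟨h1, h2⟩
  rcases key m le_rfl with ⟨h1, h2⟩ | ⟨_, h2⟩
  · rw [h1] at h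
    rw [h] at h2
    have := h2.length_le
    simp at this
  · exact h2

/-- As long as there are no answers, the guess does not matter. -/
theorem runs_eq_of_answers_eq_nil {W : ℕ → Bool} {p : List Bool} (hp : p ≠ []) {k : ℕ}
    (h : (runs V x ρ (guessOracle p) k).answers = []) :
    runs V x ρ (witnessOracle W) k = runs V x ρ (guessOracle p) k := by
  induction k with
  | zero => rfl
  | succ k ih =>
    have h' : (runs V x ρ (guessOracle p) k).answers = [] :=
      List.prefix_nil.1 (h ▸ answers_prefix_succ k)
    rw [runs_succ] at h
    rw [runs_succ, runs_succ, ih h']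
    generalize runs V x ρ (guessOracle p) k = s at h h'
    obtain ⟨⟨c, a⟩, ⟨_ | b', l⟩⟩ := s
    · change a = [] at h'
      subst h'
      rcases hV : V (x, c, []) with b' | _ | i
      · simp only [runStep, hV]
      · simp only [runStep, hV]
      · obtain ⟨b, p, rfl⟩ := List.exists_cons_of_ne_nil hp
        simp [runStep, hV, guessOracle, RunState.answers] at h
    · rfl

/-- The runs in the definition of a verifier are iterations of `runStep`. -/
theorem exec_eq_some (w : List Bool) {k : ℕ} {c a : List Bool} (j : ℕ) {r : Bool × ℕ × ℕ}
    (h : exec V x ρ w k c a = some r) :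
    ∃ c' a' j', (runStep V x ρ (witnessOracle (bitsOf w)))^[k] ((c, a), (none, j)) =
      ((c', a'), (some r.1, j')) ∧ c'.length = r.2.1 ∧ a'.length = r.2.2 := by
  induction k generalizing c a j with
  | zero => cases h
  | succ k ih =>
    rw [Function.iterate_succ_apply]
    simp only [exec] at h
    simp only [runStep]
    revert h
    rcases V (x, c, a) with b | _ | i
    · intro h
      cases h
      refine ⟨c, a, j, ?_, rfl, rfl⟩
      exact Function.iterate_fixed rfl k
    · intro h; exact ih _ h
    · intro h; exact ih _ h

/-- The run does not depend on random bits that are not read. -/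
theorem exec_congr {ρ' : ℕ → Bool} (w : List Bool) {k : ℕ} {c a : List Bool} {r : Bool × ℕ × ℕ}
    (h : exec V x ρ w k c a = some r) (hρ : ∀ j < r.2.1, ρ j = ρ' j) :
    exec V x ρ' w k c a = some r ∧ c.length ≤ r.2.1 := by
  induction k generalizing c a with
  | zero => cases h
  | succ k ih =>
    simp only [exec] at h ⊢
    revert h
    rcases V (x, c, a) with b | _ | i
    · rintro ⟨⟩; exact ⟨rfl, le_rfl⟩
    · intro h
      have := ih h
      simp only [List.length_append, List.length_singleton] at this
      rw [← hρ c.length (by omega)]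
      exact ⟨this.1, by omega⟩
    · intro h; exact ih h

end

/-! ### The clauses of a run -/

section
variable {V : Program} {x : List Bool} {ρ : ℕ → Bool}

/-- The answers in a guessed run are taken from the guess. -/
theorem answers_guess_prefix (p : List Bool) (k : ℕ) :
    (runs V x ρ (guessOracle p) k).answers <+: p := by
  induction k with
  | zero => exact List.nil_prefix
  | succ k ih =>
    rw [runs_succ]
    generalize runs V x ρ (guessOracle p) k = s at ih
    obtain ⟨⟨c, a⟩, ⟨_ | b, j⟩⟩ := s
    · rcases hV : V (x, c, a) with b | _ | i
      · simpa only [runStep, hV] using ih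
      · simpa only [runStep, hV] using ih
      · simp only [runStep, hV]
        rcases hb : guessOracle p a.length i with _ | b
        · exact ih
        · obtain ⟨r, rfl⟩ := ih
          rcases r with _ | ⟨b', r⟩
          · simp [guessOracle, RunState.answers] at hb
          · simp only [guessOracle, RunState.answers] at hb
            simp at hb
            subst hb
            exact ⟨r, by simp [RunState.answers]⟩
    · exact ih

/-- The run up to a given time depends on finitely many bits of the witness only. -/
theorem exists_runs_congr (V : Program) (x : List Bool) (ρ : ℕ → Bool) (W : ℕ → Bool) (k : ℕ) :
    ∃ N, ∀ W' : ℕ → Bool, (∀ i < N, W' i = W i) →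
      runs V x ρ (witnessOracle W') k = runs V x ρ (witnessOracle W) k := by
  induction k with
  | zero => exact ⟨0, fun _ _ => rfl⟩
  | succ k ih =>
    obtain ⟨N, hN⟩ := ih
    rcases hs : runs V x ρ (witnessOracle W) k with ⟨⟨c, a⟩, ⟨_ | b, j⟩⟩
    · rcases hV : V (x, c, a) with b | _ | i
      · exact ⟨N, fun W' h => by rw [runs_succ, runs_succ, hN W' h, hs]; simp only [runStep, hV]⟩
      · exact ⟨N, fun W' h => by rw [runs_succ, runs_succ, hN W' h, hs]; simp only [runStep, hV]⟩
      · refine ⟨max N (i + 1), fun W' h => ?_⟩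
        rw [runs_succ, runs_succ, hN W' fun i hi => h i (lt_max_of_lt_left hi), hs]
        simp only [runStep, hV, witnessOracle, h i (lt_max_of_lt_right (Nat.lt_succ_self i))]
    · exact ⟨N, fun W' h => by rw [runs_succ, runs_succ, hN W' h, hs]; rfl⟩

/-- For finitely many strings of random bits, the runs with an infinite witness are runs with a
finite one. -/
theorem exists_finite_witness (V : Program) (x : List Bool) (Rs : List (List Bool)) (W : ℕ → Bool)
    (k : ℕ) : ∃ w : List Bool, ∀ R ∈ Rs, runs V x (bitsOf R) (witnessOracle (bitsOf w)) k =
      runs V x (bitsOf R) (witnessOracle W) k := by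
  have : ∃ N, ∀ W' : ℕ → Bool, (∀ i < N, W' i = W i) → ∀ R ∈ Rs,
      runs V x (bitsOf R) (witnessOracle W') k = runs V x (bitsOf R) (witnessOracle W) k := by
    induction Rs with
    | nil => exact ⟨0, by simp⟩
    | cons R Rs ih =>
      obtain ⟨N, hN⟩ := ih
      obtain ⟨N', hN'⟩ := exists_runs_congr V x (bitsOf R) W k
      refine ⟨max N N', fun W' h => List.forall_mem_cons.2 ⟨?_, ?_⟩⟩
      · exact hN' W' fun i hi => h i (lt_max_of_lt_right hi)
      · exact hN W' fun i hi => h i (lt_max_of_lt_left hi)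
  obtain ⟨N, hN⟩ := this
  refine ⟨(List.range N).map W, hN _ fun i hi => ?_⟩
  simp [bitsOf, List.getD_eq_getElem?_getD, hi]

end

/-- The variable that stands for "with random bits `R`, the answers of the witness begin
with `p`". These variables have even numbers. -/
def prefixVar (R p : List Bool) : ℕ := numOf (false :: (R ++ p))

/-- The variable that stands for the bit of the witness at position `i`. These variables have odd
numbers. -/
def witnessVar (i : ℕ) : ℕ := 2 * i + 1

theorem prefixVar_injective {R R' p p' : List Bool} (hR : R.length = R'.length)
    (h : prefixVar R p = prefixVar R' p') : R = R' ∧ p = p' := by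
  have := numOf_injective h
  simp only [List.cons.injEq, true_and] at this
  exact List.append_inj this hR

theorem prefixVar_mod_two (R p : List Bool) : prefixVar R p % 2 = 0 := by
  simp [prefixVar, numOf]

/-- The clause for the guess `p` of the answers, if the guess is used up by the run that led to the
state `s`: if the answers begin with all but the last bit of `p` and the witness has the last bit of
`p` at the position of the last query, then the answers begin with `p`; if the verifier rejects
without another query, the first two conditions must not both hold. -/
def guessClause (R p : List Bool) (s : RunState) : Clause :=
  (if p.dropLast.isEmpty then [] else [(false, prefixVar R p.dropLast)]) ++
    (!p.getLastD false, witnessVar s.last) ::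
      if s.verdict == some false then [] else [(true, prefixVar R p)]

/-- The clause for random bits `R` and a guess `p` of the answers, which leads to the state `s`. If
the guess is not used up, there is nothing to say, unless the verifier rejects without queries. -/
def stateClause (R p : List Bool) (s : RunState) : Clause :=
  if s.answers.length < p.length then
    if s.answers.isEmpty && s.verdict == some false then [] else [(true, 0), (false, 0)]
  else guessClause R p s

/-- The clause for random bits `R` and a guess `p` of the answers. -/
def clauseOf (V : Program) (x : List Bool) (B : ℕ) (R p : List Bool) : Clause :=
  stateClause R p (runs V x (bitsOf R) (guessOracle p) B)

theorem length_clauseOf_le (V : Program) (x : List Bool) (B : ℕ) (R p : List Bool) :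
    (clauseOf V x B R p).length ≤ 3 := by
  simp only [clauseOf, stateClause, guessClause]
  split_ifs <;> simp

/-- The nonempty bit strings of length at most `q`. -/
def guesses (q : ℕ) : List (List Bool) := (List.range q).flatMap fun j => allStr (j + 1)

theorem mem_guesses {q : ℕ} {p : List Bool} : p ∈ guesses q ↔ p ≠ [] ∧ p.length ≤ q := by
  simp only [guesses, List.mem_flatMap, List.mem_range, mem_allStr]
  constructor
  · rintro ⟨j, hj, h⟩
    exact ⟨by rintro rfl; simp at h, by omega⟩
  · rintro ⟨h, h'⟩
    have := List.length_pos_iff.2 h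
    exact ⟨p.length - 1, by omega, by omega⟩

theorem length_guesses_add_two (q : ℕ) : (guesses q).length + 2 = 2 * 2 ^ q := by
  induction q with
  | zero => rfl
  | succ q ih =>
    rw [guesses] at ih
    rw [guesses, List.range_succ, List.flatMap_append, List.length_append, List.flatMap_singleton,
      length_allStr]
    rw [pow_succ]; omega

theorem length_guesses_le {q : ℕ} (hq : 1 ≤ q) : (guesses q).length ≤ q * 2 ^ q := by
  have h := length_guesses_add_two q
  rcases hq.eq_or_lt with rfl | hq
  · simp at h ⊢; omega
  · have : 2 * 2 ^ q ≤ q * 2 ^ q := Nat.mul_le_mul_right _ hq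
    omega

theorem guesses_pos {q : ℕ} (hq : 1 ≤ q) : 1 ≤ (guesses q).length :=
  List.length_pos_of_mem (mem_guesses.2 ⟨List.cons_ne_nil false [], by simpa⟩)

section
variable {V : Program} {x : List Bool} {B : ℕ}

/-- The assignment that belongs to a witness: the witness variables are given their values, and a
prefix variable is true if it should be. -/
noncomputable def intended (V : Program) (x : List Bool) (B m : ℕ) (W : ℕ → Bool) (n : ℕ) : Bool :=
  open Classical in
  if n % 2 = 1 then W (n / 2)
  else decide (∃ R p, R.length = m ∧ n = prefixVar R p ∧
    p <+: (runs V x (bitsOf R) (witnessOracle W) B).answers)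

theorem intended_witnessVar (V : Program) (x : List Bool) (B m : ℕ) (W : ℕ → Bool) (i : ℕ) :
    intended V x B m W (witnessVar i) = W i := by
  have h1 : (2 * i + 1) % 2 = 1 := by omega
  have h2 : (2 * i + 1) / 2 = i := by omega
  simp [intended, witnessVar, h1, h2]

theorem intended_prefixVar {m : ℕ} {W : ℕ → Bool} {R : List Bool} (hR : R.length = m)
    (p : List Bool) : intended V x B m W (prefixVar R p) = true ↔
      p <+: (runs V x (bitsOf R) (witnessOracle W) B).answers := by
  have h1 : ¬ prefixVar R p % 2 = 1 := by rw [prefixVar_mod_two]; simp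
  simp only [intended, h1, if_false, decide_eq_true_eq]
  constructor
  · rintro ⟨R', p', h, h', hp⟩
    obtain ⟨rfl, rfl⟩ := prefixVar_injective (hR.trans h.symm) h'
    exact hp
  · exact fun h => ⟨R, p, hR, rfl, h⟩

/-- If the verifier accepts, the intended assignment satisfies the clauses. -/
theorem sat_intended {m : ℕ} {W : ℕ → Bool} {R p : List Bool} (hR : R.length = m) (hp : p ≠ [])
    (h : (runs V x (bitsOf R) (witnessOracle W) B).verdict = some true) :
    (clauseOf V x B R p).sat (intended V x B m W) = true := by
  have hpre := answers_guess_prefix (V := V) (x := x) (ρ := bitsOf R) p B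
  rw [clauseOf, stateClause]
  split_ifs with h1 h2
  · exfalso
    simp only [Bool.and_eq_true, List.isEmpty_iff, beq_iff_eq] at h2
    rw [runs_eq_of_answers_eq_nil hp h2.1, h2.2] at h
    cases h
  · simp only [Clause.sat, List.any_cons, List.any_nil]
    cases intended V x B m W 0 <;> rfl
  · have h2 : (runs V x (bitsOf R) (guessOracle p) B).answers = p :=
      hpre.eq_of_length_le (not_lt.1 h1)
    obtain ⟨p', b, rfl⟩ : ∃ p' b, p = p' ++ [b] :=
      ⟨p.dropLast, p.getLast hp, (List.dropLast_append_getLast hp).symm⟩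
    rw [Clause.sat, List.any_eq_true]
    simp only [guessClause, List.dropLast_concat, List.mem_append, List.mem_cons, beq_iff_eq]
    by_cases h3 : p' <+: (runs V x (bitsOf R) (witnessOracle W) B).answers
    · by_cases h4 : W (runs V x (bitsOf R) (guessOracle (p' ++ [b])) B).last = b
      · have h5 := exists_answers_concat h3 h2
        rw [h4] at h5
        refine ⟨(true, prefixVar R (p' ++ [b])), .inr (.inr ?_), (intended_prefixVar hR _).2 h5⟩
        obtain ⟨k, hk, h6, -⟩ := exists_runs_guess_eq h5
        rw [if_neg]
        · simp
        · intro h7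
          rw [h6] at h7
          rw [runs_eq_of_isSome (by rw [h7]; rfl) hk, h7] at h
          cases h
      · refine ⟨_, .inr (.inl rfl), ?_⟩
        simp only [intended_witnessVar]
        simp only [List.getLastD_concat]
        cases b <;> simpa using h4
    · refine ⟨(false, prefixVar R p'), .inl ?_, ?_⟩
      · rw [if_neg]
        · simp
        · intro h4
          rw [List.isEmpty_iff.1 h4] at h3
          exact h3 List.nil_prefix
      · simpa using (intended_prefixVar (V := V) (x := x) (B := B) (W := W) hR p').not.2 h3

/-- If the verifier rejects, any assignment whose witness variables describe the witness leaves a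
clause unsatisfied. -/
theorem exists_not_sat {q : ℕ} (hq : 1 ≤ q) (τ : ℕ → Bool) (R : List Bool)
    (h : (runs V x (bitsOf R) (witnessOracle fun i => τ (witnessVar i)) B).verdict = some false)
    (hl : (runs V x (bitsOf R) (witnessOracle fun i => τ (witnessVar i)) B).answers.length ≤ q) :
    ∃ p ∈ guesses q, (clauseOf V x B R p).sat τ = false := by
  by_contra! hsat
  simp only [ne_eq, Bool.not_eq_false] at hsat
  set W : ℕ → Bool := fun i => τ (witnessVar i) with hW
  by_cases hA : (runs V x (bitsOf R) (witnessOracle W) B).answers = []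
  · have := hsat [false] (mem_guesses.2 ⟨by simp, by simpa⟩)
    rw [clauseOf, runs_guess_eq (hA ▸ List.nil_prefix), stateClause, if_pos, if_pos] at this
    · cases this
    · simp [hA, h]
    · simp [hA]
  -- Otherwise the satisfied clauses force the prefix variables along the true answers to be true,
  -- one after the other, until the clause of the full list of answers is violated.
  · have key : ∀ p, p <+: (runs V x (bitsOf R) (witnessOracle W) B).answers → p ≠ [] →
        τ (prefixVar R p) = true ∧
          (runs V x (bitsOf R) (guessOracle p) B).verdict ≠ some false := by
      intro p
      induction p using List.reverseRecOn with
      | nil => exact fun _ h => (h rfl).elim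
      | append_singleton p b ih =>
        intro hp _
        obtain ⟨k, hk, h1, h2⟩ := exists_runs_guess_eq hp
        have h3 := getLast_answers W k (by rw [h2]; simp)
        rw [h2, List.getLastD_concat] at h3
        have h4 := hsat (p ++ [b]) (mem_guesses.2 ⟨by simp, hp.length_le.trans hl⟩)
        rw [clauseOf, stateClause, h1, if_neg (by rw [h2]; simp), Clause.sat,
          List.any_eq_true] at h4
        obtain ⟨⟨s, v⟩, hmem, hv⟩ := h4
        simp only [guessClause, List.dropLast_concat, List.mem_append, List.mem_cons,
          List.getLastD_concat, beq_iff_eq] at hmem hv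
        rcases hmem with hmem | hmem | hmem
        · exfalso
          split_ifs at hmem with h5
          · simp at hmem
          · simp only [List.mem_singleton, Prod.mk.injEq] at hmem
            obtain ⟨rfl, rfl⟩ := hmem
            rw [(ih ((List.prefix_append _ _).trans hp) (by simpa using h5)).1] at hv
            cases hv
        · exfalso
          simp only [Prod.mk.injEq] at hmem
          obtain ⟨rfl, rfl⟩ := hmem
          have : b = τ (witnessVar (runs V x (bitsOf R) (witnessOracle W) k).last) := h3
          rw [hv] at this
          cases b <;> cases this
        · split_ifs at hmem with h5
          · simp at hmem
          · simp only [List.mem_singleton, Prod.mk.injEq] at hmem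
            obtain ⟨rfl, rfl⟩ := hmem
            exact ⟨hv, by rw [h1]; exact h5⟩
    have := (key _ List.prefix_rfl hA).2
    rw [runs_guess_eq List.prefix_rfl] at this
    exact this h

end

/-! ### The formula -/

/-- The formula for an input `x`: all clauses for random strings from the list `Rs` and nonempty
guesses of at most `q` answers. -/
def formulaOf (V : Program) (x : List Bool) (B q : ℕ) (Rs : List (List Bool)) : CNF3 :=
  ⟨Rs.flatMap fun R => (guesses q).map fun p => clauseOf V x B R p, by
    intro C hC
    simp only [List.mem_flatMap, List.mem_map] at hC
    obtain ⟨R, -, p, -, rfl⟩ := hC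
    exact length_clauseOf_le V x B R p⟩

theorem size_formulaOf (V : Program) (x : List Bool) (B q : ℕ) (Rs : List (List Bool)) :
    (formulaOf V x B q Rs).size = Rs.length * (guesses q).length := by
  simp [CNF3.size, formulaOf, List.length_flatMap]

/-- Each string of random bits with which the verifier rejects costs at least one clause. -/
theorem numSat_formulaOf_add_le {V : Program} {x : List Bool} {B q : ℕ} (hq : 1 ≤ q) (τ : ℕ → Bool)
    (Rs : List (List Bool)) (P : List Bool → Bool)
    (h : ∀ R ∈ Rs, P R = false →
      (runs V x (bitsOf R) (witnessOracle fun i => τ (witnessVar i)) B).verdict = some false)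
    (hl : ∀ R ∈ Rs,
      (runs V x (bitsOf R) (witnessOracle fun i => τ (witnessVar i)) B).answers.length ≤ q) :
    (formulaOf V x B q Rs).numSat τ + Rs.countP (fun R => !P R) ≤
      (formulaOf V x B q Rs).size := by
  rw [size_formulaOf]
  simp only [CNF3.numSat, formulaOf]
  induction Rs with
  | nil => simp
  | cons R Rs ih =>
    have ih := ih (fun R hR => h R (by simp [hR])) fun R hR => hl R (by simp [hR])
    rw [List.flatMap_cons, List.countP_append, List.countP_cons, List.length_cons, add_mul, one_mul]
    suffices ((guesses q).map fun p => clauseOf V x B R p).countP (Clause.sat τ) +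
        (if (!P R) = true then 1 else 0) ≤ (guesses q).length by omega
    split_ifs with hP
    · obtain ⟨p, hp, hsat⟩ := exists_not_sat hq τ R (h R (by simp) (by simpa using hP))
        (hl R (by simp))
      rw [Nat.succ_le_iff]
      refine lt_of_le_of_ne (List.countP_le_length.trans (by simp)) fun heq => ?_
      have := List.countP_eq_length.1 (heq.trans (by simp)) _ (List.mem_map_of_mem hp)
      rw [hsat] at this
      cases this
    · exact List.countP_le_length.trans (by simp)

namespace Verifier

/-- The result of a verifier can be read off the final state. -/
theorem runs_result (V : Verifier) (x : List Bool) (ρ : ℕ → Bool) (w : List Bool) :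
    (runs V.prog x ρ (witnessOracle (bitsOf w)) (V.bound.eval x.length)).verdict =
      some (V.result x ρ w).1 ∧
    (runs V.prog x ρ (witnessOracle (bitsOf w)) (V.bound.eval x.length)).answers.length =
      (V.result x ρ w).2.2 := by
  obtain ⟨c, a, j, h, -, h'⟩ := exec_eq_some w 0 (Option.some_get (V.halts x ρ w)).symm
  rw [runs, RunState.init, h]
  exact ⟨rfl, h'⟩

theorem result_congr (V : Verifier) {x : List Bool} {ρ ρ' : ℕ → Bool} (w : List Bool)
    (h : ∀ j < (V.result x ρ w).2.1, ρ j = ρ' j) : V.result x ρ' w = V.result x ρ w := by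
  have := (exec_congr w (Option.some_get (V.halts x ρ w)).symm h).1
  exact Option.get_of_eq_some _ this

/-- The acceptance probability may be computed with more random bits than necessary. -/
theorem countP_accept (V : Verifier) {r q : ℕ → ℕ} (hV : V.Restricted r q) (x w : List Bool) {m : ℕ}
    (hm : r x.length ≤ m) :
    ((allStr m).countP fun s => (V.result x (bitsOf s) w).1 : ℝ) =
      V.acceptProb (r x.length) x w * 2 ^ m := by
  induction m, hm using Nat.le_induction with
  | base =>
    rw [acceptProb, card_filter_padBits (r x.length) fun ρ => (V.result x ρ w).1]
    field_simp
  | succ m hm ih =>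
    rw [countP_allStr_succ]
    · push_cast
      rw [ih, pow_succ]; ring
    · intro s b hs
      rw [V.result_congr (ρ := bitsOf s) (ρ' := bitsOf (s ++ [b])) w]
      intro j hj
      have := (hV x (bitsOf s) w).1
      have hj' : j < s.length := by omega
      simp [bitsOf, List.getD_eq_getElem?_getD, List.getElem?_append_left hj']

/-- If the verifier accepts with certainty, the formula is satisfiable. -/
theorem exists_numSat_eq_size (V : Verifier) {r q : ℕ → ℕ} (hV : V.Restricted r q) {x w : List Bool}
    (h : V.acceptProb (r x.length) x w = 1) {m : ℕ} (hm : r x.length ≤ m) (q' : ℕ) :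
    ∃ τ, (formulaOf V.prog x (V.bound.eval x.length) q' (allStr m)).numSat τ =
      (formulaOf V.prog x (V.bound.eval x.length) q' (allStr m)).size := by
  have h1 := V.countP_accept hV x w hm
  rw [h, one_mul] at h1
  have h2 : (allStr m).countP (fun s => (V.result x (bitsOf s) w).1) = (allStr m).length := by
    rw [length_allStr]; exact_mod_cast h1
  refine ⟨intended V.prog x (V.bound.eval x.length) m (bitsOf w), ?_⟩
  rw [CNF3.numSat, CNF3.size, List.countP_eq_length]
  intro C hC
  simp only [formulaOf, List.mem_flatMap, List.mem_map] at hC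
  obtain ⟨R, hR, p, hp, rfl⟩ := hC
  refine sat_intended (mem_allStr.1 hR) (mem_guesses.1 hp).1 ?_
  rw [(V.runs_result x _ w).1, List.countP_eq_length.1 h2 R hR]

/-- If the verifier rejects with probability `1 / 2` at least, no assignment satisfies more than the
stated number of clauses: at least half of the random strings cost a clause, and each of them
contributes at most `q * 2 ^ q` clauses. -/
theorem numSat_le (V : Verifier) {r : ℕ → ℕ} {q : ℕ} (hq : 1 ≤ q) (hV : V.Restricted r fun _ => q)
    {x : List Bool} (h : ∀ w, V.acceptProb (r x.length) x w ≤ 1 / 2) {m : ℕ} (hm : r x.length ≤ m)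
    (τ : ℕ → Bool) :
    ((formulaOf V.prog x (V.bound.eval x.length) q (allStr m)).numSat τ : ℝ) ≤
      (1 - 1 / (2 * (q : ℝ) * 2 ^ q)) *
        (formulaOf V.prog x (V.bound.eval x.length) q (allStr m)).size := by
  -- An assignment describes an infinite witness, of which only finitely many bits are read.
  obtain ⟨w, hw⟩ := exists_finite_witness V.prog x (allStr m) (fun i => τ (witnessVar i))
    (V.bound.eval x.length)
  have h1 := numSat_formulaOf_add_le (V := V.prog) (x := x) (B := V.bound.eval x.length) hq τ
    (allStr m) (fun s => (V.result x (bitsOf s) w).1)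
    (fun R hR hP => by
      rw [← hw R hR, (V.runs_result x _ w).1, hP])
    (fun R hR => by rw [← hw R hR, (V.runs_result x _ w).2]; exact (hV x _ w).2)
  have h2 := V.countP_accept hV x w hm
  have h3 := List.length_eq_countP_add_countP (l := allStr m)
    (fun s => (V.result x (bitsOf s) w).1)
  have h4 : (allStr m).countP (fun s => !(V.result x (bitsOf s) w).1) =
      (allStr m).countP (fun s => decide ¬(V.result x (bitsOf s) w).1 = true) := by
    congr 1; funext s; cases (V.result x (bitsOf s) w).1 <;> rfl
  rw [← h4, length_allStr] at h3
  have h5 : ((2 : ℝ) ^ m) = (allStr m).countP (fun s => (V.result x (bitsOf s) w).1) +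
      (allStr m).countP (fun s => !(V.result x (bitsOf s) w).1) := by exact_mod_cast h3
  have h6 : ((formulaOf V.prog x (V.bound.eval x.length) q (allStr m)).numSat τ : ℝ) +
      (allStr m).countP (fun s => !(V.result x (bitsOf s) w).1) ≤
      (formulaOf V.prog x (V.bound.eval x.length) q (allStr m)).size := by exact_mod_cast h1
  have h7 : ((formulaOf V.prog x (V.bound.eval x.length) q (allStr m)).size : ℝ) ≤
      2 ^ m * (q * 2 ^ q) := by
    rw [size_formulaOf, length_allStr]
    exact_mod_cast Nat.mul_le_mul_left _ (length_guesses_le hq)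
  have h8 : (0 : ℝ) < q * 2 ^ q := by
    have : (0 : ℝ) < q := by exact_mod_cast hq
    positivity
  have h9 : V.acceptProb (r x.length) x w * 2 ^ m ≤ 1 / 2 * 2 ^ m :=
    mul_le_mul_of_nonneg_right (h w) (by positivity)
  have h10 : 1 / (2 * (q : ℝ) * 2 ^ q) *
      (formulaOf V.prog x (V.bound.eval x.length) q (allStr m)).size ≤ 1 / 2 * 2 ^ m := by
    rw [div_mul_eq_mul_div, div_le_iff₀ (by nlinarith)]
    nlinarith
  linarith

end Verifier

/-! ### Computing the formula in polynomial time -/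

/-- Numbers are represented by their binary digits. -/
instance : Coded ℕ := ⟨fun n => Coded.code (encodeNat n)⟩

theorem size_str_le (l : List Bool) : size l ≤ 4 * l.length + 1 := by
  have := size_list_le (l := l) (B := 3) fun b _ => size_bool_le b
  omega

theorem encodePair_eq (p : List Bool × List Bool) :
    encodePair p = p.1.map Sum.inl ++ p.2.map Sum.inr := by
  simp [encodePair, encodingProd, encodingList]

theorem encodeTriple_eq (p : List Bool × List Bool × List Bool) :
    encodeTriple p = p.1.map Sum.inl ++
      (p.2.1.map fun b => Sum.inr (Sum.inl b)) ++ p.2.2.map fun b => Sum.inr (Sum.inr b) := by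
  simp [encodeTriple, encodingProd, encodingList, Function.comp_def]

namespace PT
variable {X α Γ : Type} [Coded X] [Coded α] [Coded Γ]

theorem encodeSeq {e : α → List Γ} {l : X → List α} (he : PT e) (hl : PT l) :
    PT fun x => Inapprox.encodeSeq e (l x) :=
  hl.flatMap (f := fun _ a => (e a).map some ++ [none])
    (((he.comp snd).map (snd.optionSome)).append (const [none]))

theorem eqSome {o : X → Option Bool} (ho : PT o) (b : Bool) : PT fun x => o x == some b :=
  ((isSome.comp ho).and (((getD false).comp ho).beq (const b))).congr fun x => congrArg enc <| by
    rcases o x with _ | b' <;> simp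

theorem encodeNat {n : X → ℕ} (hn : PT n) : PT fun x => Computability.encodeNat (n x) :=
  hn.congr fun _ => rfl

theorem prefixVar {R p : X → List Bool} (hR : PT R) (hp : PT p) :
    PT fun x => prefixVar (R x) (p x) :=
  (((const false).cons (hR.append hp)).append (const [true])).congr fun x => by
    rw [Inapprox.prefixVar, ← encodeNat_numOf]; rfl

theorem witnessVar {i : X → ℕ} (hi : PT i) : PT fun x => witnessVar (i x) :=
  ((const true).cons hi.encodeNat).congr fun x => by
    rw [← encodeNat_two_mul_add_one]; rfl

theorem encodeCNF3 {φ : X → CNF3} (h : PT fun x => (φ x).1) : PT fun x => encodeCNF3 (φ x) :=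
  (encodeSeq (encodeSeq (e := encodeLiteral) (fst.cons (encodeNat snd)) PT.id) h).congr
    fun _ => rfl

end PT

/-- The position of the query, if the move is a query. -/
def Move.queryPos : Move → ℕ
  | .query i => i
  | _ => 0

theorem Move.encodeNat_queryPos (m : Move) : encodeNat m.queryPos = (encodeMove m).tail.tail := by
  cases m <;> rfl

/-- A move with guessed answers, in terms of the bits of the encoded move. -/
theorem runStep_eq (V : Program) (x R p : List Bool) (s : RunState) :
    runStep V x (bitsOf R) (guessOracle p) s =
      if s.verdict.isSome then s
      else if (encodeMove (V (x, s.1))).headD false then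
        if (encodeMove (V (x, s.1))).tail.headD false then
          if (p.drop s.answers.length).isEmpty then s
          else ((s.1.1, s.answers ++ [(p.drop s.answers.length).headD false]),
            (none, (V (x, s.1)).queryPos))
        else ((s.1.1 ++ [(R.drop s.1.1.length).headD false], s.answers), (none, s.last))
      else (s.1, (some ((encodeMove (V (x, s.1))).tail.headD false), s.last)) := by
  obtain ⟨⟨c, a⟩, ⟨_ | b, j⟩⟩ := s
  · rcases hV : V (x, c, a) with b | _ | i
    · simp [runStep, hV, encodeMove, RunState.verdict, RunState.last]
    · simp [runStep, hV, encodeMove, RunState.verdict, RunState.last, RunState.answers, bitsOf,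
        List.headD_eq_head?_getD, List.getD_eq_getElem?_getD]
    · by_cases h : a.length < p.length
      · simp [runStep, hV, encodeMove, RunState.verdict, RunState.answers, guessOracle,
          List.headD_eq_head?_getD, h, Move.queryPos]
      · simp [runStep, hV, encodeMove, RunState.verdict, RunState.answers, guessOracle, h,
          not_lt.1 h]
  · rfl

theorem runs_eq_foldl (V : Program) (x : List Bool) (ρ : ℕ → Bool) (o : ℕ → ℕ → Option Bool)
    (k : ℕ) : runs V x ρ o k =
      (List.replicate k ()).foldl (fun s _ => runStep V x ρ o s) RunState.init := by
  induction k with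
  | zero => rfl
  | succ k ih => rw [runs_succ, ih, List.replicate_succ', List.foldl_append]; rfl

/-- The size of the state of a run is bounded. The position of the last query has been computed
from the input and two lists of at most `k` bits. -/
theorem runs_invariant {V : Program} {x : List Bool} {ρ : ℕ → Bool} {o : ℕ → ℕ → Option Bool}
    {p : Polynomial ℕ} (hp : ∀ t, size (V t).queryPos ≤ p.eval (size t)) (k : ℕ) :
    (runs V x ρ o k).1.1.length ≤ k ∧ (runs V x ρ o k).1.2.length ≤ k ∧
      size (runs V x ρ o k).last ≤ 1 + p.eval (size x + 8 * k + 4) := by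
  induction k with
  | zero => exact ⟨le_rfl, le_rfl, Nat.le_add_right 1 _⟩
  | succ k ih =>
    rw [runs_succ]
    generalize runs V x ρ o k = s at ih
    have hk : p.eval (size x + 8 * k + 4) ≤ p.eval (size x + 8 * (k + 1) + 4) :=
      eval_mono p (by omega)
    obtain ⟨⟨c, a⟩, ⟨_ | b, j⟩⟩ := s
    · obtain ⟨h1, h2, h3⟩ := ih
      simp only [RunState.last] at h1 h2 h3 ⊢
      rcases hV : V (x, c, a) with b | _ | i
      · simp only [runStep, hV]; omega
      · simp only [runStep, hV, List.length_append, List.length_singleton]; omega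
      · have h4 := hp (x, c, a)
        have h5 : p.eval (size (x, c, a)) ≤ p.eval (size x + 8 * k + 4) := by
          refine eval_mono p ?_
          have := size_str_le c
          have := size_str_le a
          simp only [size_pair]; omega
        rw [hV] at h4
        simp only [Move.queryPos] at h4
        simp only [runStep, hV]
        rcases o a.length i with _ | b
        · dsimp only; omega
        · simp only [List.length_append, List.length_singleton]; omega
    · obtain ⟨h1, h2, h3⟩ := ih
      simp only [RunState.last] at h1 h2 h3 ⊢
      simp only [runStep]; omega

section
variable {X : Type} [Coded X]

theorem Verifier.pt_move (V : Verifier) {t : X → List Bool × List Bool × List Bool} (ht : PT t) :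
    PT fun y => encodeMove (V.prog (t y)) := by
  refine V.polyTime.toPT (injective_code_sum injective_code_bool
    (injective_code_sum injective_code_bool injective_code_bool)) (g := t) ?_
  refine PolyTime.congr (f := fun y => (t y).1.map Sum.inl ++
      ((t y).2.1.map fun b => Sum.inr (Sum.inl b)) ++ (t y).2.2.map fun b => Sum.inr (Sum.inr b))
    ?_ fun y => congrArg enc (encodeTriple_eq (t y)).symm
  exact (((PT.fst.comp ht).map PT.snd.inl).append
    ((PT.fst.comp (PT.snd.comp ht)).map PT.snd.inl.inr)).append
    ((PT.snd.comp (PT.snd.comp ht)).map PT.snd.inr.inr)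

theorem Verifier.pt_queryPos (V : Verifier) {t : X → List Bool × List Bool × List Bool}
    (ht : PT t) : PT fun y => (V.prog (t y)).queryPos :=
  (PT.tail.comp (PT.tail.comp (V.pt_move ht))).congr fun y => by
    rw [← Move.encodeNat_queryPos]; rfl

theorem Verifier.pt_runStep (V : Verifier) {x R p : X → List Bool} {s : X → RunState} (hx : PT x)
    (hR : PT R) (hp : PT p) (hs : PT s) :
    PT fun y => runStep V.prog (x y) (bitsOf (R y)) (guessOracle (p y)) (s y) := by
  simp only [runStep_eq]
  have hs1 : PT fun y => (s y).1 := PT.fst.comp hs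
  have hm : PT fun y => encodeMove (V.prog (x y, (s y).1)) := V.pt_move (hx.pair hs1)
  have ha : PT fun y => (s y).answers := PT.snd.comp hs1
  have hc : PT fun y => (s y).1.1 := PT.fst.comp hs1
  have hl : PT fun y => (s y).last := PT.snd.comp (PT.snd.comp hs)
  have hb : PT fun y => (encodeMove (V.prog (x y, (s y).1))).tail.headD false :=
    (PT.headD false).comp (PT.tail.comp hm)
  refine PT.ite (PT.isSome.comp (PT.fst.comp (PT.snd.comp hs))) hs
    (PT.ite ((PT.headD false).comp hm) (PT.ite hb (PT.ite (PT.isEmpty.comp (hp.drop ha)) hs ?_) ?_)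
      (hs1.pair (hb.optionSome.pair hl)))
  · exact (hc.pair (ha.append (((PT.headD false).comp (hp.drop ha)).cons (PT.const [])))).pair
      ((PT.const none).pair (V.pt_queryPos (hx.pair hs1)))
  · exact ((hc.append (((PT.headD false).comp (hR.drop hc)).cons (PT.const []))).pair ha).pair
      ((PT.const none).pair hl)

theorem Verifier.pt_runs (V : Verifier) {x R p : X → List Bool} (hx : PT x) (hR : PT R)
    (hp : PT p) : PT fun y => runs V.prog (x y) (bitsOf (R y)) (guessOracle (p y))
      (V.bound.eval (x y).length) := by
  simp only [runs_eq_foldl]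
  obtain ⟨P, hP⟩ := Bdd.size (V.pt_queryPos (X := List Bool × List Bool × List Bool) PT.id)
  have hk : Bdd fun y => V.bound.eval (x y).length :=
    Bdd.eval ((Bdd.size hx).mono fun y => length_le_size _) _
  refine PT.foldl (f := fun y s _ => runStep V.prog (x y) (bitsOf (R y)) (guessOracle (p y)) s)
    (B := fun y => 8 * V.bound.eval (x y).length + 10 +
      (1 + P.eval (size (x y) + 8 * V.bound.eval (x y).length + 4)))
    (hx.unary V.bound) (PT.const _) ?_ ?_ ?_
  · exact V.pt_runStep (hx.comp (PT.fst.comp PT.fst)) (hR.comp (PT.fst.comp PT.fst))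
      (hp.comp (PT.fst.comp PT.fst)) (PT.snd.comp PT.fst)
  · exact (((Bdd.const 8).mul hk).add (Bdd.const 10)).add ((Bdd.const 1).add
      (Bdd.eval (((Bdd.size hx).add ((Bdd.const 8).mul hk)).add (Bdd.const 4)) P))
  · intro y l hl
    obtain ⟨k, hk, rfl⟩ : ∃ k ≤ V.bound.eval (x y).length, l = List.replicate k () :=
      ⟨l.length, by simpa using hl.length_le, List.eq_replicate_iff.2 ⟨rfl, fun _ _ => rfl⟩⟩
    rw [← runs_eq_foldl]
    obtain ⟨h1, h2, h3⟩ := runs_invariant (V := V.prog) (x := x y) (ρ := bitsOf (R y))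
      (o := guessOracle (p y)) hP k
    have h4 : P.eval (size (x y) + 8 * k + 4) ≤
        P.eval (size (x y) + 8 * V.bound.eval (x y).length + 4) := eval_mono P (by omega)
    generalize runs V.prog (x y) (bitsOf (R y)) (guessOracle (p y)) k = s at h1 h2 h3
    obtain ⟨⟨c, a⟩, ⟨v, j⟩⟩ := s
    have h5 := size_str_le c
    have h6 := size_str_le a
    have h7 : size v ≤ 5 := by
      rcases v with _ | b
      · simp
      · have := size_bool_le b; simp; omega
    simp only [RunState.last] at h1 h2 h3
    simp only [size_pair]
    omega

theorem PT.guessClause {R p : X → List Bool} {s : X → RunState} (hR : PT R) (hp : PT p)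
    (hs : PT s) : PT fun y => guessClause (R y) (p y) (s y) := by
  have hv : PT fun y => (s y).verdict := PT.fst.comp (PT.snd.comp hs)
  have hl : PT fun y => (s y).last := PT.snd.comp (PT.snd.comp hs)
  refine PT.append (PT.ite (PT.isEmpty.comp hp.dropLast) (PT.const []) ?_)
    (PT.cons ((hp.getLastD false).not.pair hl.witnessVar)
      (PT.ite (hv.eqSome false) (PT.const []) ?_))
  · exact ((PT.const false).pair (hR.prefixVar hp.dropLast)).cons (PT.const [])
  · exact ((PT.const true).pair (hR.prefixVar hp)).cons (PT.const [])

theorem Verifier.pt_clauseOf (V : Verifier) {x R p : X → List Bool} (hx : PT x) (hR : PT R)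
    (hp : PT p) : PT fun y => clauseOf V.prog (x y) (V.bound.eval (x y).length) (R y) (p y) := by
  have hs := V.pt_runs hx hR hp
  have ha : PT fun y => (runs V.prog (x y) (bitsOf (R y)) (guessOracle (p y))
    (V.bound.eval (x y).length)).answers := PT.snd.comp (PT.fst.comp hs)
  have hv : PT fun y => (runs V.prog (x y) (bitsOf (R y)) (guessOracle (p y))
    (V.bound.eval (x y).length)).verdict := PT.fst.comp (PT.snd.comp hs)
  exact (PT.ite (ha.length_lt hp) (PT.ite ((PT.isEmpty.comp ha).and (hv.eqSome false))
    (PT.const []) (PT.const [(true, 0), (false, 0)])) (hR.guessClause hp hs)).congr fun y => by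
      simp only [clauseOf, stateClause, decide_eq_true_eq]

end

/-- All strings of random bits of some length whose number is greater than `n`. The length is found
by extending the strings as long as there are at most `n` of them, so that the logarithm of `n` need
not be computed. -/
def stringsAbove (n : ℕ) : List (List Bool) :=
  (List.replicate n ()).foldl (fun L _ => if L.length ≤ n then extend L else L) [[]]

/-- The invariant of the loop in `stringsAbove`. -/
theorem foldl_extend (n k : ℕ) : ∃ m ≤ k, (List.replicate k ()).foldl
    (fun L _ => if L.length ≤ n then extend L else L) [[]] = allStr m ∧
      2 ^ m ≤ 2 * n + 1 ∧ (n < 2 ^ m ∨ m = k) := by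
  induction k with
  | zero => exact ⟨0, le_rfl, rfl, by simp, .inr rfl⟩
  | succ k ih =>
    obtain ⟨m, hm, h1, h2, h3⟩ := ih
    rw [List.replicate_succ', List.foldl_append, h1, List.foldl_cons, List.foldl_nil, length_allStr]
    split_ifs with h
    · refine ⟨m + 1, by omega, rfl, by rw [pow_succ]; omega, .inr ?_⟩
      rw [h3.resolve_left (not_lt.2 h)]
    · exact ⟨m, by omega, rfl, h2, .inl (not_le.1 h)⟩

theorem exists_stringsAbove_eq (n : ℕ) : ∃ m, stringsAbove n = allStr m ∧ n < 2 ^ m := by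
  obtain ⟨m, -, h1, -, h2 | rfl⟩ := foldl_extend n n
  · exact ⟨m, h1, h2⟩
  · exact ⟨m, h1, Nat.lt_two_pow_self⟩

theorem PT.stringsAbove {X : Type} [Coded X] {x : X → List Bool} (hx : PT x) (p : Polynomial ℕ) :
    PT fun y => stringsAbove (p.eval (x y).length) := by
  have hp : Bdd fun y => p.eval (x y).length :=
    Bdd.eval ((Bdd.size hx).mono fun y => length_le_size _) _
  have h : PT fun z : (X × List (List Bool)) × Unit =>
      if decide (z.1.2.length ≤ (List.replicate (p.eval (x z.1.1).length) ()).length) then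
        extend z.1.2 else z.1.2 := by
    refine PT.ite ((PT.snd.comp PT.fst).length_le ((hx.unary p).comp (PT.fst.comp PT.fst)))
      ((PT.snd.comp PT.fst).flatMap ?_) (PT.snd.comp PT.fst)
    exact (PT.snd.append (PT.const [false])).cons
      ((PT.snd.append (PT.const [true])).cons (PT.const []))
  refine PT.foldl
    (f := fun y L _ => if L.length ≤ p.eval (x y).length then extend L else L)
    (B := fun y => (2 * p.eval (x y).length + 1) * (4 * p.eval (x y).length + 2) + 1)
    (hx.unary p) (PT.const [[]]) ?_ ?_ ?_
  · exact h.congr fun z => by simp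
  · exact ((((Bdd.const 2).mul hp).add (Bdd.const 1)).mul
      (((Bdd.const 4).mul hp).add (Bdd.const 2))).add (Bdd.const 1)
  · intro y l hl
    obtain ⟨k, hk, rfl⟩ : ∃ k ≤ p.eval (x y).length, l = List.replicate k () :=
      ⟨l.length, by simpa using hl.length_le, List.eq_replicate_iff.2 ⟨rfl, fun _ _ => rfl⟩⟩
    obtain ⟨m, hm, h1, h2, -⟩ := foldl_extend (p.eval (x y).length) k
    rw [h1]
    refine (size_list_le (B := 4 * m + 1) fun s hs => ?_).trans ?_
    · rw [← mem_allStr.1 hs]; exact size_str_le s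
    · rw [length_allStr]
      exact Nat.add_le_add_right (Nat.mul_le_mul h2 (by omega)) 1

/-- Logarithmically many random bits have polynomially many values. -/
theorem IsOLog.exists_polynomial {r : ℕ → ℕ} (hr : IsOLog r) :
    ∃ p : Polynomial ℕ, ∀ n, 2 ^ r n ≤ p.eval n := by
  obtain ⟨c, hc⟩ := hr.bound
  obtain ⟨N, hN⟩ := Filter.eventually_atTop.1 hc
  refine ⟨.C (∑ n ∈ Finset.range (N + 1), 2 ^ r n) + .X ^ ⌈c⌉₊, fun n => ?_⟩
  simp only [Polynomial.eval_add, Polynomial.eval_C, Polynomial.eval_pow, Polynomial.eval_X]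
  rcases lt_or_ge n (N + 1) with h | h
  · refine le_add_right ?_
    exact Finset.single_le_sum (f := fun n => 2 ^ r n) (fun _ _ => Nat.zero_le _)
      (Finset.mem_range.2 h)
  · refine le_add_left ?_
    have hn : (1 : ℝ) ≤ n := by exact_mod_cast (by omega : 1 ≤ n)
    have hlog := Real.log_nonneg hn
    have h1 := hN n (by omega)
    rw [Real.norm_of_nonneg (Nat.cast_nonneg _), Real.norm_of_nonneg hlog] at h1
    have h2 : (r n : ℝ) ≤ ⌈c⌉₊ * Real.log n :=
      h1.trans (mul_le_mul_of_nonneg_right (Nat.le_ceil c) hlog)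
    have h3 : ((2 : ℝ) ^ r n) ≤ (n : ℝ) ^ ⌈c⌉₊ := by
      calc (2 : ℝ) ^ r n ≤ Real.exp 1 ^ r n := by
            gcongr
            have := Real.add_one_le_exp (1 : ℝ)
            linarith
        _ = Real.exp (r n) := by rw [← Real.exp_nat_mul, mul_one]
        _ ≤ Real.exp (⌈c⌉₊ * Real.log n) := Real.exp_le_exp.2 h2
        _ = (n : ℝ) ^ ⌈c⌉₊ := by rw [Real.exp_nat_mul, Real.exp_log (by linarith)]
    exact_mod_cast h3

theorem hasGapReduction {q : ℕ} (hq : 1 ≤ q) {L : Language Bool} (hL : L ∈ PCPLog q) :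
    HasGapReduction L (1 / (2 * (q : ℝ) * 2 ^ q)) := by
  obtain ⟨r, hr, V, hV, hacc, hrej⟩ := hL
  obtain ⟨p, hp⟩ := hr.exists_polynomial
  refine ⟨fun x => formulaOf V.prog x (V.bound.eval x.length) q (stringsAbove (p.eval x.length)),
    ?_, fun x => ?_⟩
  · refine PT.toPolyTime (PT.encodeCNF3 ?_)
      (injective_code_option (injective_code_option injective_code_bool))
    refine (PT.id.stringsAbove p).flatMap (PT.map (PT.const (guesses q)) ?_)
    exact V.pt_clauseOf (PT.fst.comp PT.fst) (PT.snd.comp PT.fst) PT.snd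
  · obtain ⟨m, h1, h2⟩ := exists_stringsAbove_eq (p.eval x.length)
    have hm : r x.length ≤ m := by
      have := (hp x.length).trans_lt h2
      exact ((Nat.pow_lt_pow_iff_right (by norm_num)).1 this).le
    dsimp only
    rw [h1]
    refine ⟨?_, fun hx => ?_, fun hx τ => ?_⟩
    · rw [size_formulaOf, length_allStr]
      exact Nat.mul_pos (by positivity) (guesses_pos hq)
    · obtain ⟨w, hw⟩ := hacc x hx
      exact V.exists_numSat_eq_size hV hw hm q
    · exact V.numSat_le hq hV (hrej x hx) hm τ

/-! ### Reading formulas and assignments -/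

/-- Splits a string at the separators `none`. -/
def splitSeq {Γ : Type} (l : List (Option Γ)) : List (List Γ) :=
  l.foldr (fun o L => o.elim ([] :: L) fun a => (a :: L.headD []) :: L.tail) []

theorem splitSeq_encodeSeq {α Γ : Type} (e : α → List Γ) (l : List α) :
    splitSeq (encodeSeq e l) = l.map e := by
  have h : ∀ (u v : List Γ) (M : List (List Γ)), (u.map some).foldr
      (fun o L => o.elim ([] :: L) fun a => (a :: L.headD []) :: L.tail) (v :: M) =
        (u ++ v) :: M := by
    intro u v M
    induction u with
    | nil => rfl
    | cons a u ih => rw [List.map_cons, List.foldr_cons, ih]; rfl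
  induction l with
  | nil => rfl
  | cons a l ih =>
    simp only [splitSeq, encodeSeq] at ih
    rw [splitSeq, encodeSeq, List.flatMap_cons, List.append_assoc, List.foldr_append,
      List.singleton_append, List.foldr_cons, ih, Option.elim_none, h, List.append_nil,
      List.map_cons]

theorem size_splitSeq_le {Γ : Type} [Coded Γ] (l : List (Option Γ)) :
    size (splitSeq l) ≤ 5 * size l := by
  induction l with
  | nil => simp [splitSeq]
  | cons o l ih =>
    simp only [splitSeq] at ih
    rw [splitSeq, List.foldr_cons]
    generalize List.foldr _ [] l = M at ih
    rcases o with _ | a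
    · simp only [Option.elim_none, size_cons, size_nil, size_none]; omega
    · rcases M with _ | ⟨u, M⟩
      · simp only [Option.elim_some, List.headD_nil, List.tail_nil, size_cons, size_nil,
          size_some] at ih ⊢
        omega
      · simp only [Option.elim_some, List.headD_cons, List.tail_cons, size_cons,
          size_some] at ih ⊢
        omega

theorem PT.splitSeq {X Γ : Type} [Coded X] [Coded Γ] [Inhabited Γ] {l : X → List (Option Γ)}
    (hl : PT l) : PT fun x => splitSeq (l x) := by
  have e : ∀ l : List (Option Γ), l.foldl (fun L o =>
      if o.isSome then (o.getD default :: L.headD []) :: L.tail else [] :: L) [] =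
      Inapprox.splitSeq l.reverse := by
    intro l
    rw [Inapprox.splitSeq, List.foldr_reverse]
    congr 1
    funext L o
    cases o <;> rfl
  have := PT.foldl (init := fun _ => ([] : List (List Γ))) (f := fun _ L o =>
      if o.isSome then (o.getD default :: L.headD []) :: L.tail else [] :: L)
    (B := fun x => 5 * size (l x)) hl.reverse (PT.const [])
    (PT.ite (PT.isSome.comp PT.snd)
      ((((PT.getD default).comp PT.snd).cons ((PT.headD []).comp (PT.snd.comp PT.fst))).cons
        (PT.tail.comp (PT.snd.comp PT.fst)))
      ((PT.const []).cons (PT.snd.comp PT.fst)))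
    ((Bdd.const 5).mul (Bdd.size hl)) (fun x l' h => by
      rw [e]
      refine (size_splitSeq_le _).trans (Nat.mul_le_mul_left 5 ?_)
      rw [size_reverse, ← size_reverse (l x)]
      exact size_le_of_sublist h.sublist)
  exact this.congr fun x => by rw [e, List.reverse_reverse]

theorem encodeNat_injective : Function.Injective encodeNat :=
  Function.LeftInverse.injective decode_encodeNat

/-- The satisfied clauses can be selected on encoded formulas and assignments. -/
theorem PT.satClauses {X : Type} [Coded X] {C : X → List (List (List Bool))}
    {S : X → List (List Bool)} (hC : PT C) (hS : PT S) :
    PT fun x => (C x).filter fun c => c.any fun l => decide (l.tail ∈ S x) == l.headD false :=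
  hC.filter (PT.snd.any ((PT.tail.comp PT.snd).memBits
    (hS.comp (PT.fst.comp PT.fst)) |>.beq ((PT.headD false).comp PT.snd)))

theorem length_satClauses (φ : CNF3) (S : List ℕ) :
    ((φ.1.map (List.map encodeLiteral)).filter fun c => c.any fun l =>
      decide (l.tail ∈ S.map encodeNat) == l.headD false).length = φ.numSat (assignment S) := by
  rw [CNF3.numSat, ← List.countP_eq_length_filter, List.countP_map]
  congr 1
  funext c
  rw [Function.comp_apply, List.any_map, Clause.sat]
  congr 1
  funext l
  simp [encodeLiteral, assignment, encodeNat_injective.eq_iff]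

/-! ### Deciding a language with a gap reduction and an approximate algorithm -/

/-- A good approximation to a satisfiable formula satisfies more than the fraction `1 - 1 / D` of
its clauses, since `1 / (1 + ε) > 1 - ε`. -/
theorem lt_numSat_of_satisfiable {φ : CNF3} {D : ℕ} (hD : 1 ≤ D) {s : ℕ} (hφ : 1 ≤ φ.size)
    {τ : ℕ → Bool} (hτ : φ.numSat τ = φ.size) (hs : (s : ℝ) ≥ (φ.opt : ℝ) / (1 + 1 / D)) :
    (D - 1) * φ.size < D * s := by
  have hopt : φ.size ≤ φ.opt := hτ ▸ le_csSup φ.bddAbove_numSat ⟨τ, rfl⟩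
  have hopt' : (φ.size : ℝ) ≤ φ.opt := by exact_mod_cast hopt
  have hφ' : (1 : ℝ) ≤ φ.size := by exact_mod_cast hφ
  have hD' : (1 : ℝ) ≤ D := by exact_mod_cast hD
  rw [ge_iff_le, div_le_iff₀ (by positivity)] at hs
  have h1 : (φ.size : ℝ) * D ≤ s * (D + 1) := by
    calc (φ.size : ℝ) * D ≤ s * (1 + 1 / D) * D := by gcongr; linarith
      _ = s * (D + 1) := by field_simp
  have h2 : ((D : ℝ) - 1) * φ.size < D * s := by nlinarith
  rw [← Nat.cast_lt (α := ℝ)]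
  push_cast [hD]
  exact h2

theorem mul_numSat_le {φ : CNF3} {D : ℕ} (hD : 1 ≤ D) {s : ℕ}
    (hs : (s : ℝ) ≤ (1 - 1 / D) * φ.size) : D * s ≤ (D - 1) * φ.size := by
  have hD' : (1 : ℝ) ≤ D := by exact_mod_cast hD
  rw [← Nat.cast_le (α := ℝ)]
  push_cast [hD]
  calc (D : ℝ) * s ≤ D * ((1 - 1 / D) * φ.size) := by gcongr
    _ = (D - 1) * φ.size := by field_simp

/-- The decision procedure: compute the formula and an approximate solution, and compare the number
of satisfied clauses with the gap. -/
theorem mem_P_of_hasGapReduction {L : Language Bool} {D : ℕ} (hD : 1 ≤ D)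
    (hL : HasGapReduction L (1 / D)) {A : CNF3 → List ℕ} (hA : IsPolyTimeApprox (1 + 1 / D) A) :
    L ∈ P := by
  obtain ⟨f, hf, hgap⟩ := hL
  obtain ⟨hA, happrox⟩ := hA
  have h1 : PT fun x => encodeCNF3 (f x) := hf.toPT injective_code_bool (g := fun x => x) PT.id
  have h2 : PT fun x => encodeAssignment (A (f x)) :=
    (hA.comp hf).toPT injective_code_bool (g := fun x => x) PT.id
  have h3 : PT fun x => (f x).1.map (List.map encodeLiteral) :=
    (PT.map (f := fun _ c => splitSeq c) h1.splitSeq PT.snd.splitSeq).congr fun x => by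
      simp [encodeCNF3, splitSeq_encodeSeq, Function.comp_def]
  have h4 : PT fun x => (A (f x)).map encodeNat :=
    h2.splitSeq.congr fun x => by rw [encodeAssignment, splitSeq_encodeSeq]
  have h5 := h3.satClauses h4
  have h6 : PT fun x => decide ((D - 1) * (f x).size < D * (f x).numSat (assignment (A (f x)))) :=
    (PT.length_lt
      (PT.flatMap (f := fun x _ => (f x).1.map (List.map encodeLiteral))
        (PT.const (List.replicate (D - 1) ())) (h3.comp PT.fst))
      (PT.flatMap (f := fun x _ => ((f x).1.map (List.map encodeLiteral)).filter fun c =>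
          c.any fun l => decide (l.tail ∈ (A (f x)).map encodeNat) == l.headD false)
        (PT.const (List.replicate D ())) (h5.comp PT.fst))).congr fun x => congrArg enc <| by
        rw [List.length_flatMap, List.length_flatMap, length_satClauses, Bool.eq_iff_iff]
        simp [CNF3.size]
        exact decide_eq_true_iff.symm
  refine ⟨_, PT.toPolyTime (h6.cons (PT.const [])) injective_code_bool, fun x => ?_⟩
  rw [decide_eq_true_iff]
  obtain ⟨hsize, hmem, hnot⟩ := hgap x
  constructor
  · intro hx
    obtain ⟨τ, hτ⟩ := hmem hx
    exact lt_numSat_of_satisfiable hD hsize hτ (happrox (f x))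
  · intro h
    by_contra hx
    exact (mul_numSat_le hD (hnot hx _)).not_gt h

/-! ### P and NP -/

/-- The witness is ignored. -/
theorem P_subset_NP : P ⊆ NP := by
  rintro L ⟨f, hf, hL⟩
  have hsplit : PT fun s : Bool ⊕ Bool => (s.isRight, s.elim id id) :=
    (PolyTime.restrict (PT.id (α := Bool × Bool)) (fun s : Bool ⊕ Bool => (s.isRight, s.elim id id))
      fun s => by rcases s with b | b <;> rfl).congr fun _ => rfl
  have hfst : PT fun l : List (Bool ⊕ Bool) =>
      l.flatMap fun s => if s.isRight then [] else [s.elim id id] :=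
    PT.id.flatMap (f := fun _ (s : Bool ⊕ Bool) => if s.isRight then [] else [s.elim id id])
      (PT.ite (PT.fst.comp (hsplit.comp PT.snd)) (PT.const [])
        ((PT.snd.comp (hsplit.comp PT.snd)).cons (PT.const [])))
  have h : PolyTime (fun l => l) encodeBool fun l : List (Bool ⊕ Bool) =>
      f (l.flatMap fun s => if s.isRight then [] else [s.elim id id]) :=
    PT.toPolyTime (hf.toPT injective_code_bool hfst) injective_code_bool
  refine ⟨fun p => f p.1, 0, (h.restrict encodePair fun _ => rfl).congr fun p => ?_, fun x => ?_⟩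
  · rw [Function.comp_apply, encodePair_eq]
    have : ∀ l : List Bool, (l.flatMap fun _ => ([] : List Bool)) = [] := by simp
    simp [List.flatMap_append, List.flatMap_map, this]
  · rw [hL]
    exact ⟨fun h => ⟨[], Nat.zero_le _, h⟩, fun ⟨_, _, h⟩ => h⟩

theorem NPComplete.P_eq_NP {L : Language Bool} (hL : NPComplete L) (h : L ∈ P) : P = NP := by
  refine P_subset_NP.antisymm fun L' hL' => ?_
  obtain ⟨g, hg, hgL⟩ := hL.2 L' hL'
  obtain ⟨f, hf, hfL⟩ := h
  exact ⟨f ∘ g, hf.comp hg, fun x => (hgL x).trans (hfL (g x))⟩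

/-- A bounded number of queries is at most constant. -/
theorem exists_mem_PCPLog {L : Language Bool} (hL : L ∈ PCPLogConst) :
    ∃ q, 1 ≤ q ∧ L ∈ PCPLog q := by
  obtain ⟨r, q, hr, hq, V, hV, h⟩ := hL
  obtain ⟨c, hc⟩ := hq.bound
  obtain ⟨N, hN⟩ := Filter.eventually_atTop.1 hc
  refine ⟨∑ n ∈ Finset.range N, q n + ⌈c⌉₊ + 1, by omega, r, hr, V, fun x R w => ?_, h⟩
  refine ⟨(hV x R w).1, (hV x R w).2.trans ?_⟩
  dsimp only
  rcases lt_or_ge x.length N with hx | hx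
  · have := Finset.single_le_sum (f := q) (fun _ _ => Nat.zero_le _) (Finset.mem_range.2 hx)
    omega
  · have h1 := hN _ hx
    rw [Real.norm_of_nonneg (Nat.cast_nonneg _), norm_one, mul_one] at h1
    have h2 : q x.length ≤ ⌈c⌉₊ := by exact_mod_cast h1.trans (Nat.le_ceil c)
    omega

theorem mem_P_of_mem_PCPLog {q : ℕ} (hq : 1 ≤ q) {L : Language Bool} (hL : L ∈ PCPLog q)
    {A : CNF3 → List ℕ} (hA : IsPolyTimeApprox (1 + 1 / (2 * (q : ℝ) * 2 ^ q)) A) : L ∈ P := by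
  have hD : ((2 * q * 2 ^ q : ℕ) : ℝ) = 2 * (q : ℝ) * 2 ^ q := by push_cast; rfl
  refine mem_P_of_hasGapReduction (D := 2 * q * 2 ^ q) (Nat.mul_pos (by omega) (by positivity)) ?_
    (A := A) ?_
  · rw [hD]; exact hasGapReduction hq hL
  · rw [hD]; exact hA

end Inapprox

/-- The PCP Theorem implies that for some `ε₁ > 0` there is no polynomial-time
`(1 + ε₁)`-approximate algorithm for Max 3SAT unless P = NP. Moreover, languages with `q`-query
verifiers reduce to Max 3SAT with gap `1 / (2 q 2 ^ q)`, and this value of `ε₁` is good if the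
language is NP-complete. -/
theorem theorem2 :
    (Inapprox.NP = Inapprox.PCPLogConst →
      ∃ ε₁ : ℝ, 0 < ε₁ ∧
        ((∃ A : Inapprox.CNF3 → List ℕ, Inapprox.IsPolyTimeApprox (1 + ε₁) A) →
          Inapprox.P = Inapprox.NP)) ∧
    (∀ q : ℕ, 1 ≤ q → ∀ L ∈ Inapprox.PCPLog q,
      Inapprox.HasGapReduction L (1 / (2 * (q : ℝ) * 2 ^ q)) ∧
      (Inapprox.NPComplete L →
        (∃ A : Inapprox.CNF3 → List ℕ,
          Inapprox.IsPolyTimeApprox (1 + 1 / (2 * (q : ℝ) * 2 ^ q)) A) →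
        Inapprox.P = Inapprox.NP)) := by
  refine ⟨fun hPCP => ?_, fun q hq L hL => ⟨Inapprox.hasGapReduction hq hL, ?_⟩⟩
  · by_cases hP : Inapprox.P = Inapprox.NP
    · exact ⟨1, one_pos, fun _ => hP⟩
    -- Any language in NP that is not in P serves; none has to be known to be complete.
    obtain ⟨L, hL, hLP⟩ := Set.exists_of_ssubset (Inapprox.P_subset_NP.ssubset_of_ne hP)
    obtain ⟨q, hq, hLq⟩ := Inapprox.exists_mem_PCPLog (hPCP ▸ hL)
    have : (0 : ℝ) < q := by exact_mod_cast hq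
    exact ⟨1 / (2 * (q : ℝ) * 2 ^ q), by positivity,
      fun ⟨_, hA⟩ => (hLP (Inapprox.mem_P_of_mem_PCPLog hq hLq hA)).elim⟩
  · rintro hL' ⟨A, hA⟩
    exact hL'.P_eq_NP (Inapprox.mem_P_of_mem_PCPLog hq hL hA)
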